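/- **Setting.** Let $(\Omega,\mathcal F,P)$ be a probability space. A unit has covariates $X\in\mathcal X\subseteq\mathbb R^{d_x}$ and unobserved heterogeneity $\eta\in\mathcal H\subseteq\mathbb R$. The choice set $\mathcal Y$ is a compact interval containing the window $[k_0,k_1]$, with $k_0\le k\le k_1$ and the cutoff $k$ in the interior of $\mathcal Y$. For $d\in\{0,1\}$, $U_d(y,x,\eta)$ are payoffs, $m(d,x,\eta,\theta)$ structural equations ($\theta\in\Theta\subseteq\mathbb R^{d_\theta}$), $\theta_0\in\Theta$ is the true parameter and $Y^*(d)=m(d,X,\eta,\theta_0)$. Assume: 1. $U_d(\cdot,x,\eta)$ is strictly concave on $\mathcal Y$, and $U_0-U_1$ is $\le0$ for $y<k$, $=0$ at $y=k$, $\ge0$ for $y>k$. $Y^*(d)$ maximizes $U_d(\cdot,X,\eta)$ over $\mathcal Y$, and the desired choice $Y^*$ maximizes $U_0(y,X,\eta)1\{y\le k\}+U_1(y,X,\eta)1\{y>k\}$ over $\mathcal Y$. 2. For all $x\in\mathcal X$, $\theta\in\Theta$, $d$: $m(d,x,\cdot,\theta)$ is strictly increasing on $\mathcal H$; $m(d,\cdot,\cdot,\theta)$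 and the inverse $(x,y)\mapsto m^{-1}(d,x,y,\theta)$ (on the set where it is defined) are continuous; $k_1$ lies in the range of $m(1,x,\cdot,\theta)$. Put $R(y,x,\theta)=m(0,x,m^{-1}(1,x,y,\theta),\theta)$. 3. The observed choice $Y$ satisfies: $Y\in[k_0,k_1]$ if $Y^*=k$; $Y=Y^*$ if $Y\notin[k_0,k_1]$; $Y=Y^*$ if $Y^*\notin[k_0,k_1]$. For each $d$, $Y^*(d)$ has on a compact interval $\mathcal Y_d$, containing $k_d$ in its interior, a density that lies between two positive constants. 4. $T=\mathtt t(X)\ge0$ is bounded, and $E[T\mid Y^*(0)=y]\ge c>0$ on $\mathcal Y_0$. Put $P_T(A)=E[1_AT]/E[T]$. For each $\theta\in\Theta$ let $\bar k_1(\theta)\in[k,\max\mathcal Y_0]$ satisfy $P_T(R(k_1,X,\theta)>\bar k_1(\theta),\,Y\in[k_0,k_1])=0$, fix a version of the conditional law under $P_T$ of $R(k_1,X,\theta)$ given $Y^*(0)=y$, and let $g(\tau,\theta,y)$, $\tau\in(0,1)$, be its $\tau$-quantile. Functions $f$ and $(g_\tau)_{\tau\in(0,1)}$ on $[a,b]$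 *satisfy the analyticity condition* with constants $(\rho,\beta,\delta)$, $\rho>0$, $\beta,\delta\ge0$, if each has an analytic continuation to the $r$-neighbourhood of $[a,b]$ in $\mathbb C$ for some $r>\rho$ and (i) $\int_a^b\int_0^1|f(y+\rho e^{2\pi ix})|\,dx\,dy\le\beta\int_a^b|f(y)|\,dy$; (ii) $\sup_{x\in[0,1]}|g_\tau(y+\rho e^{2\pi ix})-y|\,1\{g_\tau(y)\ge y\}\le\delta\rho$ for all $y\in[a,b]$, $\tau\in(0,1)$; (iii) $|g_\tau(y+\rho e^{2\pi ix})|$ is bounded uniformly in $y\in[a,b]$, $\tau\in(0,1)$, $x\in[0,1]$. **Theorem.** Let $k_0=t_0<t_1<\dots<t_S=\bar k_1(\theta_0)$ with $S\ge1$, and let $$\bar f(y)=\sum_{s=1}^S\bar f_s(y)1\{y\in[t_{s-1},t_s)\},\qquad \underline f(y)=\sum_{s=1}^S\underline f_s(y)1\{y\in[t_{s-1},t_s)\}$$ satisfy $\int_{k_0}^y\underline f(z)\,dz\le P_T(k_0\le Y^*(0)\le y)\le\int_{k_0}^y\bar f(z)\,dz$ for all $y\in[k_0,\bar k_1(\theta_0)]$.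 Suppose that there are constants with $\delta\in[0,1)$ such that for all $\theta\in\Theta$ and $s=1,\dots,S$, on $[k_0,\bar k_1(\theta)]$, $\bar f_s$ and $(g(\tau,\theta,\cdot))_\tau$ satisfy the analyticity condition with $(\rho,\bar\beta,\delta)$, and $\underline f_s$ and $(g(\tau,\theta,\cdot))_\tau$ satisfy it with $(\rho,\underline\beta,\delta)$. Put $\bar f_0=\underline f_0=0$, $\Delta\bar f_s=\bar f_{s+1}-\bar f_s$, $\Delta\underline f_s=\underline f_{s+1}-\underline f_s$ and $$\bar B(\theta)=\sum_{s=0}^{S-1}\sum_{j=1}^\infty\frac1{j!}D_y^{j-1}\Big[E_{P_T}\big[(R(k_1,X,\theta)-t_s)_+^j\mid Y^*(0)=y\big]\,\Delta\bar f_s(y)\Big]_{y=t_s},$$ $$\underline B(\theta)=\sum_{s=0}^{S-1}\sum_{j=1}^\infty\frac1{j!}D_y^{j-1}\Big[E_{P_T}\big[(R(k_1,X,\theta)-t_s)_+^j\mid Y^*(0)=y\big]\,\Delta\underline f_s(y)\Big]_{y=t_s},$$ with derivatives taken in $[k_0,\bar k_1(\theta)]$ (so one-sided at end points). Then, for all $\theta\in\Theta$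 and $s<S$ with $t_s\le\bar k_1(\theta)$, these derivatives exist and the series over $j$ converge absolutely, and $$P_T(Y\in[k_0,k_1])\in[\underline B(\theta_0),\bar B(\theta_0)].$$ **Application (Lipschitz envelopes in the isoelastic model).** Let $\theta_0>0$, $\tau_0<\tau_1<1$, $\rho_d=1-\tau_d$, $0<K_0\le K\le K_1$, $\eta>0$ a random variable, and let $Y^*$ maximize over $y>0$ $$\rho_0(y-K)1\{y\le K\}+\rho_1(y-K)1\{y>K\}+c-\frac{\eta}{1+1/\theta_0}\Big(\frac y\eta\Big)^{1+1/\theta_0}.$$ Let $Y$ be related to $Y^*$ as in 3 with cutoff $K$ and window $[K_0,K_1]$. Suppose $\log\eta$ has a density that is Lipschitz with constant $M>0$ on $[\log(K_0\rho_0^{-\theta_0}),\log(K_1\rho_1^{-\theta_0})]$ and continuous at both end points. Let $f_y$ be a density of $\log Y$ outside $[\log K_0,\log K_1]$ with one-sided limits $a=f_y(\log K_0-)$, $b=f_y(\log K_1+)$, and let $B=P(Y\in[K_0,K_1])$. Then $$\theta_0\in\begin{cases}\varnothing&\text{if }B<\left|\frac{a^2-b^2}{2M}\right|,\\ [\underline\theta,\bar\theta]&\text{if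 }\left|\frac{a^2-b^2}{2M}\right|\le B<\frac{a^2+b^2}{2M},\\ [\underline\theta,\infty)&\text{if }\frac{a^2+b^2}{2M}\le B,\end{cases}$$ (in particular the first case does not occur), where $$\underline\theta=\frac{\frac{2}{M}\Big(-\frac{a+b}2+\sqrt{\frac{a^2+b^2}2+MB}\Big)-\log\frac{K_1}{K_0}}{\log(\rho_0/\rho_1)},\qquad \bar\theta=\frac{\frac{2}{M}\Big(\frac{a+b}2-\sqrt{\frac{a^2+b^2}2-MB}\Big)-\log\frac{K_1}{K_0}}{\log(\rho_0/\rho_1)}.$$ -/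

import Mathlib

open MeasureTheory ProbabilityTheory Set Filter
open scoped Topology

noncomputable section

/-! ### Analyticity condition -/

/-- `H` is a complex-analytic continuation of `h : [a, b] → ℝ` to the `R`-neighbourhood of `[a, b]`
in the complex plane, for some `R > ρ` (so that `H` makes sense on circles of radius `ρ`). -/
structure AnalyticContinuation (a b ρ : ℝ) (h : ℝ → ℝ) (H : ℂ → ℂ) : Prop where
  extends_real : ∀ y ∈ Icc a b, H (y : ℂ) = (h y : ℂ)
  holomorphic : ∃ R > ρ, DifferentiableOn ℂ H {z : ℂ | ∃ y ∈ Icc a b, ‖z - (y : ℂ)‖ < R}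

/-- The point `y + ρ e^{2 π i x}`. -/
def circlePoint (y ρ x : ℝ) : ℂ :=
  (y : ℂ) + (ρ : ℂ) * Complex.exp (2 * (Real.pi : ℂ) * Complex.I * (x : ℂ))

/-- The analyticity condition on `[a, b]` for `f` and `(g τ)_{τ ∈ (0,1)}`, with smoothness constants
`(ρ, β, δ)`. -/
def AnalyticityCondition (a b : ℝ) (f : ℝ → ℝ) (g : ℝ → ℝ → ℝ) (ρ β δ : ℝ) : Prop :=
  0 < ρ ∧ 0 ≤ β ∧ 0 ≤ δ ∧
  ∃ (F : ℂ → ℂ) (G : ℝ → ℂ → ℂ),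
    AnalyticContinuation a b ρ f F ∧
    (∀ τ ∈ Ioo (0 : ℝ) 1, AnalyticContinuation a b ρ (g τ) (G τ)) ∧
    (∫ y in a..b, ∫ x in (0 : ℝ)..1, ‖F (circlePoint y ρ x)‖) ≤ β * ∫ y in a..b, |f y| ∧
    (∀ y ∈ Icc a b, ∀ τ ∈ Ioo (0 : ℝ) 1, y ≤ g τ y →
      ∀ x ∈ Icc (0 : ℝ) 1, ‖G τ (circlePoint y ρ x) - (y : ℂ)‖ ≤ δ * ρ) ∧
    (∃ C : ℝ, ∀ y ∈ Icc a b, ∀ τ ∈ Ioo (0 : ℝ) 1, ∀ x ∈ Icc (0 : ℝ) 1,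
      ‖G τ (circlePoint y ρ x)‖ ≤ C)

/-! ### Conditional laws and quantiles -/

/-- `κ y` is a (regular) version of the conditional law of `W` given `V = y` under `Q`. -/
def IsCondLaw {Ω : Type*} [MeasurableSpace Ω] (Q : Measure Ω) (V W : Ω → ℝ)
    (κ : Kernel ℝ ℝ) : Prop :=
  IsMarkovKernel κ ∧ Q.map (fun ω => (V ω, W ω)) = (Q.map V) ⊗ₘ κ

/-- The `τ`-quantile of the law `κ y`. -/
def condQuantile (κ : Kernel ℝ ℝ) (τ y : ℝ) : ℝ :=
  sInf {x : ℝ | τ ≤ (κ y).real (Iic x)}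

/-- The probability measure `A ↦ E[1_A T] / E[T]`. -/
def weightedMeasure {Ω : Type*} [MeasurableSpace Ω] (P : Measure Ω) (T : Ω → ℝ) : Measure Ω :=
  P.withDensity (fun ω => ENNReal.ofReal (T ω / ∫ ω', T ω' ∂P))

/-! ### Bunching designs -/

/-- Observed choices and optimization frictions: bunchers are observed inside the window
`[k₀, k₁]`, and observed and desired choices coincide outside of the window. -/
structure FrictionWindow {Ω : Type*} (k k₀ k₁ : ℝ) (Ystar Y : Ω → ℝ) : Prop where
  buncher : ∀ ω, Ystar ω = k → Y ω ∈ Icc k₀ k₁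
  observed_outside : ∀ ω, Y ω ∉ Icc k₀ k₁ → Y ω = Ystar ω
  desired_outside : ∀ ω, Ystar ω ∉ Icc k₀ k₁ → Y ω = Ystar ω

/-- The objects of a bunching design, for a generic unit. -/
structure BunchingDesign (Ω : Type*) (dx dθ : ℕ) where
  /-- the range of the observed covariates -/
  covariates : Set (EuclideanSpace ℝ (Fin dx))
  /-- the range of the unobserved heterogeneity -/
  types : Set ℝ
  /-- the parameter space -/
  params : Set (EuclideanSpace ℝ (Fin dθ))
  /-- the true parameter -/
  θ₀ : EuclideanSpace ℝ (Fin dθ)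
  /-- the choice interval is `[yLo, yHi]` -/
  yLo : ℝ
  yHi : ℝ
  /-- the cutoff -/
  k : ℝ
  /-- the window of optimization errors is `[k₀, k₁]` -/
  k₀ : ℝ
  k₁ : ℝ
  /-- `[supLo d, supHi d]` is the interval on which the density of the counterfactual choice
  under policy `d` is bounded and positive -/
  supLo : Fin 2 → ℝ
  supHi : Fin 2 → ℝ
  /-- the counterfactual payoffs `U d y x η` -/
  U : Fin 2 → ℝ → EuclideanSpace ℝ (Fin dx) → ℝ → ℝ
  /-- the structural equations `m d x η θ` -/
  m : Fin 2 → EuclideanSpace ℝ (Fin dx) → ℝ → EuclideanSpace ℝ (Fin dθ) → ℝ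
  /-- covariates of the unit -/
  X : Ω → EuclideanSpace ℝ (Fin dx)
  /-- unobserved heterogeneity of the unit -/
  η : Ω → ℝ
  /-- desired choice of the unit under the actual policy -/
  Ystar : Ω → ℝ
  /-- observed choice of the unit -/
  Y : Ω → ℝ
  /-- the weight as a function of the covariates -/
  weight : EuclideanSpace ℝ (Fin dx) → ℝ

namespace BunchingDesign

variable {Ω : Type*} {dx dθ : ℕ} (D : BunchingDesign Ω dx dθ)

/-- The choice interval. -/
def choices : Set ℝ := Icc D.yLo D.yHi

/-- The compound payoff under the actual policy. -/
def payoff (y : ℝ) (x : EuclideanSpace ℝ (Fin dx)) (η : ℝ) : ℝ :=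
  if y ≤ D.k then D.U 0 y x η else D.U 1 y x η

/-- The counterfactual choice under policy `d`. -/
def counterfactual (d : Fin 2) (ω : Ω) : ℝ := D.m d (D.X ω) (D.η ω) D.θ₀

/-- The inverse of `η ↦ m d x η θ`, meaningful for `y` in the image of `D.types`. -/
def mInv (d : Fin 2) (x : EuclideanSpace ℝ (Fin dx)) (y : ℝ)
    (θ : EuclideanSpace ℝ (Fin dθ)) : ℝ :=
  Function.invFunOn (fun η => D.m d x η θ) D.types y

/-- The reversion. -/
def reversion (y : ℝ) (x : EuclideanSpace ℝ (Fin dx)) (θ : EuclideanSpace ℝ (Fin dθ)) : ℝ :=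
  D.m 0 x (D.mInv 1 x y θ) θ

/-- The weight of the unit. -/
def T (ω : Ω) : ℝ := D.weight (D.X ω)

/-- The weighted probability measure. -/
def PT [MeasurableSpace Ω] (P : Measure Ω) : Measure Ω := weightedMeasure P D.T

/-- The framework: location of the cutoff and of the window, ranges and measurability. -/
structure Framework [MeasurableSpace Ω] : Prop where
  cutoff_interior : D.k ∈ Ioo D.yLo D.yHi
  window_subset : Icc D.k₀ D.k₁ ⊆ D.choices
  cutoff_mem_window : D.k ∈ Icc D.k₀ D.k₁
  sup_interior₀ : D.k₀ ∈ Ioo (D.supLo 0) (D.supHi 0)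
  sup_interior₁ : D.k₁ ∈ Ioo (D.supLo 1) (D.supHi 1)
  true_param : D.θ₀ ∈ D.params
  X_mem : ∀ ω, D.X ω ∈ D.covariates
  η_mem : ∀ ω, D.η ω ∈ D.types
  measurable_X : Measurable D.X
  measurable_η : Measurable D.η
  measurable_Y : Measurable D.Y
  measurable_weight : Measurable D.weight

/-- Kinked payoffs, with the counterfactual and the desired choices as their maximizers. -/
structure KinkedPayoff : Prop where
  strictConcave : ∀ d, ∀ x ∈ D.covariates, ∀ η ∈ D.types,
    StrictConcaveOn ℝ D.choices (fun y => D.U d y x η)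
  below : ∀ x ∈ D.covariates, ∀ η ∈ D.types, ∀ y ∈ D.choices, y < D.k →
    D.U 0 y x η - D.U 1 y x η ≤ 0
  at_cutoff : ∀ x ∈ D.covariates, ∀ η ∈ D.types, D.U 0 D.k x η - D.U 1 D.k x η = 0
  above : ∀ x ∈ D.covariates, ∀ η ∈ D.types, ∀ y ∈ D.choices, D.k < y →
    0 ≤ D.U 0 y x η - D.U 1 y x η
  counterfactual_argmax : ∀ d ω, D.counterfactual d ω ∈ D.choices ∧
    IsMaxOn (fun y => D.U d y (D.X ω) (D.η ω)) D.choices (D.counterfactual d ω)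
  desired_argmax : ∀ ω, D.Ystar ω ∈ D.choices ∧
    IsMaxOn (fun y => D.payoff y (D.X ω) (D.η ω)) D.choices (D.Ystar ω)

/-- Invertible structural equations, continuous together with their inverses. The last field says
that the reversion is defined at the upper edge `k₁` of the window. -/
structure InvertibleEquations : Prop where
  strictMono : ∀ d, ∀ x ∈ D.covariates, ∀ θ ∈ D.params,
    StrictMonoOn (fun η => D.m d x η θ) D.types
  continuous_m : ∀ d, ∀ θ ∈ D.params,
    ContinuousOn (fun p : EuclideanSpace ℝ (Fin dx) × ℝ => D.m d p.1 p.2 θ)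
      (D.covariates ×ˢ D.types)
  continuous_mInv : ∀ d, ∀ θ ∈ D.params,
    ContinuousOn (fun p : EuclideanSpace ℝ (Fin dx) × ℝ => D.mInv d p.1 p.2 θ)
      {p | p.1 ∈ D.covariates ∧ p.2 ∈ (fun η => D.m d p.1 η θ) '' D.types}
  reversion_defined : ∀ x ∈ D.covariates, ∀ θ ∈ D.params,
    D.k₁ ∈ (fun η => D.m 1 x η θ) '' D.types

/-- Optimization frictions, and densities of the counterfactual choices bounded and bounded away
from zero. -/
structure DataAndFrictions [MeasurableSpace Ω] (P : Measure Ω) : Prop where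
  frictions : FrictionWindow D.k D.k₀ D.k₁ D.Ystar D.Y
  density : ∃ c₁ c₂ : ℝ, 0 < c₁ ∧ c₁ ≤ c₂ ∧ ∀ d, ∃ f : ℝ → ℝ, Measurable f ∧
    (∀ y ∈ Icc (D.supLo d) (D.supHi d), c₁ ≤ f y ∧ f y ≤ c₂) ∧
    (P.map (D.counterfactual d)).restrict (Icc (D.supLo d) (D.supHi d)) =
      (volume.restrict (Icc (D.supLo d) (D.supHi d))).withDensity
        (fun y => ENNReal.ofReal (f y))

/-- The weight is nonnegative and bounded, and its conditional mean given the counterfactual choice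
under policy `0` is bounded away from zero on `[supLo 0, supHi 0]`. -/
structure WeightCondition [MeasurableSpace Ω] (P : Measure Ω) : Prop where
  nonneg : ∀ ω, 0 ≤ D.T ω
  bounds : ∃ c₁ c₂ : ℝ, 0 < c₁ ∧ c₁ ≤ c₂ ∧ (∀ ω, D.T ω ≤ c₂) ∧
    ∀ᵐ ω ∂P, D.counterfactual 0 ω ∈ Icc (D.supLo 0) (D.supHi 0) →
      c₁ ≤ (P[D.T | MeasurableSpace.comap (D.counterfactual 0) inferInstance]) ω

/-- `kbar θ` is an upper limit of `R(k₁, X, θ)` on the event that the unit is observed in the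
window. -/
def IsUpperLimit [MeasurableSpace Ω] (P : Measure Ω)
    (kbar : EuclideanSpace ℝ (Fin dθ) → ℝ) : Prop :=
  ∀ θ ∈ D.params, kbar θ ∈ Icc D.k (D.supHi 0) ∧
    D.PT P {ω | kbar θ < D.reversion D.k₁ (D.X ω) θ ∧ D.Y ω ∈ Icc D.k₀ D.k₁} = 0

/-- `flow` and `fup` are integrated envelopes of the weighted law of the counterfactual choice under
policy `0` on `[k₀, b]`. -/
def EnvelopeCondition [MeasurableSpace Ω] (P : Measure Ω) (b : ℝ) (flow fup : ℝ → ℝ) : Prop :=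
  ∀ y ∈ Icc D.k₀ b,
    (D.PT P).real {ω | D.counterfactual 0 ω ∈ Icc D.k₀ y} ∈
      Icc (∫ z in D.k₀..y, flow z) (∫ z in D.k₀..y, fup z)

end BunchingDesign

/-! ### Piecewise functions and the bounds -/

/-- `∑_{s = 1}^{S} f_s(y) 1{y ∈ [t_{s-1}, t_s)}`. -/
def piecewiseFn (S : ℕ) (t : ℕ → ℝ) (f : ℕ → ℝ → ℝ) (y : ℝ) : ℝ :=
  ∑ s ∈ Finset.range S, (Ico (t s) (t (s + 1))).indicator (f (s + 1)) y

/-- The jump `f_{s+1} - f_s`, where `f_0` is read as `0`. -/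
def jumpFn (f : ℕ → ℝ → ℝ) (s : ℕ) (y : ℝ) : ℝ :=
  f (s + 1) y - if s = 0 then 0 else f s y

/-- `y ↦ E[(W - w)_+^j | V = y] h(y)`, where `κ` is the conditional law of `W` given `V`. -/
def momentFn (κ : Kernel ℝ ℝ) (w : ℝ) (j : ℕ) (h : ℝ → ℝ) (y : ℝ) : ℝ :=
  (∫ r, (max (r - w) 0) ^ j ∂(κ y)) * h y

/-- The term with index `j + 1` of the moment series at `w`,
`1 / (j+1)! D_y^j [E[(W - w)_+^{j+1} | V = y] h(y)]_{y = w}`, derivatives being taken in the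
interval `I`. -/
def momentTerm (κ : Kernel ℝ ℝ) (I : Set ℝ) (w : ℝ) (h : ℝ → ℝ) (j : ℕ) : ℝ :=
  iteratedDerivWithin j (momentFn κ w (j + 1) h) I w / (Nat.factorial (j + 1) : ℝ)

/-- The bound: sum over the knots of the moment series in the jumps. -/
def bunchingBound (κ : Kernel ℝ ℝ) (I : Set ℝ) (S : ℕ) (t : ℕ → ℝ) (f : ℕ → ℝ → ℝ) : ℝ :=
  ∑ s ∈ Finset.range S, ∑' j : ℕ, momentTerm κ I (t s) (jumpFn f s) j

/-- The moment series at the knot `t s` is well defined: the derivatives exist, and it converges. -/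
def MomentSeriesDefined (κ : Kernel ℝ ℝ) (I : Set ℝ) (t : ℕ → ℝ) (f : ℕ → ℝ → ℝ)
    (s : ℕ) : Prop :=
  (∀ j : ℕ, ContDiffOn ℝ (j : ℕ) (momentFn κ (t s) (j + 1) (jumpFn f s)) I) ∧
    Summable (momentTerm κ I (t s) (jumpFn f s))

/-! ### The isoelastic model -/

/-- The isoelastic payoff under the piecewise linear schedule with marginal tax rates `τ₀` up to the
cutoff `K` and `τ₁` above it, and after-tax income `c` at the cutoff. -/
def isoelasticPayoff (τ₀ τ₁ K c θ y η : ℝ) : ℝ :=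
  ((if y ≤ K then (1 - τ₀) * (y - K) else (1 - τ₁) * (y - K)) + c)
    - η / (1 + 1 / θ) * (y / η) ^ (1 + 1 / θ)

/-- The isoelastic model with elasticity `θ₀` and optimization frictions. -/
structure IsoelasticModel {Ω : Type*} [MeasurableSpace Ω] (τ₀ τ₁ K K₀ K₁ c θ₀ : ℝ)
    (η Ystar Y : Ω → ℝ) : Prop where
  rates : τ₀ < τ₁ ∧ τ₁ < 1
  elasticity_pos : 0 < θ₀
  window_pos : 0 < K₀
  cutoff_mem_window : K ∈ Icc K₀ K₁
  measurable_η : Measurable η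
  measurable_Y : Measurable Y
  η_pos : ∀ ω, 0 < η ω
  argmax : ∀ ω, 0 < Ystar ω ∧
    IsMaxOn (fun y => isoelasticPayoff τ₀ τ₁ K c θ₀ y (η ω)) (Ioi 0) (Ystar ω)
  frictions : FrictionWindow K K₀ K₁ Ystar Y

/-- `f` is a density of the law of `log η` that is Lipschitz with constant `M` on the (logarithm of
the) bunching interval `[lo, hi]` and continuous at its two end points. -/
structure LipschitzLogDensity {Ω : Type*} [MeasurableSpace Ω] (P : Measure Ω) (η : Ω → ℝ)
    (lo hi M : ℝ) (f : ℝ → ℝ) : Prop where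
  measurable : Measurable f
  nonneg : ∀ x, 0 ≤ f x
  isDensity : P.map (fun ω => Real.log (η ω)) = volume.withDensity (fun x => ENNReal.ofReal (f x))
  lipschitz : ∀ x ∈ Icc lo hi, ∀ y ∈ Icc lo hi, |f x - f y| ≤ M * |x - y|
  continuousAt_lo : ContinuousAt f lo
  continuousAt_hi : ContinuousAt f hi

/-- `g` is a density of the law of `y` outside of the window `[k₀, k₁]`, with limits `a` at `k₀` from
the left and `b` at `k₁` from the right. -/
structure ObservedDensity {Ω : Type*} [MeasurableSpace Ω] (P : Measure Ω) (y : Ω → ℝ)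
    (k₀ k₁ : ℝ) (g : ℝ → ℝ) (a b : ℝ) : Prop where
  measurable : Measurable g
  nonneg : ∀ x, 0 ≤ g x
  isDensity : (P.map y).restrict (Icc k₀ k₁)ᶜ =
    (volume.restrict (Icc k₀ k₁)ᶜ).withDensity (fun x => ENNReal.ofReal (g x))
  left_limit : Tendsto g (𝓝[<] k₀) (𝓝 a)
  right_limit : Tendsto g (𝓝[>] k₁) (𝓝 b)

/-- Lower elasticity bound; `a`, `b` are the one-sided limits of the observed log density at the
window, `M` the Lipschitz constant, `B` the bunching mass, `w` the length of the window of log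
income and `L` the log ratio of the net-of-tax rates. -/
def elasticityLower (a b M B w L : ℝ) : ℝ :=
  ((-((a + b) / 2) + Real.sqrt ((a ^ 2 + b ^ 2) / 2 + M * B)) / (M / 2) - w) / L

/-- Upper elasticity bound. -/
def elasticityUpper (a b M B w L : ℝ) : ℝ :=
  (((a + b) / 2 - Real.sqrt ((a ^ 2 + b ^ 2) / 2 - M * B)) / (M / 2) - w) / L

/-- The identified set for the elasticity. -/
def elasticitySet (a b M B w L : ℝ) : Set ℝ :=
  if B < |(a ^ 2 - b ^ 2) / (2 * M)| then ∅
  else if B < (a ^ 2 + b ^ 2) / (2 * M) then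
    Icc (elasticityLower a b M B w L) (elasticityUpper a b M B w L)
  else Ici (elasticityLower a b M B w L)

end

/-! ### Lagrange inversion on a disc -/

section Lagrange

open Complex Metric ComplexConjugate

/-! Write `V` for the counterfactual choice under policy `0` and `W` for the reversion of `k₁`. The
compound payoff is the pointwise minimum of the two concave payoffs, so the desired choice lies in
the window iff `k₀ ≤ V` and the choice under policy `1` is at most `k₁`; by monotonicity in the
type, the latter says `V ≤ W` (`observed_mem_window_iff`). Frictions do not change this event.

Given `V = v`, the law of `W` is that of the quantile `g_τ(v)` at a uniform `τ`. By Fubini the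
bunching mass is the integral over `τ` of the weighted mass of the set of those `v` in `[k₀, kbar]`
with `v ≤ g_τ(v)` (`IsCondLaw.measure_le_eq_integral`). At a zero of `g_τ(v) - v`, Cauchy's estimate
and the analyticity condition give `|g_τ'| ≤ δ < 1`. Hence this set is empty or an initial interval
`[k₀, a]` ending at a fixed point `a` of `g_τ` (`QuantileContinuation.le_condQuantile_iff`), and the
envelope condition bounds its mass by integrals of the envelopes over `[k₀, a]`.

The bounds compute these integrals without knowing `a`. Summation by parts turns the integral of a
piecewise function over `[k₀, a]` into integrals of the jumps over `[t_s, a]`, for the knots `t_s ≤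
a`. Lagrange inversion (`hasSum_lagrangeTerm`) expands each of them in derivatives at `t_s` of
powers of `g_τ - t_s` times the jump; for the other knots the positive part makes every term vanish.
All terms are at most a constant times `δ ^ j`, uniformly in `τ`, so integration over `τ` commutes
with derivatives and sums and turns powers of quantiles into conditional moments.

Lagrange inversion is proved with Cauchy's formula: the series sums under a contour integral to
`-log (1 - (G z - t) / (z - t))`, and integration by parts moves the derivative from the primitive
to the logarithm. What is left has residues only at `a` and `t`, since `z - G z` vanishes in the
disc only at `a`, to first order (`dslope_ne_one`, a strict form of the Schwarz-Pick lemma).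

In the application, the bunching mass is the integral of the density of `log η` over an interval
whose length is affine in the elasticity and at whose ends the density equals `a` and `b`. The
Lipschitz condition encloses the density between cones issuing from the two end values; integrating
the cones up to their crossing point gives quadratic inequalities for the length
(`mem_elasticitySet`). -/

lemma normSq_blaschke (ρ : ℝ) (u β : ℂ) :
    ‖(ρ : ℂ) ^ 2 - conj β * u‖ ^ 2 - ρ ^ 2 * ‖u - β‖ ^ 2 =
      (ρ ^ 2 - ‖u‖ ^ 2) * (ρ ^ 2 - ‖β‖ ^ 2) := by
  simp only [← normSq_eq_norm_sq, normSq_apply, sub_re, sub_im, mul_re, mul_im, conj_re,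
    conj_im, ofReal_re, ofReal_im, ← ofReal_pow]
  ring

/-- The Blaschke factor `ρ (w - β) / (ρ² - conj β w)` has modulus less than one inside the disc, and
one on its boundary (`blaschke_eq`); both follow from the sign of the right side of
`normSq_blaschke`. -/
lemma blaschke_lt {ρ : ℝ} (hρ : 0 < ρ) {w β : ℂ} (hw : ‖w‖ < ρ) (hβ : ‖β‖ < ρ) :
    ρ * ‖w - β‖ < ‖(ρ : ℂ) ^ 2 - conj β * w‖ := by
  have h := normSq_blaschke ρ w β
  have h1 : 0 < (ρ ^ 2 - ‖w‖ ^ 2) * (ρ ^ 2 - ‖β‖ ^ 2) := by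
    apply mul_pos <;> nlinarith [norm_nonneg w, norm_nonneg β]
  refine lt_of_pow_lt_pow_left₀ 2 (norm_nonneg _) ?_
  rw [mul_pow]; linarith

lemma blaschke_eq {ρ : ℝ} (hρ : 0 < ρ) {u β : ℂ} (hu : ‖u‖ = ρ) :
    ‖(ρ : ℂ) ^ 2 - conj β * u‖ = ρ * ‖u - β‖ := by
  have h := normSq_blaschke ρ u β
  rw [hu, sub_self, zero_mul] at h
  refine (pow_left_inj₀ (norm_nonneg _) (by positivity) two_ne_zero).1 ?_
  rw [mul_pow]; linarith

variable {t : ℂ} {ρ δ R : ℝ} {G F : ℂ → ℂ}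

/-- Maximum principle: the analyticity condition speaks only of the circle. -/
lemma norm_sub_le_of_sphere (hρ : 0 < ρ) (hR : ρ < R) (hG : DifferentiableOn ℂ G (ball t R))
    (hb : ∀ z ∈ sphere t ρ, ‖G z - t‖ ≤ δ * ρ) : ∀ z ∈ closedBall t ρ, ‖G z - t‖ ≤ δ * ρ := by
  intro z hz
  have hd : DiffContOnCl ℂ (fun z => G z - t) (ball t ρ) := by
    apply DifferentiableOn.diffContOnCl
    rw [closure_ball t hρ.ne']
    exact (hG.mono (closedBall_subset_ball hR)).sub_const t
  refine norm_le_of_forall_mem_frontier_norm_le isBounded_ball hd ?_ ?_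
  · rw [frontier_ball t hρ.ne']; exact hb
  · rwa [closure_ball t hρ.ne']

/-- A holomorphic map of a disc into a strictly smaller concentric disc, with fixed point `b`, does
not move points by the factor one relative to `b`. -/
lemma dslope_ne_one (hρ : 0 < ρ) (hR : ρ < R) (hδ : δ < 1) (hG : DifferentiableOn ℂ G (ball t R))
    (hb : ∀ z ∈ sphere t ρ, ‖G z - t‖ ≤ δ * ρ) {b : ℂ} (hbb : b ∈ ball t ρ) (hfix : G b = b) :
    ∀ z ∈ closedBall t ρ, dslope G b z ≠ 1 := by
  have hδρ : δ * ρ < ρ := by nlinarith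
  have hβ : ‖b - t‖ < ρ := by simpa [dist_eq_norm] using hbb
  have hcl := norm_sub_le_of_sphere hρ hR hG hb
  have hden : ∀ z ∈ closedBall t ρ, (ρ : ℂ) ^ 2 - conj (b - t) * (G z - t) ≠ 0 := by
    intro z hz h0
    have := blaschke_lt hρ ((hcl z hz).trans_lt hδρ) hβ
    rw [h0, norm_zero] at this
    exact absurd this (not_lt.2 (by positivity))
  -- The Blaschke factor of `G z - t` divided by that of `z - t`, both with their zero at `b - t`.
  -- The common zero at `z = b` is removed by `dslope`, so `h` is holomorphic on the closed disc; on
  -- the circle the denominator's factor has modulus one and the numerator's less than one.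
  set h : ℂ → ℂ := fun z => dslope G b z * ((ρ : ℂ) ^ 2 - conj (b - t) * (z - t)) /
    ((ρ : ℂ) ^ 2 - conj (b - t) * (G z - t)) with hh
  have hsub : closedBall t ρ ⊆ ball t R := closedBall_subset_ball hR
  have hbR : ball t R ∈ 𝓝 b := isOpen_ball.mem_nhds (hsub (ball_subset_closedBall hbb))
  have hds : DifferentiableOn ℂ (dslope G b) (closedBall t ρ) :=
    ((differentiableOn_dslope hbR).2 hG).mono hsub
  have hhd : DifferentiableOn ℂ h (closedBall t ρ) := by
    refine (hds.mul ?_).div ?_ hden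
    · fun_prop
    · exact (differentiableOn_const _).sub
        ((differentiableOn_const _).mul ((hG.mono hsub).sub_const t))
  have hlt : ∀ z ∈ sphere t ρ, ‖h z‖ < 1 := by
    intro z hz
    have hzc := sphere_subset_closedBall hz
    have hzb : z ≠ b := by
      rintro rfl
      rw [mem_sphere_iff_norm] at hz
      linarith
    have hzu : ‖z - t‖ = ρ := by simpa [dist_eq_norm] using hz
    have hz0 : 0 < ‖z - b‖ := norm_pos_iff.2 (sub_ne_zero.2 hzb)
    have e1 := blaschke_eq (β := b - t) hρ hzu
    have e2 := blaschke_lt hρ ((hcl z hzc).trans_lt hδρ) hβ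
    rw [sub_sub_sub_cancel_right] at e1 e2
    have hpos : 0 < ‖(ρ : ℂ) ^ 2 - conj (b - t) * (G z - t)‖ := norm_pos_iff.2 (hden z hzc)
    rw [hh]
    simp only
    rw [dslope_of_ne _ hzb, slope_def_field, hfix, norm_div, norm_mul, norm_div, e1, div_lt_one hpos]
    calc ‖G z - b‖ / ‖z - b‖ * (ρ * ‖z - b‖) = ρ * ‖G z - b‖ := by field_simp
      _ < _ := e2
  obtain ⟨z₀, hz₀, hmax⟩ := (isCompact_sphere t ρ).exists_isMaxOn
    (NormedSpace.sphere_nonempty.2 hρ.le)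
    (hhd.continuousOn.mono sphere_subset_closedBall).norm
  have hall : ∀ z ∈ closedBall t ρ, ‖h z‖ ≤ ‖h z₀‖ := by
    intro z hz
    refine norm_le_of_forall_mem_frontier_norm_le (U := ball t ρ) isBounded_ball ?_ ?_ ?_
    · apply DifferentiableOn.diffContOnCl
      rwa [closure_ball t hρ.ne']
    · rw [frontier_ball t hρ.ne']; exact fun z hz => hmax hz
    · rwa [closure_ball t hρ.ne']
  intro z hz h1
  -- Slope one relative to the fixed point `b` makes `z` itself a fixed point. Then the two
  -- remaining factors of `h z` agree, so that `h z = 1`, although `‖h‖ < 1` on the circle and hence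
  -- on the disc.
  have hGz : G z = z := by
    by_cases hzb : z = b
    · rw [hzb, hfix]
    · rw [dslope_of_ne _ hzb, slope_def_field, hfix, div_eq_one_iff_eq (sub_ne_zero.2 hzb)] at h1
      linear_combination h1
  have : h z = 1 := by
    simp only [hh]
    have := hden z hz
    rw [hGz] at this
    rw [h1, hGz, one_mul, div_self this]
  have h2 := hall z hz
  rw [this, norm_one] at h2
  exact absurd (hlt z₀ hz₀) (not_lt.2 h2)

/-- The term with index `j + 1` of the Lagrange inversion series. -/
noncomputable def lagrangeTerm (G F : ℂ → ℂ) (t : ℂ) (j : ℕ) : ℂ :=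
  iteratedDeriv j (fun z => (G z - t) ^ (j + 1) * F z) t / (Nat.factorial (j + 1) : ℂ)

/-- Cauchy's estimate on the circle of radius `ρ` bounds the derivative by `j! (δ ρ)^(j+1) C / ρ^j`,
and `j! ≤ (j+1)!`. -/
lemma norm_lagrangeTerm_le (hρ : 0 < ρ) (hR : ρ < R)
    (hG : DifferentiableOn ℂ G (ball t R)) (hF : DifferentiableOn ℂ F (ball t R))
    (hb : ∀ z ∈ sphere t ρ, ‖G z - t‖ ≤ δ * ρ) {C : ℝ} (hC : ∀ z ∈ sphere t ρ, ‖F z‖ ≤ C)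
    (j : ℕ) : ‖lagrangeTerm G F t j‖ ≤ C * ρ * δ * δ ^ j := by
  have hsub : closedBall t ρ ⊆ ball t R := closedBall_subset_ball hR
  have hd : DiffContOnCl ℂ (fun z => (G z - t) ^ (j + 1) * F z) (ball t ρ) := by
    apply DifferentiableOn.diffContOnCl
    rw [closure_ball t hρ.ne']
    exact (((hG.mono hsub).sub_const t).pow _).mul (hF.mono hsub)
  obtain ⟨z₀, hz₀⟩ := NormedSpace.sphere_nonempty (x := t).2 hρ.le
  have hδρ : 0 ≤ δ * ρ := (norm_nonneg _).trans (hb z₀ hz₀)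
  have hδ : 0 ≤ δ := nonneg_of_mul_nonneg_left hδρ hρ
  have hC0 : 0 ≤ C := (norm_nonneg _).trans (hC z₀ hz₀)
  have h1 := norm_iteratedDeriv_le_of_forall_mem_sphere_norm_le (C := (δ * ρ) ^ (j + 1) * C) j hρ hd
    (by
      intro z hz
      rw [norm_mul, norm_pow]
      exact mul_le_mul (pow_le_pow_left₀ (norm_nonneg _) (hb z hz) _) (hC z hz) (norm_nonneg _)
        (by positivity))
  rw [lagrangeTerm, norm_div, Complex.norm_natCast, div_le_iff₀ (by positivity)]
  refine h1.trans ?_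
  have : (j.factorial : ℝ) * ((δ * ρ) ^ (j + 1) * C) / ρ ^ j =
      C * ρ * δ * δ ^ j * j.factorial := by
    field_simp
    ring
  rw [this]
  gcongr
  exact Nat.le_succ j

/-- Cauchy's formula for the derivative of order `j`; the quotient `j! / (j+1)!` becomes the
coefficient `1 / (j+1)` of the logarithmic series. -/
lemma lagrangeTerm_eq_circleIntegral (hρ : 0 < ρ) (hR : ρ < R)
    (hG : DifferentiableOn ℂ G (ball t R)) (hF : DifferentiableOn ℂ F (ball t R)) (j : ℕ) :
    2 * Real.pi * I * lagrangeTerm G F t j =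
      ∮ z in C(t, ρ), F z * (((G z - t) / (z - t)) ^ (j + 1) / (j + 1)) := by
  have hsub : closedBall t ρ ⊆ ball t R := closedBall_subset_ball hR
  have hd : DifferentiableOn ℂ (fun z => (G z - t) ^ (j + 1) * F z) (closedBall t ρ) :=
    (((hG.mono hsub).sub_const t).pow _).mul (hF.mono hsub)
  have h1 := hd.circleIntegral_one_div_sub_center_pow_smul hρ j
  have h2 : (∮ z in C(t, ρ), F z * (((G z - t) / (z - t)) ^ (j + 1) / (j + 1))) =
      ∮ z in C(t, ρ), ((j : ℂ) + 1)⁻¹ * ((1 / (z - t) ^ (j + 1)) • ((G z - t) ^ (j + 1) * F z)) := by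
    congr 1; ext z; rw [div_pow, smul_eq_mul]; ring
  rw [h2, circleIntegral.integral_const_mul, h1, lagrangeTerm, smul_eq_mul, Nat.factorial_succ]
  have : (j.factorial : ℂ) ≠ 0 := by exact_mod_cast j.factorial_ne_zero
  have h3 : (j : ℂ) + 1 ≠ 0 := by exact_mod_cast j.succ_ne_zero
  push_cast
  field_simp

/-- **Lagrange inversion**: the series in the derivatives at `t` sums to the increment of a
primitive `Φ` of `F` from `t` to the fixed point `a` of `G`. -/
theorem hasSum_lagrangeTerm {Φ : ℂ → ℂ} (hρ : 0 < ρ) (hR : ρ < R) (hδ : δ < 1)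
    (hG : DifferentiableOn ℂ G (ball t R)) (hF : DifferentiableOn ℂ F (ball t R))
    (hb : ∀ z ∈ sphere t ρ, ‖G z - t‖ ≤ δ * ρ) (hΦ : ∀ z ∈ ball t R, HasDerivAt Φ (F z) z)
    {a : ℂ} (ha : a ∈ ball t ρ) (hfix : G a = a) :
    HasSum (lagrangeTerm G F t) (Φ a - Φ t) := by
  have hsub : closedBall t ρ ⊆ ball t R := closedBall_subset_ball hR
  have hsubs : sphere t ρ ⊆ ball t R := sphere_subset_closedBall.trans hsub
  have haR : ball t R ∈ 𝓝 a := isOpen_ball.mem_nhds (hsub (ball_subset_closedBall ha))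
  have hzt : ∀ z ∈ sphere t ρ, z - t ≠ 0 := by
    intro z hz h0
    rw [mem_sphere_iff_norm, h0, norm_zero] at hz
    exact hρ.ne hz
  have hza : ∀ z ∈ sphere t ρ, z - a ≠ 0 := by
    intro z hz h0
    rw [sub_eq_zero] at h0
    subst h0
    rw [mem_sphere] at hz
    rw [mem_ball] at ha
    linarith
  have hr : ∀ z ∈ sphere t ρ, ‖(G z - t) / (z - t)‖ ≤ δ := by
    intro z hz
    have : ‖z - t‖ = ρ := by simpa [dist_eq_norm] using hz
    rw [norm_div, this, div_le_iff₀ hρ]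
    exact hb z hz
  obtain ⟨z₀, hz₀⟩ := NormedSpace.sphere_nonempty (x := t).2 hρ.le
  have hδ0 : 0 ≤ δ := (norm_nonneg _).trans (hr z₀ hz₀)
  obtain ⟨C, hC⟩ := (isCompact_sphere t ρ).exists_bound_of_continuousOn
    (hF.continuousOn.mono hsubs)
  -- the series under the integral sign
  have hsum : HasSum (fun j => 2 * Real.pi * I * lagrangeTerm G F t j)
      (∮ z in C(t, ρ), F z * -log (1 - (G z - t) / (z - t))) := by
    simp_rw [lagrangeTerm_eq_circleIntegral hρ hR hG hF]
    have hcont : ∀ j : ℕ, ContinuousOn (fun z => F z * (((G z - t) / (z - t)) ^ (j + 1) / (j + 1)))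
        (sphere t ρ) := by
      intro j
      refine (hF.continuousOn.mono hsubs).mul (ContinuousOn.div_const (ContinuousOn.pow ?_ _) _)
      exact ((hG.continuousOn.mono hsubs).sub continuousOn_const).div (by fun_prop) hzt
    unfold circleIntegral
    refine intervalIntegral.hasSum_integral_of_dominated_convergence
      (fun j _ => ρ * (C * δ ^ (j + 1))) ?_ ?_ ?_ ?_ ?_
    · intro j
      refine Continuous.aestronglyMeasurable ?_
      simp only [smul_eq_mul]
      refine Continuous.mul ?_ ((hcont j).comp_continuous (continuous_circleMap t ρ)
        (circleMap_mem_sphere t hρ.le))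
      rw [show deriv (circleMap t ρ) = _ from funext fun θ => deriv_circleMap t ρ θ]
      fun_prop
    · intro j
      refine Eventually.of_forall fun θ _ => ?_
      have hm := circleMap_mem_sphere t hρ.le θ
      rw [norm_smul, norm_mul]
      have e1 : ‖deriv (circleMap t ρ) θ‖ = ρ := by simp [deriv_circleMap, abs_of_pos hρ]
      rw [e1]
      have e2 : ‖((G (circleMap t ρ θ) - t) / (circleMap t ρ θ - t)) ^ (j + 1) / ((j : ℂ) + 1)‖ ≤
          δ ^ (j + 1) := by
        rw [norm_div, norm_pow]
        have : (1 : ℝ) ≤ ‖(j : ℂ) + 1‖ := by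
          have : ‖(j : ℂ) + 1‖ = (j : ℝ) + 1 := by exact_mod_cast Complex.norm_natCast (j + 1)
          rw [this]; linarith [(Nat.cast_nonneg j : (0 : ℝ) ≤ j)]
        refine (div_le_self (by positivity) this).trans ?_
        exact pow_le_pow_left₀ (norm_nonneg _) (hr _ hm) _
      exact mul_le_mul_of_nonneg_left (mul_le_mul (hC _ hm) e2 (norm_nonneg _)
        ((norm_nonneg _).trans (hC _ hm))) hρ.le
    · refine Eventually.of_forall fun θ _ => ?_
      have := (summable_geometric_of_lt_one hδ0 hδ).mul_left (ρ * (C * δ))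
      refine this.congr fun j => ?_
      ring
    · exact intervalIntegrable_const
    · refine Eventually.of_forall fun θ _ => ?_
      have hm := circleMap_mem_sphere t hρ.le θ
      exact ((hasSum_taylorSeries_neg_log' ((hr _ hm).trans_lt hδ)).mul_left _).const_smul _
  -- integration by parts
  set q : ℂ → ℂ := fun z => 1 - dslope G a z with hq
  have hqd : DifferentiableOn ℂ q (ball t R) :=
    ((differentiableOn_dslope haR).2 hG).const_sub 1
  -- Here `z - G z = (z - a) q z`, so this says that `a` is the only fixed point in the disc and a
  -- simple zero of `z - G z`.
  have hq0 : ∀ z ∈ closedBall t ρ, q z ≠ 0 := fun z hz h0 =>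
    dslope_ne_one hρ hR hδ hG hb ha hfix z hz (sub_eq_zero.1 h0).symm
  have hqG : ∀ z, z ≠ a → (z - a) * q z = z - G z := by
    intro z hz
    have := sub_ne_zero.2 hz
    simp only [hq]
    rw [dslope_of_ne _ hz, slope_def_field, hfix]
    field_simp
    ring
  have hlog : ∀ z ∈ sphere t ρ, 1 - (G z - t) / (z - t) = (z - a) * q z / (z - t) := by
    intro z hz
    rw [hqG z (sub_ne_zero.1 (hza z hz))]
    have := hzt z hz
    field_simp
    ring
  have hΦd : DifferentiableOn ℂ Φ (ball t R) := fun z hz =>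
    (hΦ z hz).differentiableAt.differentiableWithinAt
  have hqd' : DifferentiableOn ℂ (fun z => Φ z * (deriv q z / q z)) (closedBall t ρ) :=
    (hΦd.mono hsub).mul (((hqd.deriv isOpen_ball).mono hsub).div (hqd.mono hsub) hq0)
  -- The integrand is the derivative of `Φ z * log ((z - a) q z / (z - t))`. On the circle the
  -- argument of the logarithm stays within distance `δ < 1` of `1`, so the principal branch is
  -- differentiable there and the integral around the closed circle vanishes.
  have hparts : (∮ z in C(t, ρ), (F z * log ((z - a) * q z / (z - t)) +
      Φ z * (1 / (z - a) + deriv q z / q z - 1 / (z - t)))) = 0 := by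
    refine circleIntegral.integral_eq_zero_of_hasDerivWithinAt hρ.le
      (f := fun z => Φ z * log ((z - a) * q z / (z - t))) fun z hz => ?_
    have hzR := hsubs hz
    have hslit : (z - a) * q z / (z - t) ∈ slitPlane := by
      rw [← hlog z hz]
      exact mem_slitPlane_of_norm_lt_one (by
        rw [norm_neg]; exact (hr z hz).trans_lt hδ)
    have h1 := hzt z hz
    have h2 := hza z hz
    have h3 := hq0 z (sphere_subset_closedBall hz)
    have hdq : HasDerivAt q (deriv q z) z :=
      (hqd.differentiableAt (isOpen_ball.mem_nhds hzR)).hasDerivAt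
    have hd := ((((hasDerivAt_id z).sub_const a).mul hdq).div ((hasDerivAt_id z).sub_const t) h1).clog
      hslit
    refine (((hΦ z hzR).mul hd).congr_deriv ?_).hasDerivWithinAt
    simp only [Pi.mul_apply, Pi.div_apply, id]
    field_simp
  have hca : ∀ w ∈ ball t ρ, CircleIntegrable (fun z => Φ z / (z - w)) t ρ ∧
      (∮ z in C(t, ρ), Φ z / (z - w)) = 2 * Real.pi * I * Φ w := by
    intro w hw
    constructor
    · refine ContinuousOn.circleIntegrable hρ.le ?_
      refine (hΦd.continuousOn.mono hsubs).div (by fun_prop) fun z hz h0 => ?_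
      rw [sub_eq_zero] at h0
      subst h0
      rw [mem_sphere] at hz
      rw [mem_ball] at hw
      linarith
    · exact circleIntegral_div_sub_of_differentiable_on_off_countable countable_empty hw
        (hΦd.continuousOn.mono hsub) fun z hz =>
          (hΦ z (hsub (ball_subset_closedBall hz.1))).differentiableAt
  -- Cauchy's theorem: `q` has no zero in the closed disc, so this part has no residue.
  have hI3 : (∮ z in C(t, ρ), Φ z * (deriv q z / q z)) = 0 :=
    circleIntegral_eq_zero_of_differentiable_on_off_countable hρ.le countable_empty
      hqd'.continuousOn fun z hz => hqd'.differentiableAt (closedBall_mem_nhds_of_mem hz.1)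
  have hI3c : CircleIntegrable (fun z => Φ z * (deriv q z / q z)) t ρ :=
    (hqd'.continuousOn.mono sphere_subset_closedBall).circleIntegrable hρ.le
  have hlogc : CircleIntegrable (fun z => F z * -log (1 - (G z - t) / (z - t))) t ρ := by
    refine ContinuousOn.circleIntegrable hρ.le ((hF.continuousOn.mono hsubs).mul
      (ContinuousOn.neg (ContinuousOn.clog ?_ ?_)))
    · exact continuousOn_const.sub
        (((hG.continuousOn.mono hsubs).sub continuousOn_const).div (by fun_prop) hzt)
    · intro z hz
      exact mem_slitPlane_of_norm_lt_one (by
        rw [norm_neg]; exact (hr z hz).trans_lt hδ)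
  have hkey : (∮ z in C(t, ρ), F z * -log (1 - (G z - t) / (z - t))) =
      2 * Real.pi * I * (Φ a - Φ t) := by
    have e1 : (∮ z in C(t, ρ), (F z * log ((z - a) * q z / (z - t)) +
        Φ z * (1 / (z - a) + deriv q z / q z - 1 / (z - t)))) =
        ∮ z in C(t, ρ), (((Φ z / (z - a) + Φ z * (deriv q z / q z)) - Φ z / (z - t)) -
          F z * -log (1 - (G z - t) / (z - t))) := by
      refine circleIntegral.integral_congr hρ.le fun z hz => ?_
      rw [hlog z hz]
      ring
    have ha' := hca a ha
    have ht' := hca t (mem_ball_self hρ)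
    have e2 := circleIntegral.integral_sub ((ha'.1.add hI3c).sub ht'.1) hlogc
    have e3 := circleIntegral.integral_sub (ha'.1.add hI3c) ht'.1
    have e4 := circleIntegral.integral_add ha'.1 hI3c
    simp only [Pi.add_apply, Pi.sub_apply] at e2 e3 e4
    rw [e1, e2, e3, e4, ha'.2, ht'.2, hI3] at hparts
    linear_combination -hparts
  rw [hkey] at hsum
  have h2pi : (2 * Real.pi * I : ℂ) ≠ 0 := two_pi_I_ne_zero
  exact (hasSum_mul_left_iff h2pi).1 hsum

end Lagrange

/-! ### Families of functions with uniformly bounded derivatives -/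

section UniformFamilies

/-- The members of the family `h τ`, `τ ∈ T`, are continuous and uniformly bounded on `I`, and the
family is measurable in the index. -/
structure BoundedFamily {α : Type*} [MeasurableSpace α] (ν : Measure α) (T : Set α) (I : Set ℝ)
    (h : α → ℝ → ℝ) : Prop where
  measurable : ∀ y ∈ I, AEStronglyMeasurable (fun τ => h τ y) ν
  continuousOn : ∀ τ ∈ T, ContinuousOn (h τ) I
  bounded : ∃ C, ∀ τ ∈ T, ∀ y ∈ I, |h τ y| ≤ C

/-- The family `h τ`, `τ ∈ T`, has `n` continuous derivatives on `I`, which are uniformly bounded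
and measurable in the index. -/
def SmoothFamily {α : Type*} [MeasurableSpace α] (ν : Measure α) (T : Set α) (I : Set ℝ) :
    ℕ → (α → ℝ → ℝ) → Prop
  | 0, h => BoundedFamily ν T I h
  | n + 1, h => BoundedFamily ν T I h ∧ ∃ h' : α → ℝ → ℝ,
      (∀ τ ∈ T, ∀ y ∈ I, HasDerivWithinAt (h τ) (h' τ y) I y) ∧ SmoothFamily ν T I n h'

variable {α : Type*} [MeasurableSpace α] {ν : Measure α} {T : Set α} {I : Set ℝ}
  {g h u v : α → ℝ → ℝ} {n : ℕ}

lemma BoundedFamily.add (hg : BoundedFamily ν T I g) (hh : BoundedFamily ν T I h) :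
    BoundedFamily ν T I (fun τ y => g τ y + h τ y) := by
  refine ⟨fun y hy => (hg.measurable y hy).add (hh.measurable y hy),
    fun τ hτ => (hg.continuousOn τ hτ).add (hh.continuousOn τ hτ), ?_⟩
  obtain ⟨C, hC⟩ := hg.bounded
  obtain ⟨C', hC'⟩ := hh.bounded
  exact ⟨C + C', fun τ hτ y hy => (abs_add_le _ _).trans (add_le_add (hC τ hτ y hy) (hC' τ hτ y hy))⟩

lemma BoundedFamily.mul (hg : BoundedFamily ν T I g) (hh : BoundedFamily ν T I h) :
    BoundedFamily ν T I (fun τ y => g τ y * h τ y) := by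
  refine ⟨fun y hy => (hg.measurable y hy).mul (hh.measurable y hy),
    fun τ hτ => (hg.continuousOn τ hτ).mul (hh.continuousOn τ hτ), ?_⟩
  obtain ⟨C, hC⟩ := hg.bounded
  obtain ⟨C', hC'⟩ := hh.bounded
  refine ⟨C * C', fun τ hτ y hy => ?_⟩
  rw [abs_mul]
  exact mul_le_mul (hC τ hτ y hy) (hC' τ hτ y hy) (abs_nonneg _)
    ((abs_nonneg _).trans (hC τ hτ y hy))

lemma BoundedFamily.const (c : ℝ) : BoundedFamily ν T I (fun _ _ => c) :=
  ⟨fun _ _ => aestronglyMeasurable_const, fun _ _ => continuousOn_const,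
    |c|, fun _ _ _ _ => le_rfl⟩

lemma BoundedFamily.posPart (hg : BoundedFamily ν T I g) :
    BoundedFamily ν T I (fun τ y => max (g τ y) 0) := by
  refine ⟨fun y hy => (hg.measurable y hy).sup aestronglyMeasurable_const,
    fun τ hτ => ContinuousOn.sup (hg.continuousOn τ hτ) continuousOn_const, ?_⟩
  obtain ⟨C, hC⟩ := hg.bounded
  refine ⟨C, fun τ hτ y hy => ?_⟩
  have := hC τ hτ y hy
  rw [abs_le] at this ⊢
  constructor
  · linarith [le_max_right (g τ y) 0, abs_nonneg (g τ y)]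
  · exact max_le this.2 (by linarith)

lemma BoundedFamily.pow (hg : BoundedFamily ν T I g) (k : ℕ) :
    BoundedFamily ν T I (fun τ y => g τ y ^ k) := by
  induction k with
  | zero => simpa using BoundedFamily.const (ν := ν) (T := T) (I := I) 1
  | succ k ih => simpa only [pow_succ] using ih.mul hg

lemma SmoothFamily.boundedFamily (hg : SmoothFamily ν T I n g) : BoundedFamily ν T I g := by
  cases n with
  | zero => exact hg
  | succ n => exact hg.1

lemma SmoothFamily.of_succ (hg : SmoothFamily ν T I (n + 1) g) : SmoothFamily ν T I n g := by
  induction n generalizing g with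
  | zero => exact hg.1
  | succ n ih =>
    obtain ⟨h0, g', hg', hs⟩ := hg
    exact ⟨h0, g', hg', ih hs⟩

lemma SmoothFamily.const (n : ℕ) (c : ℝ) : SmoothFamily ν T I n (fun _ _ => c) := by
  induction n generalizing c with
  | zero => exact BoundedFamily.const c
  | succ n ih =>
    exact ⟨BoundedFamily.const c, fun _ _ => 0, fun _ _ y _ => hasDerivWithinAt_const y I c, ih 0⟩

lemma SmoothFamily.add (hg : SmoothFamily ν T I n g) (hh : SmoothFamily ν T I n h) :
    SmoothFamily ν T I n (fun τ y => g τ y + h τ y) := by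
  induction n generalizing g h with
  | zero => exact BoundedFamily.add hg hh
  | succ n ih =>
    obtain ⟨hg0, g', hg', hgs⟩ := hg
    obtain ⟨hh0, h', hh', hhs⟩ := hh
    exact ⟨hg0.add hh0, fun τ y => g' τ y + h' τ y,
      fun τ hτ y hy => (hg' τ hτ y hy).add (hh' τ hτ y hy), ih hgs hhs⟩

lemma SmoothFamily.mul (hg : SmoothFamily ν T I n g) (hh : SmoothFamily ν T I n h) :
    SmoothFamily ν T I n (fun τ y => g τ y * h τ y) := by
  induction n generalizing g h with
  | zero => exact BoundedFamily.mul hg hh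
  | succ n ih =>
    have hgp := hg.of_succ
    have hhp := hh.of_succ
    obtain ⟨hg0, g', hg', hgs⟩ := hg
    obtain ⟨hh0, h', hh', hhs⟩ := hh
    exact ⟨hg0.mul hh0, fun τ y => g' τ y * h τ y + g τ y * h' τ y,
      fun τ hτ y hy => (hg' τ hτ y hy).mul (hh' τ hτ y hy), (ih hgs hhp).add (ih hgp hhs)⟩

/-- An exponent of at least two removes the kink: at zero the function is bounded by `|x| ^ (k +
2)`, which is `o(x)`. -/
lemma hasDerivAt_posPart_pow (k : ℕ) (x : ℝ) :
    HasDerivAt (fun x : ℝ => max x 0 ^ (k + 2)) ((k + 2) * max x 0 ^ (k + 1)) x := by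
  rcases lt_trichotomy x 0 with hx | rfl | hx
  · rw [max_eq_right hx.le, zero_pow (Nat.succ_ne_zero _), mul_zero]
    refine (hasDerivAt_const x (0 : ℝ)).congr_of_eventuallyEq ?_
    filter_upwards [gt_mem_nhds hx] with z hz
    rw [max_eq_right hz.le, zero_pow (Nat.succ_ne_zero _)]
  · rw [max_self, zero_pow (Nat.succ_ne_zero _), mul_zero, hasDerivAt_iff_isLittleO]
    have h1 : (fun x : ℝ => x ^ (k + 2)) =o[𝓝 0] fun x => x := by
      simpa using Asymptotics.isLittleO_pow_pow (𝕜 := ℝ) (show 1 < k + 2 by omega)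
    have h2 : (fun x : ℝ => max x 0 ^ (k + 2)) =O[𝓝 0] fun x => x ^ (k + 2) := by
      refine Asymptotics.IsBigO.of_bound 1 (Eventually.of_forall fun z => ?_)
      rw [one_mul, norm_pow, norm_pow]
      refine pow_le_pow_left₀ (norm_nonneg _) ?_ _
      rw [Real.norm_eq_abs, Real.norm_eq_abs, abs_of_nonneg (le_max_right _ _)]
      exact max_le (le_abs_self z) (abs_nonneg z)
    simpa using h2.trans_isLittleO h1
  · rw [max_eq_left hx.le]
    have := hasDerivAt_pow (k + 2) x
    refine (this.congr_of_eventuallyEq ?_).congr_deriv ?_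
    · filter_upwards [lt_mem_nhds hx] with z hz
      rw [max_eq_left hz.le]
    · push_cast; rfl

/-- The derivative of `u_+^{k+2} v` on `I`. -/
lemma hasDerivWithinAt_posPart_pow_mul {u v : ℝ → ℝ} {u' v' y : ℝ} (k : ℕ)
    (hu : HasDerivWithinAt u u' I y) (hv : HasDerivWithinAt v v' I y) :
    HasDerivWithinAt (fun y => max (u y) 0 ^ (k + 2) * v y)
      (max (u y) 0 ^ (k + 1) * ((k + 2) * u' * v y + u y * v')) I y := by
  have h1 : HasDerivWithinAt (fun y => max (u y) 0 ^ (k + 2))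
      ((k + 2) * max (u y) 0 ^ (k + 1) * u') I y :=
    (hasDerivAt_posPart_pow k (u y)).comp_hasDerivWithinAt y hu
  refine (h1.mul hv).congr_deriv ?_
  have : max (u y) 0 ^ (k + 2) = max (u y) 0 ^ (k + 1) * u y := by
    rcases le_total (u y) 0 with h | h
    · simp [max_eq_right h]
    · rw [max_eq_left h]; ring
  rw [this]; ring

lemma hasDerivWithinAt_pow_mul {u v : ℝ → ℝ} {u' v' y : ℝ} (k : ℕ)
    (hu : HasDerivWithinAt u u' I y) (hv : HasDerivWithinAt v v' I y) :
    HasDerivWithinAt (fun y => u y ^ (k + 2) * v y)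
      (u y ^ (k + 1) * ((k + 2) * u' * v y + u y * v')) I y := by
  refine ((hu.pow (k + 2)).mul hv).congr_deriv ?_
  push_cast [Pi.pow_apply, Nat.add_sub_cancel]
  ring

/-- One differentiation lowers the exponent and the smoothness available by one each and reproduces
the form `u_+ ^ k * v` with a new `v`. The moment series stays within this range: its term of
exponent `j + 1` is differentiated `j` times, so the kink is never reached. -/
lemma SmoothFamily.posPart_pow_mul (hu : SmoothFamily ν T I n u) (hv : SmoothFamily ν T I n v) :
    SmoothFamily ν T I n (fun τ y => max (u τ y) 0 ^ (n + 1) * v τ y) := by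
  induction n generalizing u v with
  | zero => exact ((BoundedFamily.posPart hu).pow 1).mul hv
  | succ n ih =>
    have hup := hu.of_succ
    have hvp := hv.of_succ
    obtain ⟨hu0, u', hu', hus⟩ := hu
    obtain ⟨hv0, v', hv', hvs⟩ := hv
    exact ⟨(hu0.posPart.pow _).mul hv0, _,
      fun τ hτ y hy => hasDerivWithinAt_posPart_pow_mul n (hu' τ hτ y hy) (hv' τ hτ y hy),
      ih hup ((((SmoothFamily.const n ((n : ℝ) + 2)).mul hus).mul hvp).add (hup.mul hvs))⟩

/-- Derivatives of order at most `m` of `u_+^{m+1} v` are those of `u^{m+1} v` where `u` is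
nonnegative, and vanish elsewhere. -/
lemma iteratedDerivWithin_posPart_pow_mul (hI : UniqueDiffOn ℝ I) {u v : ℝ → ℝ} {n m : ℕ}
    (hnm : n ≤ m) (hu : ContDiffOn ℝ n u I) (hv : ContDiffOn ℝ n v I) {y : ℝ} (hy : y ∈ I) :
    iteratedDerivWithin n (fun y => max (u y) 0 ^ (m + 1) * v y) I y =
      if 0 ≤ u y then iteratedDerivWithin n (fun y => u y ^ (m + 1) * v y) I y else 0 := by
  induction n generalizing v m with
  | zero =>
    simp only [iteratedDerivWithin_zero]
    split_ifs with h
    · rw [max_eq_left h]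
    · rw [max_eq_right (not_le.1 h).le]; simp
  | succ n ih =>
    obtain ⟨k, rfl⟩ : ∃ k, m = k + 1 := ⟨m - 1, by omega⟩
    have hdu : ∀ y ∈ I, HasDerivWithinAt u (derivWithin u I y) I y := fun y hy =>
      (hu.differentiableOn (by simp) y hy).hasDerivWithinAt
    have hdv : ∀ y ∈ I, HasDerivWithinAt v (derivWithin v I y) I y := fun y hy =>
      (hv.differentiableOn (by simp) y hy).hasDerivWithinAt
    have hu1 : ContDiffOn ℝ n u I := hu.of_le (by exact_mod_cast Nat.le_succ n)
    have hv1 : ContDiffOn ℝ n v I := hv.of_le (by exact_mod_cast Nat.le_succ n)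
    have hu2 : ContDiffOn ℝ n (derivWithin u I) I := hu.derivWithin hI (by norm_cast)
    have hv2 : ContDiffOn ℝ n (derivWithin v I) I := hv.derivWithin hI (by norm_cast)
    -- Both derivatives keep the shape of the claim, with the exponent lowered by one and the same
    -- new factor in place of `v`; this is why `v` is generalized in the induction.
    have e1 : EqOn (derivWithin (fun y => max (u y) 0 ^ (k + 1 + 1) * v y) I)
        (fun y => max (u y) 0 ^ (k + 1) *
          ((k + 2) * derivWithin u I y * v y + u y * derivWithin v I y)) I := fun y hy =>
      (hasDerivWithinAt_posPart_pow_mul k (hdu y hy) (hdv y hy)).derivWithin (hI y hy)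
    have e2 : EqOn (derivWithin (fun y => u y ^ (k + 1 + 1) * v y) I)
        (fun y => u y ^ (k + 1) *
          ((k + 2) * derivWithin u I y * v y + u y * derivWithin v I y)) I := fun y hy =>
      (hasDerivWithinAt_pow_mul k (hdu y hy) (hdv y hy)).derivWithin (hI y hy)
    rw [iteratedDerivWithin_succ', iteratedDerivWithin_succ', iteratedDerivWithin_congr e1 hy,
      iteratedDerivWithin_congr e2 hy]
    exact ih (by omega) hu1 (((contDiffOn_const.mul hu2).mul hv1).add (hu1.mul hv2))

end UniformFamilies

/-! ### Differentiation under the integral sign for smooth families. -/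

section IntegralOfFamily

variable {α : Type*} [MeasurableSpace α] {ν : Measure α} {T : Set α} {p q : ℝ}
  {h h' : α → ℝ → ℝ} {n : ℕ}

lemma neBot_nhdsWithin_Icc_diff (hpq : p < q) {y : ℝ} (hy : y ∈ Icc p q) :
    (𝓝[Icc p q \ {y}] y).NeBot :=
  (accPt_principal_iff_nhdsWithin).1 ((uniqueDiffOn_Icc hpq y hy).accPt)

/-- The derivative of a measurable family is measurable in the index. -/
lemma aestronglyMeasurable_derivFamily (hT : ∀ᵐ τ ∂ν, τ ∈ T) (hpq : p < q)
    (hm : ∀ y ∈ Icc p q, AEStronglyMeasurable (fun τ => h τ y) ν)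
    (hd : ∀ τ ∈ T, ∀ y ∈ Icc p q, HasDerivWithinAt (h τ) (h' τ y) (Icc p q) y)
    {y : ℝ} (hy : y ∈ Icc p q) : AEStronglyMeasurable (fun τ => h' τ y) ν := by
  have := neBot_nhdsWithin_Icc_diff hpq hy
  obtain ⟨x, hx⟩ := (𝓝[Icc p q \ {y}] y).exists_seq_tendsto
  have hxI : ∀ᶠ k in atTop, x k ∈ Icc p q := by
    filter_upwards [hx self_mem_nhdsWithin] with k hk using hk.1
  obtain ⟨N, hN⟩ := eventually_atTop.1 hxI
  -- The derivative is a limit of difference quotients along a sequence. The shift by `N` drops the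
  -- finitely many members outside the interval, where measurability in the index is not known.
  refine aestronglyMeasurable_of_tendsto_ae (u := atTop)
    (f := fun k τ => slope (h τ) y (x (k + N))) ?_ ?_
  · intro k
    simp only [slope_def_field]
    exact ((hm _ (hN _ (Nat.le_add_left _ _))).sub (hm y hy)).mul_const _
  · filter_upwards [hT] with τ hτ
    exact ((hasDerivWithinAt_iff_tendsto_slope.1 (hd τ hτ y hy)).comp hx).comp
      (tendsto_add_atTop_nat N)

lemma SmoothFamily.measurable_iteratedDerivWithin (hT : ∀ᵐ τ ∂ν, τ ∈ T) (hpq : p < q)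
    (hh : SmoothFamily ν T (Icc p q) n h) {y : ℝ} (hy : y ∈ Icc p q) :
    AEStronglyMeasurable (fun τ => iteratedDerivWithin n (h τ) (Icc p q) y) ν := by
  induction n generalizing h with
  | zero => simpa using hh.boundedFamily.measurable y hy
  | succ n ih =>
    obtain ⟨h0, h', hd, hs⟩ := hh
    refine (ih hs).congr ?_
    filter_upwards [hT] with τ hτ
    rw [iteratedDerivWithin_succ']
    exact (iteratedDerivWithin_congr
      (fun y hy => (hd τ hτ y hy).derivWithin (uniqueDiffOn_Icc hpq y hy)) hy).symm

variable [IsFiniteMeasure ν]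

lemma BoundedFamily.integrable {I : Set ℝ} (hT : ∀ᵐ τ ∂ν, τ ∈ T) (hh : BoundedFamily ν T I h)
    {y : ℝ} (hy : y ∈ I) : Integrable (fun τ => h τ y) ν := by
  obtain ⟨C, hC⟩ := hh.bounded
  refine Integrable.of_bound (hh.measurable y hy) C ?_
  filter_upwards [hT] with τ hτ using hC τ hτ y hy

lemma BoundedFamily.continuousOn_integral {I : Set ℝ} (hT : ∀ᵐ τ ∂ν, τ ∈ T)
    (hh : BoundedFamily ν T I h) : ContinuousOn (fun y => ∫ τ, h τ y ∂ν) I := by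
  obtain ⟨C, hC⟩ := hh.bounded
  intro y hy
  refine tendsto_integral_filter_of_dominated_convergence (fun _ => C) ?_ ?_
    (integrable_const C) ?_
  · filter_upwards [self_mem_nhdsWithin] with z hz using hh.measurable z hz
  · filter_upwards [self_mem_nhdsWithin] with z hz
    filter_upwards [hT] with τ hτ using hC τ hτ z hz
  · filter_upwards [hT] with τ hτ using hh.continuousOn τ hτ y hy

lemma hasDerivWithinAt_integral (hT : ∀ᵐ τ ∂ν, τ ∈ T)
    (hh : BoundedFamily ν T (Icc p q) h) (hh' : BoundedFamily ν T (Icc p q) h')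
    (hd : ∀ τ ∈ T, ∀ y ∈ Icc p q, HasDerivWithinAt (h τ) (h' τ y) (Icc p q) y)
    {y : ℝ} (hy : y ∈ Icc p q) :
    HasDerivWithinAt (fun y => ∫ τ, h τ y ∂ν) (∫ τ, h' τ y ∂ν) (Icc p q) y := by
  obtain ⟨C, hC⟩ := hh'.bounded
  rw [hasDerivWithinAt_iff_tendsto_slope]
  have e : ∀ᶠ z in 𝓝[Icc p q \ {y}] y,
      ∫ τ, slope (h τ) y z ∂ν = slope (fun y => ∫ τ, h τ y ∂ν) y z := by
    filter_upwards [self_mem_nhdsWithin] with z hz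
    simp only [slope_def_field]
    rw [integral_div, integral_sub (hh.integrable hT hz.1) (hh.integrable hT hy)]
  refine Tendsto.congr' e ?_
  refine tendsto_integral_filter_of_dominated_convergence (fun _ => C) ?_ ?_
    (integrable_const C) ?_
  · filter_upwards [self_mem_nhdsWithin] with z hz
    simp only [slope_def_field]
    exact ((hh.measurable z hz.1).sub (hh.measurable y hy)).mul_const _
  · filter_upwards [self_mem_nhdsWithin] with z hz
    filter_upwards [hT] with τ hτ
    have h0 : 0 < ‖z - y‖ := norm_pos_iff.2 (sub_ne_zero.2 hz.2)
    rw [slope_def_field, norm_div, div_le_iff₀ h0]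
    -- The mean value inequality bounds the difference quotients by the uniform bound of the
    -- derivatives, which is the dominating constant.
    exact (convex_Icc p q).norm_image_sub_le_of_norm_hasDerivWithin_le (hd τ hτ)
      (fun x hx => hC τ hτ x hx) hy hz.1
  · filter_upwards [hT] with τ hτ
    exact hasDerivWithinAt_iff_tendsto_slope.1 (hd τ hτ y hy)

/-- Differentiation under the integral sign, on a closed interval. -/
theorem SmoothFamily.contDiffOn_integral (hT : ∀ᵐ τ ∂ν, τ ∈ T) (hpq : p < q)
    (hh : SmoothFamily ν T (Icc p q) n h) :
    ContDiffOn ℝ n (fun y => ∫ τ, h τ y ∂ν) (Icc p q) := by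
  induction n generalizing h with
  | zero => exact contDiffOn_zero.2 (hh.boundedFamily.continuousOn_integral hT)
  | succ n ih =>
    obtain ⟨h0, h', hd, hs⟩ := hh
    have key : ∀ y ∈ Icc p q, HasDerivWithinAt (fun y => ∫ τ, h τ y ∂ν) (∫ τ, h' τ y ∂ν)
        (Icc p q) y := fun y hy => hasDerivWithinAt_integral hT h0 hs.boundedFamily hd hy
    have hu := uniqueDiffOn_Icc hpq
    rw [Nat.cast_succ, contDiffOn_succ_iff_derivWithin hu]
    refine ⟨fun y hy => (key y hy).differentiableWithinAt, by simp, ?_⟩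
    exact (ih hs).congr fun y hy => (key y hy).derivWithin (hu y hy)

theorem SmoothFamily.iteratedDerivWithin_integral (hT : ∀ᵐ τ ∂ν, τ ∈ T) (hpq : p < q)
    (hh : SmoothFamily ν T (Icc p q) n h) {y : ℝ} (hy : y ∈ Icc p q) :
    iteratedDerivWithin n (fun y => ∫ τ, h τ y ∂ν) (Icc p q) y =
      ∫ τ, iteratedDerivWithin n (h τ) (Icc p q) y ∂ν := by
  induction n generalizing h with
  | zero => simp
  | succ n ih =>
    obtain ⟨h0, h', hd, hs⟩ := hh
    have hu := uniqueDiffOn_Icc hpq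
    have e1 : EqOn (derivWithin (fun y => ∫ τ, h τ y ∂ν) (Icc p q)) (fun y => ∫ τ, h' τ y ∂ν)
        (Icc p q) := fun y hy =>
      (hasDerivWithinAt_integral hT h0 hs.boundedFamily hd hy).derivWithin (hu y hy)
    rw [iteratedDerivWithin_succ', iteratedDerivWithin_congr e1 hy, ih hs]
    refine integral_congr_ae ?_
    filter_upwards [hT] with τ hτ
    rw [iteratedDerivWithin_succ']
    exact (iteratedDerivWithin_congr
      (fun y hy => (hd τ hτ y hy).derivWithin (hu y hy)) hy).symm

end IntegralOfFamily

/-! ### Analytic continuations of functions on an interval -/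

section Continuation

open Metric

variable {a b ρ : ℝ} {h : ℝ → ℝ} {H : ℂ → ℂ}

lemma isOpen_complexNeighbourhood (a b R : ℝ) :
    IsOpen {z : ℂ | ∃ y ∈ Icc a b, ‖z - (y : ℂ)‖ < R} := by
  have : {z : ℂ | ∃ y ∈ Icc a b, ‖z - (y : ℂ)‖ < R} = ⋃ y ∈ Icc a b, ball (y : ℂ) R := by
    ext z; simp [dist_eq_norm]
  rw [this]
  exact isOpen_biUnion fun y _ => isOpen_ball

/-- The second part, that the complex derivative is real at real points, lets `deriv H` be used as a
continuation of the real derivative. It holds because the complexified `h` has both numbers as its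
derivative on an interval of positive length. -/
lemma hasDerivWithinAt_of_continuation (hab : a < b)
    (hext : ∀ y ∈ Icc a b, H (y : ℂ) = (h y : ℂ)) {y : ℝ} (hy : y ∈ Icc a b)
    (hH : DifferentiableAt ℂ H y) :
    HasDerivWithinAt h (deriv H y).re (Icc a b) y ∧ (((deriv H y).re : ℝ) : ℂ) = deriv H y := by
  have h1 : HasDerivWithinAt h (deriv H y).re (Icc a b) y :=
    (hH.hasDerivAt.real_of_complex.hasDerivWithinAt).congr
      (fun x hx => by rw [hext x hx, Complex.ofReal_re]) (by rw [hext y hy, Complex.ofReal_re])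
  refine ⟨h1, ?_⟩
  have h2 : HasDerivWithinAt (fun x : ℝ => (h x : ℂ)) (deriv H y) (Icc a b) y :=
    (hH.hasDerivAt.comp_ofReal.hasDerivWithinAt).congr (fun x hx => (hext x hx).symm)
      (hext y hy).symm
  exact (uniqueDiffOn_Icc hab y hy).eq_deriv _ h1.ofReal_comp h2

lemma iteratedDeriv_continuation (hab : a < b) {U : Set ℂ} (hU : IsOpen U)
    (hIU : ∀ y ∈ Icc a b, (y : ℂ) ∈ U) (hext : ∀ y ∈ Icc a b, H (y : ℂ) = (h y : ℂ))
    (hH : DifferentiableOn ℂ H U) (n : ℕ) :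
    ∀ y ∈ Icc a b, iteratedDeriv n H y = ((iteratedDerivWithin n h (Icc a b) y : ℝ) : ℂ) := by
  induction n generalizing h H with
  | zero => simpa using hext
  | succ n ih =>
    intro y hy
    have hd : ∀ y ∈ Icc a b, HasDerivWithinAt h (deriv H y).re (Icc a b) y ∧
        (((deriv H y).re : ℝ) : ℂ) = deriv H y := fun y hy =>
      hasDerivWithinAt_of_continuation hab hext hy
        (hH.differentiableAt (hU.mem_nhds (hIU y hy)))
    rw [iteratedDeriv_succ', iteratedDerivWithin_succ']
    refine ih (fun y hy => ?_) (hH.deriv hU) y hy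
    rw [(hd y hy).1.derivWithin (uniqueDiffOn_Icc hab y hy), (hd y hy).2]

lemma AnalyticContinuation.exists_radius (hc : AnalyticContinuation a b ρ h H) :
    ∃ R > ρ, ∀ y ∈ Icc a b, DifferentiableOn ℂ H (ball (y : ℂ) R) := by
  obtain ⟨R, hR, hd⟩ := hc.holomorphic
  exact ⟨R, hR, fun y hy => hd.mono fun z hz => ⟨y, hy, by simpa [dist_eq_norm] using hz⟩⟩

lemma AnalyticContinuation.sub {h' : ℝ → ℝ} {H' : ℂ → ℂ} (hc : AnalyticContinuation a b ρ h H)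
    (hc' : AnalyticContinuation a b ρ h' H') :
    AnalyticContinuation a b ρ (fun y => h y - h' y) (fun z => H z - H' z) := by
  obtain ⟨R, hR, hd⟩ := hc.holomorphic
  obtain ⟨R', hR', hd'⟩ := hc'.holomorphic
  refine ⟨fun y hy => ?_, min R R', lt_min hR hR', ?_⟩
  · rw [hc.extends_real y hy, hc'.extends_real y hy]; push_cast; rfl
  · refine (hd.mono ?_).sub (hd'.mono ?_)
    · rintro z ⟨y, hy, hz⟩
      exact ⟨y, hy, hz.trans_le (min_le_left _ _)⟩
    · rintro z ⟨y, hy, hz⟩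
      exact ⟨y, hy, hz.trans_le (min_le_right _ _)⟩

lemma AnalyticContinuation.sub_const (hc : AnalyticContinuation a b ρ h H) (c : ℝ) :
    AnalyticContinuation a b ρ (fun y => h y - c) (fun z => H z - c) :=
  hc.sub ⟨fun _ _ => rfl, ρ + 1, by simp, differentiableOn_const _⟩

lemma AnalyticContinuation.mul {h' : ℝ → ℝ} {H' : ℂ → ℂ} (hc : AnalyticContinuation a b ρ h H)
    (hc' : AnalyticContinuation a b ρ h' H') :
    AnalyticContinuation a b ρ (fun y => h y * h' y) (fun z => H z * H' z) := by
  obtain ⟨R, hR, hd⟩ := hc.holomorphic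
  obtain ⟨R', hR', hd'⟩ := hc'.holomorphic
  refine ⟨fun y hy => ?_, min R R', lt_min hR hR', ?_⟩
  · rw [hc.extends_real y hy, hc'.extends_real y hy]; push_cast; rfl
  · refine (hd.mono ?_).mul (hd'.mono ?_)
    · rintro z ⟨y, hy, hz⟩
      exact ⟨y, hy, hz.trans_le (min_le_left _ _)⟩
    · rintro z ⟨y, hy, hz⟩
      exact ⟨y, hy, hz.trans_le (min_le_right _ _)⟩

lemma AnalyticContinuation.pow (hc : AnalyticContinuation a b ρ h H) (n : ℕ) :
    AnalyticContinuation a b ρ (fun y => h y ^ n) (fun z => H z ^ n) := by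
  obtain ⟨R, hR, hd⟩ := hc.holomorphic
  refine ⟨fun y hy => ?_, R, hR, hd.pow n⟩
  rw [hc.extends_real y hy]; push_cast; rfl

lemma AnalyticContinuation.iteratedDeriv_eq (hρ : 0 < ρ) (hab : a < b)
    (hc : AnalyticContinuation a b ρ h H) (n : ℕ) {y : ℝ} (hy : y ∈ Icc a b) :
    iteratedDeriv n H y = ((iteratedDerivWithin n h (Icc a b) y : ℝ) : ℂ) := by
  obtain ⟨R, hR, hd⟩ := hc.holomorphic
  exact iteratedDeriv_continuation hab (isOpen_complexNeighbourhood a b R)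
    (fun y hy => ⟨y, hy, by simpa using hρ.trans hR⟩) hc.extends_real hd n y hy

lemma AnalyticContinuation.hasDerivWithinAt (hρ : 0 < ρ) (hab : a < b)
    (hc : AnalyticContinuation a b ρ h H) {y : ℝ} (hy : y ∈ Icc a b) :
    HasDerivWithinAt h (deriv H y).re (Icc a b) y := by
  obtain ⟨R, hR, hd⟩ := hc.exists_radius
  exact (hasDerivWithinAt_of_continuation hab hc.extends_real hy
    ((hd y hy).differentiableAt (ball_mem_nhds _ (hρ.trans hR)))).1

lemma AnalyticContinuation.contDiffOn (hρ : 0 < ρ) (hc : AnalyticContinuation a b ρ h H) (n : ℕ) :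
    ContDiffOn ℝ n h (Icc a b) := by
  obtain ⟨R, hR, hd⟩ := hc.holomorphic
  have h1 : ContDiffOn ℝ n H {z : ℂ | ∃ y ∈ Icc a b, ‖z - (y : ℂ)‖ < R} :=
    (hd.contDiffOn (isOpen_complexNeighbourhood a b R)).restrict_scalars ℝ
  have h2 : ContDiffOn ℝ n (fun y : ℝ => (H (y : ℂ)).re) (Icc a b) :=
    Complex.reCLM.contDiff.comp_contDiffOn
      (h1.comp Complex.ofRealCLM.contDiff.contDiffOn
        (fun y hy => ⟨y, hy, by simpa using hρ.trans hR⟩))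
  exact h2.congr fun y hy => by rw [hc.extends_real y hy, Complex.ofReal_re]

lemma AnalyticContinuation.continuousOn (hρ : 0 < ρ) (hc : AnalyticContinuation a b ρ h H) :
    ContinuousOn h (Icc a b) := (hc.contDiffOn hρ 0).continuousOn

/-- Translates conditions on the parametrized circle into conditions on the sphere. The parameter is
the fractional part of `arg / 2π`; the integer part is a period of the exponential. -/
lemma exists_circlePoint_eq {y : ℝ} {z : ℂ} (hz : z ∈ sphere (y : ℂ) ρ) :
    ∃ x ∈ Icc (0 : ℝ) 1, z = circlePoint y ρ x := by
  have h2pi : 0 < 2 * Real.pi := Real.two_pi_pos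
  refine ⟨Int.fract (Complex.arg (z - y) / (2 * Real.pi)),
    ⟨Int.fract_nonneg _, (Int.fract_lt_one _).le⟩, ?_⟩
  have hn : ‖z - y‖ = ρ := by simpa [dist_eq_norm] using hz
  have h1 := Complex.norm_mul_exp_arg_mul_I (z - y)
  rw [hn] at h1
  unfold circlePoint
  rw [← sub_eq_iff_eq_add', ← Int.self_sub_floor]
  refine h1.symm.trans ?_
  congr 1
  rw [Complex.exp_eq_exp_iff_exists_int]
  refine ⟨⌊Complex.arg (z - y) / (2 * Real.pi)⌋, ?_⟩
  have : (Real.pi : ℂ) ≠ 0 := by exact_mod_cast Real.pi_ne_zero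
  push_cast
  field_simp
  ring

/-- The union of the circles is the image of a compact set under addition, and lies in the
neighbourhood where `H` is continuous. -/
lemma AnalyticContinuation.bounded (hc : AnalyticContinuation a b ρ h H) :
    ∃ C, ∀ y ∈ Icc a b, ∀ z ∈ sphere (y : ℂ) ρ, ‖H z‖ ≤ C := by
  obtain ⟨R, hR, hd⟩ := hc.holomorphic
  have hK : IsCompact ((fun w : ℝ × ℂ => (w.1 : ℂ) + w.2) '' (Icc a b ×ˢ sphere (0 : ℂ) ρ)) :=
    (isCompact_Icc.prod (isCompact_sphere 0 ρ)).image (by fun_prop)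
  obtain ⟨C, hC⟩ := hK.exists_bound_of_continuousOn (hd.continuousOn.mono (by
    rintro _ ⟨⟨y, w⟩, ⟨hy, hw⟩, rfl⟩
    refine ⟨y, hy, ?_⟩
    have : ‖w‖ = ρ := by simpa using hw
    simpa [this] using hR))
  refine ⟨C, fun y hy z hz => hC z ⟨(y, z - y), ⟨hy, ?_⟩, by simp⟩⟩
  simpa [dist_eq_norm] using hz

/-- The derivatives of a family of functions with analytic continuations that are uniformly bounded
on circles of radius `ρ`. -/
lemma smoothFamily_of_continuation {α : Type*} [MeasurableSpace α] {ν : Measure α} {T : Set α}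
    {g : α → ℝ → ℝ} {G : α → ℂ → ℂ} (hρ : 0 < ρ) (hab : a < b) (hT : ∀ᵐ τ ∂ν, τ ∈ T)
    (hc : ∀ τ ∈ T, AnalyticContinuation a b ρ (g τ) (G τ))
    (hC : ∃ C, ∀ τ ∈ T, ∀ y ∈ Icc a b, ∀ z ∈ sphere (y : ℂ) ρ, ‖G τ z‖ ≤ C)
    (hm : ∀ y ∈ Icc a b, AEStronglyMeasurable (fun τ => g τ y) ν) (n : ℕ) :
    SmoothFamily ν T (Icc a b) n g := by
  obtain ⟨C, hC⟩ := hC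
  have hu := uniqueDiffOn_Icc hab
  have hd : ∀ k, ∀ τ ∈ T, ∀ y ∈ Icc a b,
      HasDerivWithinAt (iteratedDerivWithin k (g τ) (Icc a b))
        (iteratedDerivWithin (k + 1) (g τ) (Icc a b) y) (Icc a b) y := by
    intro k τ hτ y hy
    rw [iteratedDerivWithin_succ]
    refine (((hc τ hτ).contDiffOn hρ (k + 1)).differentiableOn_iteratedDerivWithin ?_ hu y
      hy).hasDerivWithinAt
    exact_mod_cast Nat.lt_succ_self k
  have hbase : ∀ k, BoundedFamily ν T (Icc a b)
      (fun τ => iteratedDerivWithin k (g τ) (Icc a b)) := by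
    intro k
    -- The bound is Cauchy's estimate with the uniform bound `C` on circles of radius `ρ`.
    refine ⟨?_, fun τ hτ y hy => (hd k τ hτ y hy).continuousWithinAt, k.factorial * C / ρ ^ k, ?_⟩
    · induction k with
      | zero => simpa using hm
      | succ k ih => exact fun y hy => aestronglyMeasurable_derivFamily hT hab ih (hd k) hy
    · intro τ hτ y hy
      obtain ⟨R, hR, hdR⟩ := (hc τ hτ).exists_radius
      have h1 := Complex.norm_iteratedDeriv_le_of_forall_mem_sphere_norm_le k hρ
        (DifferentiableOn.diffContOnCl (by
          rw [closure_ball _ hρ.ne']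
          exact (hdR y hy).mono (closedBall_subset_ball hR))) (hC τ hτ y hy)
      rwa [(hc τ hτ).iteratedDeriv_eq hρ hab k hy, Complex.norm_real] at h1
  have main : ∀ n k, SmoothFamily ν T (Icc a b) n
      (fun τ => iteratedDerivWithin k (g τ) (Icc a b)) := by
    intro n
    induction n with
    | zero => exact hbase
    | succ n ih => exact fun k => ⟨hbase k, _, hd k, ih (k + 1)⟩
  have := main n 0
  simpa only [iteratedDerivWithin_zero] using this

end Continuation

/-! ### Quantiles -/

section Quantile

variable {κ : Kernel ℝ ℝ} [IsMarkovKernel κ]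

/-- The infimum is attained because the distribution function is right continuous; `0 < τ < 1` makes
the set of candidates bounded below and nonempty. Every later use of quantiles goes through this
equivalence. -/
lemma condQuantile_le_iff {τ : ℝ} (hτ : τ ∈ Ioo (0 : ℝ) 1) (y x : ℝ) :
    condQuantile κ τ y ≤ x ↔ τ ≤ (κ y).real (Iic x) := by
  have hF : ∀ x, (κ y).real (Iic x) = cdf (κ y) x := fun x => (cdf_eq_real _ x).symm
  have hmono := (cdf (κ y)).mono
  unfold condQuantile
  simp only [hF]
  set s := {x | τ ≤ cdf (κ y) x} with hs
  have hne : s.Nonempty := by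
    obtain ⟨x, hx⟩ := ((tendsto_cdf_atTop (κ y)).eventually (lt_mem_nhds hτ.2)).exists
    exact ⟨x, hx.le⟩
  have hbdd : BddBelow s := by
    obtain ⟨x, hx⟩ := ((tendsto_cdf_atBot (κ y)).eventually (gt_mem_nhds hτ.1)).exists
    exact ⟨x, fun z hz => le_of_lt (hmono.reflect_lt (hx.trans_le hz))⟩
  constructor
  · intro h
    have h1 : τ ≤ cdf (κ y) (sInf s) := by
      refine ge_of_tendsto (((cdf (κ y)).right_continuous (sInf s)).mono_left
        (nhdsWithin_mono _ Ioi_subset_Ici_self)) ?_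
      filter_upwards [self_mem_nhdsWithin] with z hz
      obtain ⟨w, hw, hwz⟩ := exists_lt_of_csInf_lt hne hz
      exact le_trans hw (hmono hwz.le)
    exact h1.trans (hmono h)
  · exact fun h => csInf_le hbdd h

lemma monotoneOn_condQuantile (y : ℝ) :
    MonotoneOn (fun τ => condQuantile κ τ y) (Ioo 0 1) := by
  intro τ hτ τ' hτ' h
  exact (condQuantile_le_iff hτ y _).2 (h.trans ((condQuantile_le_iff hτ' y _).1 le_rfl))

lemma aemeasurable_condQuantile (y : ℝ) :
    AEMeasurable (fun τ => condQuantile κ τ y) (volume.restrict (Ioo 0 1)) :=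
  aemeasurable_restrict_of_monotoneOn measurableSet_Ioo (monotoneOn_condQuantile y)

/-- The quantile function of the law `κ y` transports the uniform law on `(0, 1)` to `κ y`. -/
lemma map_condQuantile (y : ℝ) :
    (volume.restrict (Ioo (0 : ℝ) 1)).map (fun τ => condQuantile κ τ y) = κ y := by
  have hfin : IsFiniteMeasure
      ((volume.restrict (Ioo (0 : ℝ) 1)).map (fun τ => condQuantile κ τ y)) := by
    infer_instance
  refine Measure.ext_of_Iic _ _ fun x => ?_
  rw [Measure.map_apply_of_aemeasurable (aemeasurable_condQuantile y) measurableSet_Iic,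
    Measure.restrict_apply' measurableSet_Ioo]
  have h1 : (fun τ => condQuantile κ τ y) ⁻¹' Iic x ∩ Ioo 0 1 =
      Iic ((κ y).real (Iic x)) ∩ Ioo 0 1 := by
    ext τ
    simp only [mem_inter_iff, mem_preimage, mem_Iic]
    exact and_congr_left fun hτ => condQuantile_le_iff hτ y x
  have hle : (κ y).real (Iic x) ≤ 1 := measureReal_le_one
  have h2 : volume (Iic ((κ y).real (Iic x)) ∩ Ioo (0 : ℝ) 1) =
      ENNReal.ofReal ((κ y).real (Iic x)) := by
    apply le_antisymm
    · calc _ ≤ volume (Ioc 0 ((κ y).real (Iic x))) := measure_mono fun τ hτ => ⟨hτ.2.1, hτ.1⟩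
        _ = _ := by simp
    · calc _ = volume (Ioo 0 ((κ y).real (Iic x))) := by simp
        _ ≤ volume (Iic ((κ y).real (Iic x)) ∩ Ioo (0 : ℝ) 1) :=
          measure_mono fun τ hτ => ⟨le_of_lt hτ.2, hτ.1, hτ.2.trans_le hle⟩
  rw [h1, h2, ofReal_measureReal]

lemma integral_condQuantile {φ : ℝ → ℝ} (hφ : Continuous φ) (y : ℝ) :
    ∫ r, φ r ∂(κ y) = ∫ τ in Ioo (0 : ℝ) 1, φ (condQuantile κ τ y) := by
  conv_lhs => rw [← map_condQuantile (κ := κ) y]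
  exact integral_map (aemeasurable_condQuantile y) hφ.aestronglyMeasurable

/-- Joint measurability, as needed for Fubini. A quantile below `v` is separated from it by a
rational `r`, and `g_τ(v) ≤ r` is a condition on the measurable function `κ v (Iic r)`, so the
complement is a countable union. -/
lemma measurableSet_le_condQuantile :
    MeasurableSet {p : ℝ × ℝ | p.1 ∈ Ioo (0 : ℝ) 1 ∧ p.2 ≤ condQuantile κ p.1 p.2} := by
  have : {p : ℝ × ℝ | p.1 ∈ Ioo (0 : ℝ) 1 ∧ p.2 ≤ condQuantile κ p.1 p.2} =
      {p : ℝ × ℝ | p.1 ∈ Ioo (0 : ℝ) 1} \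
        ⋃ r : ℚ, {p : ℝ × ℝ | (r : ℝ) < p.2 ∧ p.1 ≤ (κ p.2).real (Iic (r : ℝ))} := by
    ext ⟨τ, v⟩
    simp only [mem_ofPred_eq, Set.mem_sdiff, mem_iUnion, not_exists, not_and, not_le]
    refine and_congr_right fun hτ => ?_
    constructor
    · intro h r hr
      by_contra hc
      exact absurd (((condQuantile_le_iff hτ v r).2 (not_lt.1 hc)).trans_lt hr) (not_lt.2 h)
    · intro h
      by_contra hc
      obtain ⟨r, hr1, hr2⟩ := exists_rat_btwn (not_le.1 hc)
      exact absurd ((condQuantile_le_iff hτ v r).1 hr1.le) (not_le.2 (h r hr2))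
  rw [this]
  refine (measurable_fst measurableSet_Ioo).diff (MeasurableSet.iUnion fun r => ?_)
  refine (measurableSet_lt measurable_const measurable_snd).inter
    (measurableSet_le measurable_fst ?_)
  exact ((κ.measurable_coe measurableSet_Iic).ennreal_toReal).comp measurable_snd

end Quantile

/-! ### Moment series -/

section SeriesOfIntegrals

variable {α : Type*} [MeasurableSpace α] {ν : Measure α} [IsFiniteMeasure ν] {u : ℕ → α → ℝ}
  {K δ : ℝ}

lemma summable_of_geometric_bound (hδ0 : 0 ≤ δ) (hδ : δ < 1) {u : ℕ → ℝ}
    (hu : ∀ j, |u j| ≤ K * δ ^ j) : Summable u :=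
  Summable.of_norm_bounded ((summable_geometric_of_lt_one hδ0 hδ).mul_left K) hu

lemma integrable_tsum_of_geometric_bound (hδ0 : 0 ≤ δ) (hδ : δ < 1)
    (hm : ∀ j, AEStronglyMeasurable (u j) ν) (hu : ∀ j, ∀ᵐ τ ∂ν, |u j τ| ≤ K * δ ^ j) :
    Integrable (fun τ => ∑' j, u j τ) ν := by
  have hall := ae_all_iff.2 hu
  refine Integrable.of_bound (C := ∑' j, K * δ ^ j) ?_ ?_
  · refine aestronglyMeasurable_of_tendsto_ae (u := atTop)
      (f := fun n τ => ∑ j ∈ Finset.range n, u j τ) ?_ ?_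
    · exact fun n => Finset.aestronglyMeasurable_fun_sum _ fun j _ => hm j
    · filter_upwards [hall] with τ hτ
      exact (summable_of_geometric_bound hδ0 hδ hτ).hasSum.tendsto_sum_nat
  · filter_upwards [hall] with τ hτ
    exact tsum_of_norm_bounded ((summable_geometric_of_lt_one hδ0 hδ).mul_left K).hasSum hτ

lemma hasSum_integral_of_geometric_bound (hδ0 : 0 ≤ δ) (hδ : δ < 1)
    (hm : ∀ j, AEStronglyMeasurable (u j) ν) (hu : ∀ j, ∀ᵐ τ ∂ν, |u j τ| ≤ K * δ ^ j) :
    HasSum (fun j => ∫ τ, u j τ ∂ν) (∫ τ, ∑' j, u j τ ∂ν) := by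
  refine hasSum_integral_of_dominated_convergence (fun j _ => K * δ ^ j) hm hu ?_ ?_ ?_
  · exact Eventually.of_forall fun _ => (summable_geometric_of_lt_one hδ0 hδ).mul_left K
  · exact integrable_const _
  · filter_upwards [ae_all_iff.2 hu] with τ hτ
    exact (summable_of_geometric_bound hδ0 hδ hτ).hasSum

end SeriesOfIntegrals

/-! ### From quantile series to moment series. -/

section MomentSeries

open Metric

/-- `G τ` are analytic continuations of the conditional quantile functions, as in the analyticity
condition. -/
structure QuantileContinuation (κ : Kernel ℝ ℝ) (p q ρ δ : ℝ) (G : ℝ → ℂ → ℂ) : Prop where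
  radius_pos : 0 < ρ
  nonneg : 0 ≤ δ
  continuation : ∀ τ ∈ Ioo (0 : ℝ) 1, AnalyticContinuation p q ρ (condQuantile κ τ) (G τ)
  disc : ∀ y ∈ Icc p q, ∀ τ ∈ Ioo (0 : ℝ) 1, y ≤ condQuantile κ τ y →
    ∀ z ∈ sphere (y : ℂ) ρ, ‖G τ z - y‖ ≤ δ * ρ
  bounded : ∃ C, ∀ τ ∈ Ioo (0 : ℝ) 1, ∀ y ∈ Icc p q, ∀ z ∈ sphere (y : ℂ) ρ, ‖G τ z‖ ≤ C

lemma AnalyticityCondition.exists_continuation {κ : Kernel ℝ ℝ} {p q ρ β δ : ℝ} {f : ℝ → ℝ}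
    (h : AnalyticityCondition p q f (condQuantile κ) ρ β δ) :
    (∃ F, AnalyticContinuation p q ρ f F) ∧ ∃ G, QuantileContinuation κ p q ρ δ G := by
  obtain ⟨hρ, -, hδ, F, G, hF, hG, -, hd, C, hC⟩ := h
  refine ⟨⟨F, hF⟩, G, hρ, hδ, hG, fun y hy τ hτ hle z hz => ?_, C, fun τ hτ y hy z hz => ?_⟩
  · obtain ⟨x, hx, rfl⟩ := exists_circlePoint_eq hz
    exact hd y hy τ hτ hle x hx
  · obtain ⟨x, hx, rfl⟩ := exists_circlePoint_eq hz
    exact hC y hy τ hτ x hx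

variable {κ : Kernel ℝ ℝ} {p q ρ δ : ℝ} {G : ℝ → ℂ → ℂ} {h : ℝ → ℝ} {H : ℂ → ℂ}

lemma ae_mem_unitInterval : ∀ᵐ τ ∂(volume.restrict (Ioo (0 : ℝ) 1)), τ ∈ Ioo (0 : ℝ) 1 :=
  ae_restrict_mem measurableSet_Ioo

/-- The contribution of the quantile of order `τ` to the moment series at `w`. -/
noncomputable def quantileTerm (κ : Kernel ℝ ℝ) (p q w : ℝ) (h : ℝ → ℝ) (j : ℕ) (τ : ℝ) : ℝ :=
  iteratedDerivWithin j (fun y => max (condQuantile κ τ y - w) 0 ^ (j + 1) * h y) (Icc p q) w /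
    (Nat.factorial (j + 1) : ℝ)

/-- Where the quantile is at least `w`, the positive part can be dropped before differentiating `j`
times a power `j + 1`; elsewhere the term vanishes. Thus the disc condition is needed only where `w
≤ g_τ(w)`. -/
lemma QuantileContinuation.quantileTerm_eq (hG : QuantileContinuation κ p q ρ δ G) (hpq : p < q)
    (hH : AnalyticContinuation p q ρ h H) {w : ℝ} (hw : w ∈ Icc p q) (j : ℕ) {τ : ℝ}
    (hτ : τ ∈ Ioo (0 : ℝ) 1) :
    ((quantileTerm κ p q w h j τ : ℝ) : ℂ) =
      if w ≤ condQuantile κ τ w then lagrangeTerm (G τ) H w j else 0 := by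
  have hρ := hG.radius_pos
  have hu := (hG.continuation τ hτ).sub_const w
  have h1 := iteratedDerivWithin_posPart_pow_mul (uniqueDiffOn_Icc hpq) le_rfl
    (hu.contDiffOn hρ j) (hH.contDiffOn hρ j) hw
  rw [quantileTerm, h1]
  simp only [sub_nonneg]
  split_ifs
  · rw [lagrangeTerm, ((hu.pow (j + 1)).mul hH).iteratedDeriv_eq hρ hpq j hw]
    push_cast; rfl
  · simp

lemma QuantileContinuation.exists_radius (hG : QuantileContinuation κ p q ρ δ G)
    (hH : AnalyticContinuation p q ρ h H) {w : ℝ} (hw : w ∈ Icc p q) {τ : ℝ}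
    (hτ : τ ∈ Ioo (0 : ℝ) 1) : ∃ R > ρ, DifferentiableOn ℂ (G τ) (ball (w : ℂ) R) ∧
      DifferentiableOn ℂ H (ball (w : ℂ) R) := by
  obtain ⟨R, hR, hd⟩ := (hG.continuation τ hτ).exists_radius
  obtain ⟨R', hR', hd'⟩ := hH.exists_radius
  exact ⟨min R R', lt_min hR hR', (hd w hw).mono (ball_subset_ball (min_le_left _ _)),
    (hd' w hw).mono (ball_subset_ball (min_le_right _ _))⟩

/-- The constant does not depend on `τ`; this justifies exchanging the series with the integral over
`τ`. -/
lemma QuantileContinuation.exists_quantileTerm_bound (hG : QuantileContinuation κ p q ρ δ G)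
    (hpq : p < q) (hH : AnalyticContinuation p q ρ h H) {w : ℝ} (hw : w ∈ Icc p q) :
    ∃ K, ∀ j, ∀ τ ∈ Ioo (0 : ℝ) 1, |quantileTerm κ p q w h j τ| ≤ K * δ ^ j := by
  have hρ := hG.radius_pos
  obtain ⟨C, hC⟩ := hH.bounded
  obtain ⟨z₀, hz₀⟩ := NormedSpace.sphere_nonempty (x := (w : ℂ)).2 hρ.le
  have hC0 : 0 ≤ C := (norm_nonneg _).trans (hC w hw z₀ hz₀)
  refine ⟨C * ρ * δ, fun j τ hτ => ?_⟩
  obtain ⟨R, hR, hd, hd'⟩ := hG.exists_radius hH hw hτ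
  rw [← Real.norm_eq_abs, ← Complex.norm_real, hG.quantileTerm_eq hpq hH hw j hτ]
  split_ifs with hle
  · exact norm_lagrangeTerm_le hρ hR hd hd' (hG.disc w hw τ hτ hle) (hC w hw) j
  · rw [norm_zero]
    have := hG.nonneg
    positivity

lemma AnalyticContinuation.jumpFn {f : ℕ → ℝ → ℝ} {s : ℕ}
    (h1 : ∃ F, AnalyticContinuation p q ρ (f (s + 1)) F)
    (h0 : s ≠ 0 → ∃ F, AnalyticContinuation p q ρ (f s) F) :
    ∃ F, AnalyticContinuation p q ρ (jumpFn f s) F := by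
  obtain ⟨F, hF⟩ := h1
  -- At the first knot the jump is `f 1` itself, and no continuation of `f 0` is available.
  by_cases hs : s = 0
  · refine ⟨F, ?_⟩
    have : _root_.jumpFn f s = f (s + 1) := by ext y; simp [_root_.jumpFn, hs]
    rwa [this]
  · obtain ⟨F', hF'⟩ := h0 hs
    refine ⟨fun z => F z - F' z, ?_⟩
    have : _root_.jumpFn f s = fun y => f (s + 1) y - f s y := by ext y; simp [_root_.jumpFn, hs]
    rw [this]
    exact hF.sub hF'

/-- On a degenerate interval the moment series reduces to its first term. -/
lemma momentSeries_singleton (p w : ℝ) (hw : w ∈ Icc p p) :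
    (∀ j : ℕ, ContDiffOn ℝ j (momentFn κ w (j + 1) h) (Icc p p)) ∧
      Summable (momentTerm κ (Icc p p) w h) := by
  rw [Icc_self] at hw ⊢
  refine ⟨fun j => (contDiffOn_const (c := momentFn κ w (j + 1) h p)).congr fun y hy => by
    rw [mem_singleton_iff.1 hy], ?_⟩
  refine summable_of_ne_finset_zero (s := {0}) fun j hj => ?_
  obtain ⟨k, rfl⟩ : ∃ k, j = k + 1 := ⟨j - 1, by
    have : j ≠ 0 := by simpa using hj
    omega⟩
  -- A singleton has no accumulation point, so `derivWithin` takes its default value zero and only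
  -- the term without derivatives remains.
  have : ¬ AccPt w (𝓟 ({p} : Set ℝ)) := by
    rw [accPt_principal_iff_nhdsWithin, mem_singleton_iff.1 hw]
    simp
  rw [momentTerm, iteratedDerivWithin_succ, derivWithin_zero_of_not_accPt this, zero_div]

variable [IsMarkovKernel κ]

lemma momentFn_eq_integral_condQuantile (w : ℝ) (j : ℕ) (h : ℝ → ℝ) (y : ℝ) :
    momentFn κ w j h y = ∫ τ in Ioo (0 : ℝ) 1, max (condQuantile κ τ y - w) 0 ^ j * h y := by
  rw [momentFn, integral_mul_const]
  congr 1
  exact integral_condQuantile (φ := fun r => max (r - w) 0 ^ j) (by fun_prop) y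

lemma QuantileContinuation.smoothFamily (hG : QuantileContinuation κ p q ρ δ G) (hpq : p < q)
    (hH : AnalyticContinuation p q ρ h H) (w : ℝ) (j : ℕ) :
    SmoothFamily (volume.restrict (Ioo (0 : ℝ) 1)) (Ioo 0 1) (Icc p q) j
      (fun τ y => max (condQuantile κ τ y - w) 0 ^ (j + 1) * h y) := by
  have hρ := hG.radius_pos
  have h1 : SmoothFamily (volume.restrict (Ioo (0 : ℝ) 1)) (Ioo 0 1) (Icc p q) j
      (condQuantile κ) :=
    smoothFamily_of_continuation hρ hpq ae_mem_unitInterval hG.continuation hG.bounded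
      (fun y _ => (aemeasurable_condQuantile y).aestronglyMeasurable) j
  have h2 : SmoothFamily (volume.restrict (Ioo (0 : ℝ) 1)) (Ioo 0 1) (Icc p q) j (fun _ => h) := by
    obtain ⟨C, hC⟩ := hH.bounded
    exact smoothFamily_of_continuation hρ hpq ae_mem_unitInterval (fun _ _ => hH)
      ⟨C, fun _ _ => hC⟩ (fun y _ => aestronglyMeasurable_const) j
  exact (h1.add (SmoothFamily.const j (-w))).posPart_pow_mul h2

lemma QuantileContinuation.contDiffOn_momentFn (hG : QuantileContinuation κ p q ρ δ G)
    (hpq : p < q) (hH : AnalyticContinuation p q ρ h H) (w : ℝ) (j : ℕ) :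
    ContDiffOn ℝ j (momentFn κ w (j + 1) h) (Icc p q) :=
  ((hG.smoothFamily hpq hH w j).contDiffOn_integral ae_mem_unitInterval hpq).congr
    fun y _ => momentFn_eq_integral_condQuantile w (j + 1) h y

/-- The conditional moment is the integral over `τ` of the powers of the quantiles, and the
derivatives pass under this integral. -/
lemma QuantileContinuation.momentTerm_eq (hG : QuantileContinuation κ p q ρ δ G) (hpq : p < q)
    (hH : AnalyticContinuation p q ρ h H) {w : ℝ} (hw : w ∈ Icc p q) (j : ℕ) :
    momentTerm κ (Icc p q) w h j = ∫ τ in Ioo (0 : ℝ) 1, quantileTerm κ p q w h j τ := by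
  unfold momentTerm quantileTerm
  rw [integral_div]
  congr 1
  rw [← (hG.smoothFamily hpq hH w j).iteratedDerivWithin_integral ae_mem_unitInterval hpq hw]
  exact iteratedDerivWithin_congr
    (fun y _ => momentFn_eq_integral_condQuantile w (j + 1) h y) hw

lemma QuantileContinuation.aestronglyMeasurable_quantileTerm
    (hG : QuantileContinuation κ p q ρ δ G) (hpq : p < q)
    (hH : AnalyticContinuation p q ρ h H) {w : ℝ} (hw : w ∈ Icc p q) (j : ℕ) :
    AEStronglyMeasurable (quantileTerm κ p q w h j) (volume.restrict (Ioo (0 : ℝ) 1)) :=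
  ((hG.smoothFamily hpq hH w j).measurable_iteratedDerivWithin ae_mem_unitInterval hpq
    hw).mul_const _

lemma QuantileContinuation.integrable_tsum_quantileTerm (hG : QuantileContinuation κ p q ρ δ G)
    (hδ : δ < 1) (hpq : p < q) (hH : AnalyticContinuation p q ρ h H) {w : ℝ} (hw : w ∈ Icc p q) :
    Integrable (fun τ => ∑' j, quantileTerm κ p q w h j τ) (volume.restrict (Ioo (0 : ℝ) 1)) := by
  obtain ⟨K, hK⟩ := hG.exists_quantileTerm_bound hpq hH hw
  refine integrable_tsum_of_geometric_bound (K := K) hG.nonneg hδ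
    (hG.aestronglyMeasurable_quantileTerm hpq hH hw) fun j => ?_
  filter_upwards [ae_mem_unitInterval] with τ hτ using hK j τ hτ

theorem QuantileContinuation.hasSum_momentTerm (hG : QuantileContinuation κ p q ρ δ G)
    (hδ : δ < 1) (hpq : p < q) (hH : AnalyticContinuation p q ρ h H) {w : ℝ} (hw : w ∈ Icc p q) :
    HasSum (momentTerm κ (Icc p q) w h)
      (∫ τ in Ioo (0 : ℝ) 1, ∑' j, quantileTerm κ p q w h j τ) := by
  obtain ⟨K, hK⟩ := hG.exists_quantileTerm_bound hpq hH hw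
  have h1 : momentTerm κ (Icc p q) w h =
      fun j => ∫ τ in Ioo (0 : ℝ) 1, quantileTerm κ p q w h j τ :=
    funext fun j => hG.momentTerm_eq hpq hH hw j
  rw [h1]
  refine hasSum_integral_of_geometric_bound (K := K) hG.nonneg hδ
    (hG.aestronglyMeasurable_quantileTerm hpq hH hw) fun j => ?_
  filter_upwards [ae_mem_unitInterval] with τ hτ using hK j τ hτ

end MomentSeries

/-! ### The set where the conditional quantile exceeds the conditioning value -/

section SignChange

/-- A function on an interval whose derivative is negative at its zeros, and which is nonpositive at
the right end point, is nonnegative exactly on an initial interval. -/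
lemma nonneg_on_initial_interval {p q : ℝ} {h h' : ℝ → ℝ}
    (hd : ∀ y ∈ Icc p q, HasDerivWithinAt h (h' y) (Icc p q) y)
    (hneg : ∀ y ∈ Icc p q, h y = 0 → h' y < 0) (hq : h q ≤ 0) :
    (∀ v ∈ Icc p q, h v < 0) ∨
      ∃ a ∈ Icc p q, h a = 0 ∧ ∀ v ∈ Icc p q, 0 ≤ h v ↔ v ≤ a := by
  have hcont : ContinuousOn h (Icc p q) := fun y hy => (hd y hy).continuousWithinAt
  -- strictly to the left of a point with `0 ≤ h y`, the function is positive
  have hleft : ∀ v ∈ Icc p q, ∀ y ∈ Icc p q, v < y → 0 ≤ h y → 0 < h v := by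
    intro v hv y hy hvy h0
    by_contra hc
    have hsub : Icc v y ⊆ Icc p q := Icc_subset_Icc hv.1 hy.2
    -- A function whose derivative is negative at each of its zeros cannot cross zero upwards. So `h
    -- ≤ 0` from `v` on, whence `h y = 0`; but then the difference quotients of `h` at `y` from the
    -- left are nonnegative, against `h' y < 0`.
    have hle : ∀ x ∈ Icc v y, h x ≤ 0 := by
      refine image_le_of_deriv_right_lt_deriv_boundary (B := fun _ => 0) (B' := fun _ => 0)
        (hcont.mono hsub) (f' := h') (fun x hx => ?_) (not_lt.1 hc)
        (fun x => hasDerivAt_const x 0) (fun x hx h1 => hneg x (hsub ⟨hx.1, hx.2.le⟩) h1)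
      refine ((hd x (hsub ⟨hx.1, hx.2.le⟩)).mono_of_mem_nhdsWithin ?_)
      refine mem_nhdsWithin.2 ⟨Iio y, isOpen_Iio, hx.2, fun z hz => ?_⟩
      exact hsub ⟨hx.1.trans hz.2, le_of_lt hz.1⟩
    have hy0 : h y = 0 := le_antisymm (hle y ⟨hvy.le, le_rfl⟩) h0
    have hdy : HasDerivWithinAt h (h' y) (Icc v y) y := (hd y hy).mono hsub
    have h1 := hasDerivWithinAt_iff_tendsto_slope.1 hdy
    have hnb := neBot_nhdsWithin_Icc_diff hvy (right_mem_Icc.2 hvy.le)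
    have h2 : 0 ≤ h' y := by
      refine ge_of_tendsto h1 ?_
      filter_upwards [self_mem_nhdsWithin] with z hz
      rw [slope_def_field, hy0, sub_zero]
      have hzy : z < y := lt_of_le_of_ne hz.1.2 hz.2
      exact div_nonneg_of_nonpos (hle z hz.1) (by linarith)
    exact absurd (hneg y hy hy0) (not_lt.2 h2)
  by_cases hall : ∀ v ∈ Icc p q, h v < 0
  · exact Or.inl hall
  · right
    push Not at hall
    obtain ⟨v, hv, hv0⟩ := hall
    obtain ⟨a, ha, ha0⟩ := intermediate_value_Icc' hv.2 (hcont.mono (Icc_subset_Icc hv.1 le_rfl))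
      (show (0 : ℝ) ∈ Icc (h q) (h v) from ⟨hq, hv0⟩)
    have haI : a ∈ Icc p q := ⟨hv.1.trans ha.1, ha.2⟩
    refine ⟨a, haI, ha0, fun x hx => ⟨fun h0 => ?_, fun hxa => ?_⟩⟩
    · by_contra hc
      exact absurd (hleft a haI x hx (not_le.1 hc) h0) (by rw [ha0]; exact lt_irrefl 0)
    · rcases hxa.eq_or_lt with rfl | hlt
      · exact ha0.ge
      · exact (hleft x hx a haI hlt ha0.ge).le

open Metric

variable {κ : Kernel ℝ ℝ} {p q ρ δ : ℝ} {G : ℝ → ℂ → ℂ} {h : ℝ → ℝ} {H : ℂ → ℂ}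

/-- Applies `nonneg_on_initial_interval` to `g_τ(v) - v`. At a zero the disc condition is in force,
and Cauchy's estimate gives `‖deriv (G τ) v‖ ≤ δ`, so the derivative of the difference is at most `δ
- 1 < 0`. -/
lemma QuantileContinuation.le_condQuantile_iff (hG : QuantileContinuation κ p q ρ δ G)
    (hδ : δ < 1) (hpq : p < q) {τ : ℝ} (hτ : τ ∈ Ioo (0 : ℝ) 1) (hq : condQuantile κ τ q ≤ q) :
    (∀ v ∈ Icc p q, condQuantile κ τ v < v) ∨
      ∃ a ∈ Icc p q, condQuantile κ τ a = a ∧ ∀ v ∈ Icc p q, v ≤ condQuantile κ τ v ↔ v ≤ a := by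
  have hρ := hG.radius_pos
  have := nonneg_on_initial_interval (h := fun v => condQuantile κ τ v - v)
    (h' := fun v => (deriv (G τ) v).re - 1)
    (fun y hy => ((hG.continuation τ hτ).hasDerivWithinAt hρ hpq hy).sub (hasDerivWithinAt_id y _))
    (fun y hy h0 => ?_) (by linarith)
  · simpa only [sub_neg, sub_nonneg, sub_eq_zero] using this
  · obtain ⟨R, hR, hd⟩ := (hG.continuation τ hτ).exists_radius
    have hdc : DiffContOnCl ℂ (fun z => G τ z - y) (ball (y : ℂ) ρ) := by
      apply DifferentiableOn.diffContOnCl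
      rw [closure_ball _ hρ.ne']
      exact ((hd y hy).mono (closedBall_subset_ball hR)).sub_const _
    have h1 := Complex.norm_deriv_le_of_forall_mem_sphere_norm_le hρ hdc
      (hG.disc y hy τ hτ (by linarith))
    rw [mul_div_assoc, div_self hρ.ne', mul_one, deriv_sub_const] at h1
    linarith [(Complex.re_le_norm (deriv (G τ) (y : ℂ)))]

lemma QuantileContinuation.quantileTerm_eq_zero (hG : QuantileContinuation κ p q ρ δ G)
    (hpq : p < q) (hH : AnalyticContinuation p q ρ h H) {w : ℝ} (hw : w ∈ Icc p q) {τ : ℝ}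
    (hτ : τ ∈ Ioo (0 : ℝ) 1) (hlt : condQuantile κ τ w < w) (j : ℕ) :
    quantileTerm κ p q w h j τ = 0 := by
  have := hG.quantileTerm_eq hpq hH hw j hτ
  rw [if_neg (not_le.2 hlt)] at this
  exact_mod_cast this

/-- The Lagrange series of the quantile of order `τ` sums to the integral of `h` over the part to
the right of `w` of the interval on which the conditional quantile is at least the conditioning
value. -/
theorem QuantileContinuation.hasSum_quantileTerm (hG : QuantileContinuation κ p q ρ δ G)
    (hδ : δ < 1) (hpq : p < q) (hH : AnalyticContinuation p q ρ h H) {w : ℝ} (hw : w ∈ Icc p q)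
    {τ : ℝ} (hτ : τ ∈ Ioo (0 : ℝ) 1) {a : ℝ} (ha : a ∈ Icc p q) (hfix : condQuantile κ τ a = a)
    (hiff : ∀ v ∈ Icc p q, v ≤ condQuantile κ τ v ↔ v ≤ a) (hwa : w ≤ a) :
    HasSum (fun j => quantileTerm κ p q w h j τ) (∫ y in w..a, h y) := by
  have hρ := hG.radius_pos
  have hle : w ≤ condQuantile κ τ w := (hiff w hw).2 hwa
  have hdisc := hG.disc w hw τ hτ hle
  have hcont := hG.continuation τ hτ
  obtain ⟨R, hR, hdG, hdH⟩ := hG.exists_radius hH hw hτ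
  -- Otherwise `w + ρ` is a real point of the circle that lies in `[p, a]`, so its quantile is at
  -- least `w + ρ`; this contradicts the disc condition, as `δ ρ < ρ`.
  have har : a < w + ρ := by
    by_contra hc
    have hwr : w + ρ ∈ Icc p q := ⟨by linarith [hw.1], (not_lt.1 hc).trans ha.2⟩
    have h1 := (hiff _ hwr).2 (not_lt.1 hc)
    have h2 := hdisc ((w + ρ : ℝ) : ℂ) (by simp [abs_of_pos hρ])
    rw [hcont.extends_real _ hwr, ← Complex.ofReal_sub, Complex.norm_real] at h2
    have h3 := (le_abs_self _).trans h2
    nlinarith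
  -- A primitive of `H` on the disc, whose increment from `w` to `a` is both the sum of the Lagrange
  -- series and the integral of `h`.
  obtain ⟨Φ, hΦ⟩ := hdH.isExactOn_ball
  have haball : (a : ℂ) ∈ ball (w : ℂ) ρ := by
    rw [mem_ball, dist_eq_norm, ← Complex.ofReal_sub, Complex.norm_real, Real.norm_eq_abs,
      abs_of_nonneg (by linarith)]
    linarith
  have hsum := hasSum_lagrangeTerm hρ hR hδ hdG hdH hdisc hΦ haball
    (by rw [hcont.extends_real a ha, hfix])
  have hint : ∫ y in w..a, h y = (Φ a - Φ w).re := by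
    have hmem : ∀ y ∈ uIcc w a, y ∈ Icc p q ∧ (y : ℂ) ∈ ball (w : ℂ) R := by
      intro y hy
      rw [uIcc_of_le hwa] at hy
      refine ⟨⟨hw.1.trans hy.1, hy.2.trans ha.2⟩, ?_⟩
      rw [mem_ball, dist_eq_norm, ← Complex.ofReal_sub, Complex.norm_real, Real.norm_eq_abs,
        abs_of_nonneg (by linarith [hy.1])]
      linarith [hy.2]
    rw [intervalIntegral.integral_eq_sub_of_hasDerivAt (f := fun y : ℝ => (Φ y).re),
      Complex.sub_re]
    · intro y hy
      refine (hΦ y (hmem y hy).2).real_of_complex.congr_deriv ?_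
      rw [hH.extends_real y (hmem y hy).1, Complex.ofReal_re]
    · exact ((hH.continuousOn hρ).mono fun y hy => (hmem y hy).1).intervalIntegrable
  rw [hint]
  have hre := Complex.hasSum_re hsum
  convert hre using 2 with j
  have := hG.quantileTerm_eq hpq hH hw j hτ
  rw [if_pos hle] at this
  rw [← this, Complex.ofReal_re]

end SignChange

/-! ### Piecewise functions -/

section Piecewise

/-- Summation by parts. The extra term on the left is the last piece prolonged to the right of the
last knot, which makes the induction on the number of pieces close. -/
lemma sum_indicator_Ico_add (f : ℕ → ℝ → ℝ) (t : ℕ → ℝ) (n : ℕ) (ht : ∀ s < n, t s ≤ t (s + 1))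
    (y : ℝ) :
    ∑ s ∈ Finset.range n, (Ico (t s) (t (s + 1))).indicator (f (s + 1)) y +
      (if n ≠ 0 ∧ t n ≤ y then f n y else 0) =
    ∑ s ∈ Finset.range n, (Ici (t s)).indicator (jumpFn f s) y := by
  induction n with
  | zero => simp
  | succ n ih =>
    rw [Finset.sum_range_succ, Finset.sum_range_succ, ← ih fun s hs => ht s (by omega)]
    have h1 := ht n (Nat.lt_succ_self n)
    simp only [indicator_apply, mem_Ico, mem_Ici, jumpFn, ne_eq, Nat.succ_ne_zero,
      not_false_eq_true, true_and]
    split_ifs <;> first | (exfalso; grind) | grind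

lemma piecewiseFn_eq_sum_jumpFn {S : ℕ} {t : ℕ → ℝ} (f : ℕ → ℝ → ℝ)
    (ht : ∀ s < S, t s < t (s + 1)) {y : ℝ} (hy : y < t S) :
    piecewiseFn S t f y = ∑ s ∈ Finset.range S, (Ici (t s)).indicator (jumpFn f s) y := by
  rw [← sum_indicator_Ico_add f t S (fun s hs => (ht s hs).le), piecewiseFn,
    if_neg (fun h => absurd h.2 (not_le.2 hy)), add_zero]

lemma integral_piecewiseFn {S : ℕ} {t : ℕ → ℝ} {f : ℕ → ℝ → ℝ} {p a : ℝ}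
    (ht : ∀ s < S, t s < t (s + 1)) (hpt : ∀ s < S, p ≤ t s) (hpa : p ≤ a) (haS : a ≤ t S)
    (hc : ∀ s < S, ContinuousOn (jumpFn f s) (Icc p a)) :
    ∫ y in p..a, piecewiseFn S t f y =
      ∑ s ∈ Finset.range S, if t s ≤ a then ∫ y in t s..a, jumpFn f s y else 0 := by
  -- Half-open intervals, because the rewriting in jumps holds only to the left of `t S`, and `a`
  -- may equal `t S`.
  have hIco : ∀ {x : ℝ} {φ : ℝ → ℝ}, x ≤ a → ∫ y in x..a, φ y = ∫ y in Ico x a, φ y := by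
    intro x φ hx
    rw [intervalIntegral.integral_of_le hx, integral_Ioc_eq_integral_Ioo,
      integral_Ico_eq_integral_Ioo]
  rw [hIco hpa, setIntegral_congr_fun measurableSet_Ico
    (g := fun y => ∑ s ∈ Finset.range S, (Ici (t s)).indicator (jumpFn f s) y)
    fun y hy => piecewiseFn_eq_sum_jumpFn f ht (hy.2.trans_le haS)]
  rw [integral_finsetSum]
  · refine Finset.sum_congr rfl fun s hs => ?_
    rw [setIntegral_indicator measurableSet_Ici]
    have hps := hpt s (Finset.mem_range.1 hs)
    split_ifs with h
    · rw [hIco h]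
      congr 2
      ext y
      simp only [mem_inter_iff, mem_Ico, mem_Ici]
      constructor
      · rintro ⟨⟨_, h1⟩, h2⟩; exact ⟨h2, h1⟩
      · rintro ⟨h1, h2⟩; exact ⟨⟨hps.trans h1, h2⟩, h1⟩
    · have : Ico p a ∩ Ici (t s) = ∅ := by
        ext y
        simp only [mem_inter_iff, mem_Ico, mem_Ici, mem_empty_iff_false, iff_false]
        rintro ⟨⟨_, h1⟩, h2⟩
        exact h (h2.trans h1.le)
      rw [this, Measure.restrict_empty, integral_zero_measure]
  · intro s hs
    refine Integrable.indicator ?_ measurableSet_Ici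
    exact ((hc s (Finset.mem_range.1 hs)).integrableOn_Icc).mono_set Ico_subset_Icc_self

end Piecewise

/-! ### The bound as an integral over quantile levels. -/

section AbstractBound

variable {κ : Kernel ℝ ℝ} [IsMarkovKernel κ] {p q ρ δ : ℝ} {G : ℝ → ℂ → ℂ} {S : ℕ} {t : ℕ → ℝ}
  {f : ℕ → ℝ → ℝ}

/-- The bunching bound is the integral over `τ` of the mass that the piecewise function puts on the
set where the conditional quantile of order `τ` is at least the conditioning value. -/
theorem bunchingBound_eq_integral (hG : QuantileContinuation κ p q ρ δ G) (hδ : δ < 1) (hpq : p < q)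
    (hf : ∀ s < S, ∃ F, AnalyticContinuation p q ρ (jumpFn f s) F)
    (hq : ∀ τ ∈ Ioo (0 : ℝ) 1, condQuantile κ τ q ≤ q)
    (ht : ∀ s < S, t s < t (s + 1)) (htI : ∀ s < S, t s ∈ Icc p q) (htS : t S = q) :
    ∃ L : ℝ → ℝ, Integrable L (volume.restrict (Ioo (0 : ℝ) 1)) ∧
      bunchingBound κ (Icc p q) S t f = ∫ τ in Ioo (0 : ℝ) 1, L τ ∧
      ∀ τ ∈ Ioo (0 : ℝ) 1,
        ((∀ v ∈ Icc p q, condQuantile κ τ v < v) ∧ L τ = 0) ∨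
        ∃ a ∈ Icc p q, (∀ v ∈ Icc p q, v ≤ condQuantile κ τ v ↔ v ≤ a) ∧
          L τ = ∫ y in p..a, piecewiseFn S t f y := by
  have hρ := hG.radius_pos
  choose! F hF using hf
  refine ⟨fun τ => ∑ s ∈ Finset.range S, ∑' j, quantileTerm κ p q (t s) (jumpFn f s) j τ,
    ?_, ?_, ?_⟩
  · refine integrable_finsetSum _ fun s hs => ?_
    have hs := Finset.mem_range.1 hs
    exact hG.integrable_tsum_quantileTerm hδ hpq (hF s hs) (htI s hs)
  · rw [integral_finsetSum _ fun s hs => hG.integrable_tsum_quantileTerm hδ hpq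
      (hF s (Finset.mem_range.1 hs)) (htI s (Finset.mem_range.1 hs))]
    refine Finset.sum_congr rfl fun s hs => ?_
    have hs := Finset.mem_range.1 hs
    exact (hG.hasSum_momentTerm hδ hpq (hF s hs) (htI s hs)).tsum_eq
  · intro τ hτ
    rcases hG.le_condQuantile_iff hδ hpq hτ (hq τ hτ) with hneg | ⟨a, ha, hfix, hiff⟩
    · refine Or.inl ⟨hneg, Finset.sum_eq_zero fun s hs => ?_⟩
      have hs := Finset.mem_range.1 hs
      simp_rw [hG.quantileTerm_eq_zero hpq (hF s hs) (htI s hs) hτ (hneg _ (htI s hs))]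
      exact tsum_zero
    · refine Or.inr ⟨a, ha, hiff, ?_⟩
      rw [integral_piecewiseFn ht (fun s hs => (htI s hs).1) ha.1 (ha.2.trans_eq htS.symm)
        fun s hs => ((hF s hs).continuousOn hρ).mono (Icc_subset_Icc le_rfl ha.2)]
      refine Finset.sum_congr rfl fun s hs => ?_
      have hs := Finset.mem_range.1 hs
      split_ifs with hle
      · exact (hG.hasSum_quantileTerm hδ hpq (hF s hs) (htI s hs) hτ ha hfix hiff hle).tsum_eq
      -- A knot to the right of `a` contributes nothing on either side.
      · have hlt : condQuantile κ τ (t s) < t s := by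
          by_contra hc
          exact hle ((hiff _ (htI s hs)).1 (not_lt.1 hc))
        simp_rw [hG.quantileTerm_eq_zero hpq (hF s hs) (htI s hs) hτ hlt]
        exact tsum_zero

end AbstractBound

/-! ### Choice under a kink -/

section Kink

variable {C : Set ℝ} {U₀ U₁ : ℝ → ℝ} {k y₀ y₁ y : ℝ}

/-- Maximizers of a payoff with a concave kink at `k`: the desired choice is the counterfactual
choice on the respective side of the kink if there is one, and the kink otherwise. -/
lemma kink_choice (h₀ : StrictConcaveOn ℝ C U₀) (h₁ : StrictConcaveOn ℝ C U₁) (hk : k ∈ C)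
    (hbelow : ∀ z ∈ C, z < k → U₀ z ≤ U₁ z) (heq : U₀ k = U₁ k)
    (habove : ∀ z ∈ C, k < z → U₁ z ≤ U₀ z)
    (hy₀ : y₀ ∈ C) (hm₀ : IsMaxOn U₀ C y₀) (hy₁ : y₁ ∈ C) (hm₁ : IsMaxOn U₁ C y₁)
    (hy : y ∈ C) (hm : IsMaxOn (fun z => if z ≤ k then U₀ z else U₁ z) C y) :
    (y₀ ≤ k → y = y₀) ∧ (k ≤ y₁ → y = y₁) ∧ (k < y₀ → y₁ < k → y = k) := by
  rw [isMaxOn_iff] at hm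
  -- The compound payoff is the minimum of `U₀` and `U₁`. A maximizer of `U₀` below the kink
  -- therefore maximizes the compound payoff too, and by strict concavity it is the only one;
  -- likewise for `U₁`.
  have hle₀ : ∀ z ∈ C, (if z ≤ k then U₀ z else U₁ z) ≤ U₀ z := by
    intro z hz
    split_ifs with h
    · exact le_rfl
    · exact habove z hz (not_le.1 h)
  have hle₁ : ∀ z ∈ C, (if z ≤ k then U₀ z else U₁ z) ≤ U₁ z := by
    intro z hz
    split_ifs with h
    · rcases h.lt_or_eq with h | rfl
      · exact hbelow z hz h
      · exact heq.le
    · exact le_rfl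
  refine ⟨fun h => ?_, fun h => ?_, fun hk₀ hk₁ => ?_⟩
  · have h1 := hm y₀ hy₀
    rw [if_pos h] at h1
    exact h₀.eq_of_isMaxOn
      (isMaxOn_iff.2 fun z hz => (isMaxOn_iff.1 hm₀ z hz).trans (h1.trans (hle₀ y hy))) hm₀ hy hy₀
  · have h1 := hm y₁ hy₁
    have h2 : (if y₁ ≤ k then U₀ y₁ else U₁ y₁) = U₁ y₁ := by
      split_ifs with h'
      · rw [le_antisymm h' h, heq]
      · rfl
    rw [h2] at h1
    exact h₁.eq_of_isMaxOn
      (isMaxOn_iff.2 fun z hz => (isMaxOn_iff.1 hm₁ z hz).trans (h1.trans (hle₁ y hy))) hm₁ hy hy₁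
  · have h1 := hm k hk
    rw [if_pos le_rfl] at h1
    -- If `y < k < y₀`, strict concavity gives `U₀ k > U₀ y`, so the kink would be strictly better
    -- than `y`; symmetrically with `U₁` if `y₁ < k < y`.
    rcases lt_trichotomy y k with hlt | rfl | hgt
    · have h2 := h₀.lt_on_openSegment hy hy₀ (hlt.trans hk₀).ne (z := k)
        (by rw [openSegment_eq_Ioo (hlt.trans hk₀)]; exact ⟨hlt, hk₀⟩)
      rw [min_eq_left (isMaxOn_iff.1 hm₀ y hy)] at h2
      exact absurd (h1.trans (hle₀ y hy)) (not_le.2 h2)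
    · rfl
    · have h2 := h₁.lt_on_openSegment hy₁ hy (hk₁.trans hgt).ne (z := k)
        (by rw [openSegment_eq_Ioo (hk₁.trans hgt)]; exact ⟨hk₁, hgt⟩)
      rw [min_eq_right (isMaxOn_iff.1 hm₁ y hy)] at h2
      rw [heq] at h1
      exact absurd (h1.trans (hle₁ y hy)) (not_le.2 h2)

lemma mem_window_iff_of_kink {k₀ k₁ : ℝ} (hk : k ∈ Icc k₀ k₁)
    (h : (y₀ ≤ k → y = y₀) ∧ (k ≤ y₁ → y = y₁) ∧ (k < y₀ → y₁ < k → y = k)) :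
    y ∈ Icc k₀ k₁ ↔ k₀ ≤ y₀ ∧ y₁ ≤ k₁ := by
  obtain ⟨h0, h1, h2⟩ := h
  constructor
  · intro hy
    constructor
    · by_contra hc
      have := h0 ((not_le.1 hc).le.trans hk.1)
      exact hc (this ▸ hy.1)
    · by_contra hc
      have := h1 (hk.2.trans (not_le.1 hc).le)
      exact hc (this ▸ hy.2)
  · rintro ⟨ha, hb⟩
    by_cases hc0 : y₀ ≤ k
    · rw [h0 hc0]; exact ⟨ha, hc0.trans hk.2⟩
    · by_cases hc1 : k ≤ y₁
      · rw [h1 hc1]; exact ⟨hk.1.trans hc1, hb⟩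
      · rw [h2 (not_le.1 hc0) (not_le.1 hc1)]; exact hk

lemma FrictionWindow.mem_iff {Ω : Type*} {k k₀ k₁ : ℝ} {Ystar Y : Ω → ℝ}
    (h : FrictionWindow k k₀ k₁ Ystar Y) (ω : Ω) : Y ω ∈ Icc k₀ k₁ ↔ Ystar ω ∈ Icc k₀ k₁ := by
  constructor
  · intro hY
    by_contra hc
    exact hc (h.desired_outside ω hc ▸ hY)
  · intro hY
    by_contra hc
    exact hc (h.observed_outside ω hc ▸ hY)

end Kink

/-! ### Disintegration of the bunching mass -/

section Disintegration

variable {Ω : Type*} [MeasurableSpace Ω] {Q : Measure Ω} {V W : Ω → ℝ}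
  {κ : Kernel ℝ ℝ} {p q : ℝ}

/-- A continuous function that exceeds `c` at a point of the interval does so on a relatively open
set, which has positive measure. -/
lemma le_of_forall_ae_restrict_Icc {g : ℝ → ℝ} (hpq : p < q) (hg : ContinuousOn g (Icc p q))
    {N : Set ℝ} (hN : volume (N ∩ Icc p q) = 0) {c : ℝ} (hle : ∀ v ∈ Icc p q, v ∉ N → g v ≤ c) :
    ∀ v ∈ Icc p q, g v ≤ c := by
  intro v hv
  by_contra hc
  have h1 : ∀ᶠ z in 𝓝[Icc p q] v, c < g z := (hg v hv).eventually (lt_mem_nhds (not_le.1 hc))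
  obtain ⟨U, hU, hvU, hsub⟩ := mem_nhdsWithin.1 h1
  have hv' : v ∈ closure (Ioo p q) := by rwa [closure_Ioo hpq.ne]
  obtain ⟨x, hx⟩ := mem_closure_iff.1 hv' U hU hvU
  have hpos : 0 < volume (U ∩ Ioo p q) := (hU.inter isOpen_Ioo).measure_pos _ ⟨x, hx⟩
  refine hpos.ne' (measure_mono_null ?_ hN)
  rintro z ⟨hzU, hzI⟩
  have hzI' := Ioo_subset_Icc_self hzI
  refine ⟨?_, hzI'⟩
  by_contra hzN
  exact absurd (hsub ⟨hzU, hzI'⟩) (not_lt.2 (hle z hzI' hzN))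

variable [IsFiniteMeasure Q]

lemma IsCondLaw.measure_inter (hκ : IsCondLaw Q V W κ) (hV : Measurable V) (hW : Measurable W)
    {s : Set (ℝ × ℝ)} (hs : MeasurableSet s) :
    Q {ω | (V ω, W ω) ∈ s} = ∫⁻ v, κ v (Prod.mk v ⁻¹' s) ∂(Q.map V) := by
  have := hκ.1
  have h1 : Q {ω | (V ω, W ω) ∈ s} = (Q.map fun ω => (V ω, W ω)) s :=
    (Measure.map_apply (hV.prodMk hW) hs).symm
  rw [h1, hκ.2, Measure.compProd_apply hs]

/-- If `W ≤ q` almost surely on `p ≤ V ≤ W`, then all conditional quantiles of `W` given `V = v` are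
at most `q`, for all `v` in `[p, q]`. -/
lemma IsCondLaw.condQuantile_le (hκ : IsCondLaw Q V W κ) (hV : Measurable V) (hW : Measurable W)
    (hpq : p < q) (hnull : Q {ω | p ≤ V ω ∧ V ω ≤ W ω ∧ q < W ω} = 0)
    (hac : ∀ N, MeasurableSet N → N ⊆ Icc p q → Q.map V N = 0 → volume N = 0)
    (hcont : ∀ τ ∈ Ioo (0 : ℝ) 1, ContinuousOn (condQuantile κ τ) (Icc p q)) :
    ∀ τ ∈ Ioo (0 : ℝ) 1, ∀ v ∈ Icc p q, condQuantile κ τ v ≤ q := by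
  have := hκ.1
  have hs : MeasurableSet (Icc p q ×ˢ Ioi q) := measurableSet_Icc.prod measurableSet_Ioi
  -- On this set `V ≤ q < W`, so it is part of the null set of the hypothesis.
  have h1 : Q {ω | (V ω, W ω) ∈ Icc p q ×ˢ Ioi q} = 0 := by
    refine measure_mono_null ?_ hnull
    rintro ω ⟨⟨ha, hb⟩, hc⟩
    exact ⟨ha, hb.trans (le_of_lt hc), hc⟩
  rw [hκ.measure_inter hV hW hs, lintegral_eq_zero_iff (Kernel.measurable_kernel_prodMk_left hs),
    Filter.EventuallyEq, ae_iff] at h1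
  set N := toMeasurable (Q.map V) {v | ¬ κ v (Prod.mk v ⁻¹' Icc p q ×ˢ Ioi q) = (0 : ℝ → ENNReal) v}
    with hNdef
  have hN0 : Q.map V N = 0 := by rw [hNdef, measure_toMeasurable, h1]
  have hvol : volume (N ∩ Icc p q) = 0 :=
    hac _ ((measurableSet_toMeasurable _ _).inter measurableSet_Icc) inter_subset_right
      (measure_mono_null inter_subset_left hN0)
  intro τ hτ
  -- The conditional law is controlled only outside a null set; continuity of the quantiles in the
  -- conditioning value extends the bound to every point, in particular to the end point `q` where
  -- it is needed.
  refine le_of_forall_ae_restrict_Icc hpq (hcont τ hτ) hvol fun v hv hvN => ?_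
  rw [condQuantile_le_iff hτ]
  have h2 : κ v (Prod.mk v ⁻¹' Icc p q ×ˢ Ioi q) = 0 := by
    by_contra hc
    exact hvN (subset_toMeasurable _ _ hc)
  rw [mk_preimage_prod_right hv] at h2
  have h3 : (κ v).real (Iic q) = 1 := by
    have := probReal_compl_eq_one_sub (μ := κ v) (measurableSet_Ioi (a := q))
    rw [compl_Ioi, measureReal_def (κ v) (Ioi q), h2] at this
    simpa using this
  rw [h3]; exact hτ.2.le

/-- The mass of `p ≤ V ≤ W` as an integral over the order of the conditional quantile. -/
lemma IsCondLaw.measure_le_eq_integral (hκ : IsCondLaw Q V W κ) (hV : Measurable V)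
    (hW : Measurable W) (hnull : Q {ω | p ≤ V ω ∧ V ω ≤ W ω ∧ q < W ω} = 0) :
    Integrable (fun τ => (Q.map V).real {v | v ∈ Icc p q ∧ v ≤ condQuantile κ τ v})
      (volume.restrict (Ioo (0 : ℝ) 1)) ∧
    Q.real {ω | p ≤ V ω ∧ V ω ≤ W ω} = ∫ τ in Ioo (0 : ℝ) 1,
      (Q.map V).real {v | v ∈ Icc p q ∧ v ≤ condQuantile κ τ v} := by
  have := hκ.1
  have hfin : IsFiniteMeasure (Q.map V) := inferInstance
  set s : Set (ℝ × ℝ) := {x | x.1 ∈ Icc p q ∧ x.1 ≤ x.2} with hsdef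
  have hs : MeasurableSet s :=
    (measurable_fst measurableSet_Icc).inter (measurableSet_le measurable_fst measurable_snd)
  have h1 : Q {ω | p ≤ V ω ∧ V ω ≤ W ω} = Q {ω | (V ω, W ω) ∈ s} := by
    apply le_antisymm
    · calc Q {ω | p ≤ V ω ∧ V ω ≤ W ω}
          ≤ Q ({ω | (V ω, W ω) ∈ s} ∪ {ω | p ≤ V ω ∧ V ω ≤ W ω ∧ q < W ω}) := by
            refine measure_mono ?_
            rintro ω ⟨ha, hb⟩
            by_cases hc : q < W ω
            · exact Or.inr ⟨ha, hb, hc⟩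
            · exact Or.inl ⟨⟨ha, hb.trans (not_lt.1 hc)⟩, hb⟩
        _ ≤ Q {ω | (V ω, W ω) ∈ s} + Q {ω | p ≤ V ω ∧ V ω ≤ W ω ∧ q < W ω} := measure_union_le _ _
        _ = Q {ω | (V ω, W ω) ∈ s} := by rw [hnull, add_zero]
    · refine measure_mono ?_
      rintro ω ⟨ha, hb⟩
      exact ⟨ha.1, hb⟩
  -- The points `(v, τ)` with `v ≤ g_τ(v)`. For fixed `v` the length of its section is the
  -- conditional probability of `v ≤ W`; for fixed `τ` its section is the set in the claim. Fubini
  -- compares the two.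
  set E : Set (ℝ × ℝ) := {x | x.2 ∈ Ioo (0 : ℝ) 1 ∧ x.1 ≤ condQuantile κ x.2 x.1} ∩
    {x | x.1 ∈ Icc p q} with hEdef
  have hE : MeasurableSet E :=
    (measurable_swap (measurableSet_le_condQuantile (κ := κ))).inter
      (measurable_fst measurableSet_Icc)
  have h2 : ∀ v, κ v (Prod.mk v ⁻¹' s) = (volume.restrict (Ioo (0 : ℝ) 1)) (Prod.mk v ⁻¹' E) := by
    intro v
    rw [← map_condQuantile (κ := κ) v, Measure.map_apply_of_aemeasurable
      (aemeasurable_condQuantile v) (measurable_prodMk_left hs),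
      Measure.restrict_apply' measurableSet_Ioo, Measure.restrict_apply' measurableSet_Ioo]
    congr 1
    ext τ
    simp only [hsdef, hEdef, mem_inter_iff, mem_preimage, mem_ofPred_eq]
    tauto
  have h3 : Q {ω | p ≤ V ω ∧ V ω ≤ W ω} = ∫⁻ τ in Ioo (0 : ℝ) 1,
      (Q.map V) ((fun v => (v, τ)) ⁻¹' E) := by
    rw [h1, hκ.measure_inter hV hW hs]
    simp_rw [h2]
    rw [← Measure.prod_apply hE, Measure.prod_apply_symm hE]
  have h4 : ∀ τ ∈ Ioo (0 : ℝ) 1, (fun v => (v, τ)) ⁻¹' E =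
      {v | v ∈ Icc p q ∧ v ≤ condQuantile κ τ v} := by
    intro τ hτ
    ext v
    simp only [hEdef, mem_inter_iff, mem_preimage, mem_ofPred_eq]
    tauto
  have hm : Measurable fun τ => (Q.map V) ((fun v => (v, τ)) ⁻¹' E) :=
    measurable_measure_prodMk_right hE
  have h5 : ∀ᵐ τ ∂(volume.restrict (Ioo (0 : ℝ) 1)),
      ((Q.map V) ((fun v => (v, τ)) ⁻¹' E)).toReal =
        (Q.map V).real {v | v ∈ Icc p q ∧ v ≤ condQuantile κ τ v} := by
    filter_upwards [ae_mem_unitInterval] with τ hτ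
    rw [h4 τ hτ, measureReal_def]
  constructor
  · refine (Integrable.of_bound (C := (Q.map V).real univ)
      hm.ennreal_toReal.aestronglyMeasurable (Eventually.of_forall fun τ => ?_)).congr h5
    rw [Real.norm_of_nonneg ENNReal.toReal_nonneg]
    exact measureReal_mono (subset_univ _)
  · rw [measureReal_def, h3, ← integral_congr_ae h5, integral_toReal hm.aemeasurable]
    exact Eventually.of_forall fun τ => measure_lt_top _ _

end Disintegration

/-! ### Bunching designs -/

namespace BunchingDesign

variable {Ω : Type*} {dx dθ : ℕ} {D : BunchingDesign Ω dx dθ}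

lemma mInv_spec (hI : D.InvertibleEquations) {x : EuclideanSpace ℝ (Fin dx)}
    (hx : x ∈ D.covariates) {θ : EuclideanSpace ℝ (Fin dθ)} (hθ : θ ∈ D.params) :
    D.mInv 1 x D.k₁ θ ∈ D.types ∧ D.m 1 x (D.mInv 1 x D.k₁ θ) θ = D.k₁ :=
  ⟨Function.invFunOn_mem (hI.reversion_defined x hx θ hθ),
    Function.invFunOn_eq (hI.reversion_defined x hx θ hθ)⟩

variable [MeasurableSpace Ω]

/-- The unit is observed in the window if and only if its counterfactual choice under policy `0`
lies between the lower edge of the window and the reversion of its upper edge. -/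
lemma observed_mem_window_iff (hF : D.Framework) (hK : D.KinkedPayoff)
    (hI : D.InvertibleEquations) (hfr : FrictionWindow D.k D.k₀ D.k₁ D.Ystar D.Y) (ω : Ω) :
    D.Y ω ∈ Icc D.k₀ D.k₁ ↔
      D.k₀ ≤ D.counterfactual 0 ω ∧
        D.counterfactual 0 ω ≤ D.reversion D.k₁ (D.X ω) D.θ₀ := by
  have hX := hF.X_mem ω
  have hη := hF.η_mem ω
  have hkC : D.k ∈ D.choices := Ioo_subset_Icc_self hF.cutoff_interior
  rw [hfr.mem_iff ω, mem_window_iff_of_kink hF.cutoff_mem_window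
    (kink_choice (hK.strictConcave 0 _ hX _ hη) (hK.strictConcave 1 _ hX _ hη) hkC
      (fun z hz hzk => sub_nonpos.1 (hK.below _ hX _ hη z hz hzk))
      (sub_eq_zero.1 (hK.at_cutoff _ hX _ hη))
      (fun z hz hzk => sub_nonneg.1 (hK.above _ hX _ hη z hz hzk))
      (hK.counterfactual_argmax 0 ω).1 (hK.counterfactual_argmax 0 ω).2
      (hK.counterfactual_argmax 1 ω).1 (hK.counterfactual_argmax 1 ω).2
      (hK.desired_argmax ω).1 (hK.desired_argmax ω).2)]
  refine and_congr_right fun _ => ?_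
  obtain ⟨h1, h2⟩ := mInv_spec hI hX hF.true_param
  unfold counterfactual reversion
  conv_lhs => rw [← h2]
  exact ((hI.strictMono 1 _ hX _ hF.true_param).le_iff_le hη h1).trans
    ((hI.strictMono 0 _ hX _ hF.true_param).le_iff_le hη h1).symm

lemma measurable_of_continuousOn {E : Type*} [TopologicalSpace E] [MeasurableSpace E]
    [OpensMeasurableSpace E] {s : Set E} {φ : E → ℝ} (hφ : ContinuousOn φ s) {Z : Ω → E}
    (hZ : Measurable Z) (hs : ∀ ω, Z ω ∈ s) : Measurable fun ω => φ (Z ω) :=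
  (continuousOn_iff_continuous_domRestrict.1 hφ).measurable.comp (hZ.subtype_mk (h := hs))

lemma measurable_counterfactual (hF : D.Framework) (hI : D.InvertibleEquations) (d : Fin 2) :
    Measurable (D.counterfactual d) :=
  measurable_of_continuousOn (hI.continuous_m d _ hF.true_param)
    (hF.measurable_X.prodMk hF.measurable_η) fun ω => ⟨hF.X_mem ω, hF.η_mem ω⟩

lemma measurable_reversion (hF : D.Framework) (hI : D.InvertibleEquations)
    {θ : EuclideanSpace ℝ (Fin dθ)} (hθ : θ ∈ D.params) :
    Measurable fun ω => D.reversion D.k₁ (D.X ω) θ := by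
  have h1 : ContinuousOn (fun x => D.mInv 1 x D.k₁ θ) D.covariates :=
    (hI.continuous_mInv 1 θ hθ).comp (f := fun x => (x, D.k₁)) (by fun_prop)
      fun x hx => ⟨hx, hI.reversion_defined x hx θ hθ⟩
  have h2 : ContinuousOn (fun x => D.reversion D.k₁ x θ) D.covariates :=
    (hI.continuous_m 0 θ hθ).comp (f := fun x => (x, D.mInv 1 x D.k₁ θ))
      (continuousOn_id.prodMk h1) fun x hx => ⟨hx, (mInv_spec hI hx hθ).1⟩
  exact measurable_of_continuousOn h2 hF.measurable_X hF.X_mem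

/-- From the lower bound on the density. Together with the lower bound on the conditional weight it
makes Lebesgue measure absolutely continuous with respect to the weighted law of the counterfactual
choice on the interval. -/
lemma exists_le_map_counterfactual {P : Measure Ω} (hD : D.DataAndFrictions P) (d : Fin 2) :
    ∃ c : ENNReal, c ≠ 0 ∧ ∀ N, MeasurableSet N → N ⊆ Icc (D.supLo d) (D.supHi d) →
      c * volume N ≤ P.map (D.counterfactual d) N := by
  obtain ⟨c₁, c₂, hc₁, -, h⟩ := hD.density
  obtain ⟨f, hf, hb, heq⟩ := h d
  refine ⟨ENNReal.ofReal c₁, by simpa using hc₁, fun N hN hsub => ?_⟩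
  have e : P.map (D.counterfactual d) N = ∫⁻ y in N, ENNReal.ofReal (f y) := by
    conv_lhs => rw [← inter_eq_self_of_subset_left hsub, ← Measure.restrict_apply hN, heq,
      withDensity_apply _ hN, Measure.restrict_restrict hN, inter_eq_self_of_subset_left hsub]
  rw [e, ← setLIntegral_const]
  exact setLIntegral_mono' hN fun y hy => ENNReal.ofReal_le_ofReal (hb y (hsub hy)).1

variable {P : Measure Ω} [IsProbabilityMeasure P]

lemma integrable_T (hF : D.Framework) (hW : D.WeightCondition P) : Integrable D.T P := by
  obtain ⟨c₁, c₂, -, -, h, -⟩ := hW.bounds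
  refine Integrable.of_bound (hF.measurable_weight.comp hF.measurable_X).aestronglyMeasurable c₂
    (Eventually.of_forall fun ω => ?_)
  rw [Real.norm_of_nonneg (hW.nonneg ω)]
  exact h ω

lemma isFiniteMeasure_PT (hF : D.Framework) (hW : D.WeightCondition P) :
    IsFiniteMeasure (D.PT P) :=
  isFiniteMeasure_withDensity_ofReal ((integrable_T hF hW).div_const _).2

/-- The event belongs to the σ-algebra of the counterfactual choice, so the weight may be replaced
by its conditional mean under the integral. -/
lemma exists_le_setIntegral_T (hF : D.Framework) (hI : D.InvertibleEquations)
    (hW : D.WeightCondition P) :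
    ∃ c > 0, ∀ N, MeasurableSet N → N ⊆ Icc (D.supLo 0) (D.supHi 0) →
      c * P.real (D.counterfactual 0 ⁻¹' N) ≤ ∫ ω in D.counterfactual 0 ⁻¹' N, D.T ω ∂P := by
  obtain ⟨c₁, c₂, hc₁, -, -, hc⟩ := hW.bounds
  have hV := measurable_counterfactual hF hI 0
  refine ⟨c₁, hc₁, fun N hN hsub => ?_⟩
  have hm : MeasurableSpace.comap (D.counterfactual 0) inferInstance ≤ ‹MeasurableSpace Ω› :=
    hV.comap_le
  rw [← setIntegral_condExp hm (integrable_T hF hW) ⟨N, hN, rfl⟩]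
  calc c₁ * P.real (D.counterfactual 0 ⁻¹' N)
      = ∫ _ in D.counterfactual 0 ⁻¹' N, c₁ ∂P := by
        rw [setIntegral_const, smul_eq_mul, mul_comm]
    _ ≤ _ := by
        refine setIntegral_mono_on_ae (integrableOn_const (measure_ne_top _ _))
          integrable_condExp.integrableOn (hV hN) ?_
        filter_upwards [hc] with ω hω hωN using hω (hsub hωN)

lemma integral_T_pos (hF : D.Framework) (hI : D.InvertibleEquations) (hD : D.DataAndFrictions P)
    (hW : D.WeightCondition P) : 0 < ∫ ω, D.T ω ∂P := by
  obtain ⟨c, hc, h⟩ := exists_le_setIntegral_T hF hI hW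
  obtain ⟨c', hc', h'⟩ := exists_le_map_counterfactual hD 0
  have h1 := h _ measurableSet_Icc subset_rfl
  have h2 := h' _ measurableSet_Icc subset_rfl
  rw [Measure.map_apply (measurable_counterfactual hF hI 0) measurableSet_Icc] at h2
  have h3 : 0 < volume (Icc (D.supLo 0) (D.supHi 0)) := by
    simpa using hF.sup_interior₀.1.trans hF.sup_interior₀.2
  have h4 : 0 < P (D.counterfactual 0 ⁻¹' Icc (D.supLo 0) (D.supHi 0)) :=
    (ENNReal.mul_pos hc' h3.ne').trans_le h2
  have h5 : 0 < P.real (D.counterfactual 0 ⁻¹' Icc (D.supLo 0) (D.supHi 0)) :=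
    ENNReal.toReal_pos h4.ne' (measure_ne_top _ _)
  calc 0 < _ := mul_pos hc h5
    _ ≤ _ := h1
    _ ≤ _ := setIntegral_le_integral (integrable_T hF hW) (Eventually.of_forall hW.nonneg)

/-- Sets that are null for the weighted law of the counterfactual choice are Lebesgue null. -/
lemma volume_eq_zero_of_map_PT (hF : D.Framework) (hI : D.InvertibleEquations)
    (hD : D.DataAndFrictions P) (hW : D.WeightCondition P) {N : Set ℝ} (hN : MeasurableSet N)
    (hsub : N ⊆ Icc (D.supLo 0) (D.supHi 0)) (h0 : (D.PT P).map (D.counterfactual 0) N = 0) :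
    volume N = 0 := by
  have hV := measurable_counterfactual hF hI 0
  have hE := integral_T_pos hF hI hD hW
  have hTm : Measurable D.T := hF.measurable_weight.comp hF.measurable_X
  rw [Measure.map_apply hV hN, PT, weightedMeasure, withDensity_apply _ (hV hN),
    lintegral_eq_zero_iff (hTm.div_const _).ennreal_ofReal] at h0
  have h1 : ∫ ω in D.counterfactual 0 ⁻¹' N, D.T ω ∂P = 0 := by
    refine integral_eq_zero_of_ae ?_
    filter_upwards [h0] with ω hω
    have h2 : D.T ω / ∫ ω', D.T ω' ∂P ≤ 0 := ENNReal.ofReal_eq_zero.1 hω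
    rw [div_le_iff₀ hE, zero_mul] at h2
    exact le_antisymm h2 (hW.nonneg ω)
  obtain ⟨c, hc, h⟩ := exists_le_setIntegral_T hF hI hW
  obtain ⟨c', hc', h'⟩ := exists_le_map_counterfactual hD 0
  have h2 := h N hN hsub
  rw [h1] at h2
  have h3 : P.real (D.counterfactual 0 ⁻¹' N) = 0 :=
    le_antisymm (by by_contra hc0; nlinarith [mul_pos hc (not_le.1 hc0)]) measureReal_nonneg
  have h4 := h' N hN hsub
  rw [Measure.map_apply hV hN, (measureReal_eq_zero_iff).1 h3, nonpos_iff_eq_zero,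
    mul_eq_zero] at h4
  exact h4.resolve_left hc'

end BunchingDesign

/-! ### The bounds for a bunching design. -/

section Bounds

variable {Ω : Type*} [MeasurableSpace Ω] {P : Measure Ω} [IsProbabilityMeasure P] {dx dθ : ℕ}
  {D : BunchingDesign Ω dx dθ} {κ : EuclideanSpace ℝ (Fin dθ) → Kernel ℝ ℝ}
  {kbar : EuclideanSpace ℝ (Fin dθ) → ℝ} {S : ℕ} {t : ℕ → ℝ} {ρ β δ : ℝ}

lemma knot_le_knot (ht : ∀ s < S, t s < t (s + 1)) {i j : ℕ} (hij : i ≤ j) (hj : j ≤ S) :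
    t i ≤ t j := by
  induction j, hij using Nat.le_induction with
  | base => exact le_rfl
  | succ j _ ih => exact (ih (by omega)).trans (ht j (by omega)).le

lemma exists_continuation_jumpFn {κ : Kernel ℝ ℝ} {p q : ℝ} {f : ℕ → ℝ → ℝ}
    (hf : ∀ s ∈ Finset.Icc 1 S, AnalyticityCondition p q (f s) (condQuantile κ) ρ β δ) :
    ∀ s < S, ∃ F, AnalyticContinuation p q ρ (jumpFn f s) F := fun s hs =>
  AnalyticContinuation.jumpFn
    (hf (s + 1) (Finset.mem_Icc.2 ⟨by omega, by omega⟩)).exists_continuation.1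
    fun h0 => (hf s (Finset.mem_Icc.2 ⟨by omega, by omega⟩)).exists_continuation.1

/-- The moment series at the knots are well defined under the analyticity condition. -/
theorem momentSeriesDefined_of_analyticityCondition {κ : Kernel ℝ ℝ} [IsMarkovKernel κ] {p q : ℝ}
    {f : ℕ → ℝ → ℝ} (hδ : δ < 1)
    (hf : ∀ s ∈ Finset.Icc 1 S, AnalyticityCondition p q (f s) (condQuantile κ) ρ β δ)
    {s : ℕ} (hs : s < S) (hts : t s ∈ Icc p q) : MomentSeriesDefined κ (Icc p q) t f s := by
  obtain ⟨F, hF⟩ := exists_continuation_jumpFn hf s hs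
  obtain ⟨G, hG⟩ := (hf (s + 1) (Finset.mem_Icc.2 ⟨by omega, by omega⟩)).exists_continuation.2
  -- The upper limit may coincide with `k₀` for a parameter other than the true one.
  rcases (hts.1.trans hts.2).eq_or_lt with rfl | hpq
  · exact momentSeries_singleton p (t s) hts
  · exact ⟨fun j => hG.contDiffOn_momentFn hpq hF (t s) j,
      (hG.hasSum_momentTerm hδ hpq hF hts).summable⟩

/-- The bunching probability is an integral, over the order `τ` of the conditional quantile, of the
weighted mass of the initial interval on which the quantile is at least the conditioning value. -/
theorem bunching_mass_eq_integral (hF : D.Framework) (hK : D.KinkedPayoff)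
    (hI : D.InvertibleEquations) (hD : D.DataAndFrictions P) (hW : D.WeightCondition P)
    (hU : D.IsUpperLimit P kbar)
    (hκ : ∀ θ ∈ D.params, IsCondLaw (D.PT P) (D.counterfactual 0)
        (fun ω => D.reversion D.k₁ (D.X ω) θ) (κ θ))
    (hlt : D.k₀ < kbar D.θ₀) (hρ : 0 < ρ) {G : ℝ → ℂ → ℂ}
    (hG : ∀ τ ∈ Ioo (0 : ℝ) 1,
      AnalyticContinuation D.k₀ (kbar D.θ₀) ρ (condQuantile (κ D.θ₀) τ) (G τ)) :
    (∀ τ ∈ Ioo (0 : ℝ) 1, condQuantile (κ D.θ₀) τ (kbar D.θ₀) ≤ kbar D.θ₀) ∧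
    Integrable (fun τ => (D.PT P).real {ω | D.counterfactual 0 ω ∈ Icc D.k₀ (kbar D.θ₀) ∧
      D.counterfactual 0 ω ≤ condQuantile (κ D.θ₀) τ (D.counterfactual 0 ω)})
      (volume.restrict (Ioo (0 : ℝ) 1)) ∧
    (D.PT P).real {ω | D.Y ω ∈ Icc D.k₀ D.k₁} = ∫ τ in Ioo (0 : ℝ) 1,
      (D.PT P).real {ω | D.counterfactual 0 ω ∈ Icc D.k₀ (kbar D.θ₀) ∧
        D.counterfactual 0 ω ≤ condQuantile (κ D.θ₀) τ (D.counterfactual 0 ω)} := by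
  have hfin : IsFiniteMeasure (D.PT P) := BunchingDesign.isFiniteMeasure_PT hF hW
  have hV := BunchingDesign.measurable_counterfactual hF hI 0
  have hWm := BunchingDesign.measurable_reversion hF hI hF.true_param
  have hwin := BunchingDesign.observed_mem_window_iff hF hK hI hD.frictions
  have hκ0 := hκ _ hF.true_param
  have := hκ0.1
  obtain ⟨hkb, hnull⟩ := hU _ hF.true_param
  have hnull' : D.PT P {ω | D.k₀ ≤ D.counterfactual 0 ω ∧
      D.counterfactual 0 ω ≤ D.reversion D.k₁ (D.X ω) D.θ₀ ∧
      kbar D.θ₀ < D.reversion D.k₁ (D.X ω) D.θ₀} = 0 := by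
    refine measure_mono_null ?_ hnull
    rintro ω ⟨h1, h2, h3⟩
    exact ⟨h3, (hwin ω).2 ⟨h1, h2⟩⟩
  have hcont : ∀ τ ∈ Ioo (0 : ℝ) 1,
      ContinuousOn (condQuantile (κ D.θ₀) τ) (Icc D.k₀ (kbar D.θ₀)) :=
    fun τ hτ => (hG τ hτ).continuousOn hρ
  have hle := hκ0.condQuantile_le hV hWm hlt hnull' (fun N hN hsub h0 =>
    BunchingDesign.volume_eq_zero_of_map_PT hF hI hD hW hN
      (hsub.trans (Icc_subset_Icc hF.sup_interior₀.1.le hkb.2)) h0) hcont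
  refine ⟨fun τ hτ => hle τ hτ _ (right_mem_Icc.2 hlt.le), ?_⟩
  have hmain := hκ0.measure_le_eq_integral hV hWm hnull'
  have hset : {ω | D.Y ω ∈ Icc D.k₀ D.k₁} = {ω | D.k₀ ≤ D.counterfactual 0 ω ∧
      D.counterfactual 0 ω ≤ D.reversion D.k₁ (D.X ω) D.θ₀} := by
    ext ω; exact hwin ω
  -- The set is closed, by continuity of the quantile on the interval.
  have hE : ∀ τ ∈ Ioo (0 : ℝ) 1, MeasurableSet {v | v ∈ Icc D.k₀ (kbar D.θ₀) ∧
      v ≤ condQuantile (κ D.θ₀) τ v} := by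
    intro τ hτ
    have h1 : IsClosed (Icc D.k₀ (kbar D.θ₀) ∩
        (fun v => condQuantile (κ D.θ₀) τ v - v) ⁻¹' Ici 0) :=
      ((hcont τ hτ).sub continuousOn_id).preimage_isClosed_of_isClosed isClosed_Icc isClosed_Ici
    convert h1.measurableSet using 1
    ext v
    simp
  have hmap : ∀ τ ∈ Ioo (0 : ℝ) 1,
      ((D.PT P).map (D.counterfactual 0)).real {v | v ∈ Icc D.k₀ (kbar D.θ₀) ∧
        v ≤ condQuantile (κ D.θ₀) τ v} =
      (D.PT P).real {ω | D.counterfactual 0 ω ∈ Icc D.k₀ (kbar D.θ₀) ∧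
        D.counterfactual 0 ω ≤ condQuantile (κ D.θ₀) τ (D.counterfactual 0 ω)} := fun τ hτ =>
    map_measureReal_apply hV (hE τ hτ)
  constructor
  · refine hmain.1.congr ?_
    filter_upwards [ae_mem_unitInterval] with τ hτ using hmap τ hτ
  · rw [hset, hmain.2]
    exact setIntegral_congr_fun measurableSet_Ioo hmap

/-- The mass and both bounds are integrals over `τ`. At each level the integrands refer to the same
initial interval `[k₀, a]`, or all vanish, so the envelope condition at `y = a` compares them. -/
theorem bunching_mass_mem_bounds (hF : D.Framework) (hK : D.KinkedPayoff)
    (hI : D.InvertibleEquations) (hD : D.DataAndFrictions P) (hW : D.WeightCondition P)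
    (hU : D.IsUpperLimit P kbar)
    (hκ : ∀ θ ∈ D.params, IsCondLaw (D.PT P) (D.counterfactual 0)
        (fun ω => D.reversion D.k₁ (D.X ω) θ) (κ θ))
    {flow fup : ℕ → ℝ → ℝ} {βlow βup : ℝ}
    (hS : 0 < S) (ht0 : t 0 = D.k₀) (ht : ∀ s < S, t s < t (s + 1)) (htS : t S = kbar D.θ₀)
    (hδ : δ < 1)
    (hup : ∀ s ∈ Finset.Icc 1 S,
      AnalyticityCondition D.k₀ (kbar D.θ₀) (fup s) (condQuantile (κ D.θ₀)) ρ βup δ)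
    (hlow : ∀ s ∈ Finset.Icc 1 S,
      AnalyticityCondition D.k₀ (kbar D.θ₀) (flow s) (condQuantile (κ D.θ₀)) ρ βlow δ)
    (henv : D.EnvelopeCondition P (kbar D.θ₀) (piecewiseFn S t flow) (piecewiseFn S t fup)) :
    (D.PT P).real {ω | D.Y ω ∈ Icc D.k₀ D.k₁} ∈
      Icc (bunchingBound (κ D.θ₀) (Icc D.k₀ (kbar D.θ₀)) S t flow)
        (bunchingBound (κ D.θ₀) (Icc D.k₀ (kbar D.θ₀)) S t fup) := by
  have := (hκ _ hF.true_param).1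
  -- One family of continuations of the quantiles serves both envelopes.
  obtain ⟨G, hG⟩ := (hup 1 (Finset.mem_Icc.2 ⟨le_rfl, hS⟩)).exists_continuation.2
  have hlt : D.k₀ < kbar D.θ₀ := by
    rw [← ht0, ← htS]
    exact (ht 0 hS).trans_le (knot_le_knot ht hS le_rfl)
  have htI : ∀ s < S, t s ∈ Icc D.k₀ (kbar D.θ₀) := fun s hs =>
    ⟨ht0 ▸ knot_le_knot ht (Nat.zero_le s) hs.le, htS ▸ knot_le_knot ht hs.le le_rfl⟩
  obtain ⟨hq, hint, hmass⟩ := bunching_mass_eq_integral hF hK hI hD hW hU hκ hlt hG.radius_pos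
    hG.continuation
  -- on each quantile level, the mass is that of an initial interval
  have hinit : ∀ τ, ∀ a ∈ Icc D.k₀ (kbar D.θ₀), (∀ v ∈ Icc D.k₀ (kbar D.θ₀),
      v ≤ condQuantile (κ D.θ₀) τ v ↔ v ≤ a) →
      (D.PT P).real {ω | D.counterfactual 0 ω ∈ Icc D.k₀ (kbar D.θ₀) ∧
        D.counterfactual 0 ω ≤ condQuantile (κ D.θ₀) τ (D.counterfactual 0 ω)} =
      (D.PT P).real {ω | D.counterfactual 0 ω ∈ Icc D.k₀ a} := by
    intro τ a ha hiff
    congr 1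
    ext ω
    constructor
    · rintro ⟨h1, h2⟩
      exact ⟨h1.1, (hiff _ h1).1 h2⟩
    · rintro ⟨h1, h2⟩
      have h3 : D.counterfactual 0 ω ∈ Icc D.k₀ (kbar D.θ₀) := ⟨h1, h2.trans ha.2⟩
      exact ⟨h3, (hiff _ h3).2 h2⟩
  have hempty : ∀ τ, (∀ v ∈ Icc D.k₀ (kbar D.θ₀), condQuantile (κ D.θ₀) τ v < v) →
      (D.PT P).real {ω | D.counterfactual 0 ω ∈ Icc D.k₀ (kbar D.θ₀) ∧
        D.counterfactual 0 ω ≤ condQuantile (κ D.θ₀) τ (D.counterfactual 0 ω)} = 0 := by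
    intro τ hneg
    have : {ω | D.counterfactual 0 ω ∈ Icc D.k₀ (kbar D.θ₀) ∧
        D.counterfactual 0 ω ≤ condQuantile (κ D.θ₀) τ (D.counterfactual 0 ω)} = ∅ := by
      ext ω
      simp only [mem_ofPred_eq, mem_empty_iff_false, iff_false]
      rintro ⟨h1, h2⟩
      exact absurd (hneg _ h1) (not_lt.2 h2)
    rw [this, measureReal_empty]
  rw [hmass]
  constructor
  · obtain ⟨L, hLi, hL, hcase⟩ := bunchingBound_eq_integral hG hδ hlt
      (exists_continuation_jumpFn hlow) hq ht htI htS
    rw [hL]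
    refine setIntegral_mono_on hLi hint measurableSet_Ioo fun τ hτ => ?_
    rcases hcase τ hτ with ⟨hneg, h0⟩ | ⟨a, ha, hiff, h0⟩
    · rw [h0, hempty τ hneg]
    · rw [h0, hinit τ a ha hiff]
      exact (henv a ha).1
  · obtain ⟨L, hLi, hL, hcase⟩ := bunchingBound_eq_integral hG hδ hlt
      (exists_continuation_jumpFn hup) hq ht htI htS
    rw [hL]
    refine setIntegral_mono_on hint hLi measurableSet_Ioo fun τ hτ => ?_
    rcases hcase τ hτ with ⟨hneg, h0⟩ | ⟨a, ha, hiff, h0⟩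
    · rw [h0, hempty τ hneg]
    · rw [h0, hinit τ a ha hiff]
      exact (henv a ha).2

end Bounds

/-! ### Lipschitz envelopes -/

section LipschitzEnvelopes

variable {f : ℝ → ℝ} {lo hi M : ℝ}

lemma continuousOn_of_abs_sub_le (hM : 0 ≤ M)
    (hf : ∀ x ∈ Icc lo hi, ∀ y ∈ Icc lo hi, |f x - f y| ≤ M * |x - y|) :
    ContinuousOn f (Icc lo hi) :=
  (LipschitzOnWith.of_dist_le_mul (K := ⟨M, hM⟩) fun x hx y hy => hf x hx y hy).continuousOn

lemma integral_bounds_left (hM : 0 ≤ M)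
    (hf : ∀ x ∈ Icc lo hi, ∀ y ∈ Icc lo hi, |f x - f y| ≤ M * |x - y|) {c : ℝ}
    (hc : c ∈ Icc lo hi) :
    f lo * (c - lo) - M * (c - lo) ^ 2 / 2 ≤ ∫ x in lo..c, f x ∧
      ∫ x in lo..c, f x ≤ f lo * (c - lo) + M * (c - lo) ^ 2 / 2 := by
  have hlo : lo ∈ Icc lo hi := ⟨le_rfl, hc.1.trans hc.2⟩
  have hint : IntervalIntegrable f volume lo c :=
    ((continuousOn_of_abs_sub_le hM hf).mono (by
      rw [uIcc_of_le hc.1]; exact Icc_subset_Icc le_rfl hc.2)).intervalIntegrable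
  have hlin : ∀ m : ℝ, IntervalIntegrable (fun x => f lo + m * (x - lo)) volume lo c := fun m =>
    Continuous.intervalIntegrable (by fun_prop) _ _
  have hval : ∀ m : ℝ, ∫ x in lo..c, (f lo + m * (x - lo)) =
      f lo * (c - lo) + m * (c - lo) ^ 2 / 2 := by
    intro m
    rw [intervalIntegral.integral_eq_sub_of_hasDerivAt
      (f := fun x => f lo * x + m * (x - lo) ^ 2 / 2) (fun x _ => ?_) (hlin m)]
    · ring
    · have := ((hasDerivAt_id x).const_mul (f lo)).add
        (((((hasDerivAt_id x).sub_const lo).pow 2).const_mul m).div_const 2)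
      refine this.congr_deriv ?_
      simp
      ring
  have hpt : ∀ x ∈ Icc lo c, f lo + -M * (x - lo) ≤ f x ∧ f x ≤ f lo + M * (x - lo) := by
    intro x hx
    have h := hf x ⟨hx.1, hx.2.trans hc.2⟩ lo hlo
    rw [abs_of_nonneg (sub_nonneg.2 hx.1), abs_le] at h
    constructor <;> linarith [h.1, h.2]
  constructor
  · calc _ = ∫ x in lo..c, (f lo + -M * (x - lo)) := by rw [hval]; ring
      _ ≤ _ := intervalIntegral.integral_mono_on hc.1 (hlin _) hint fun x hx => (hpt x hx).1
  · calc _ ≤ ∫ x in lo..c, (f lo + M * (x - lo)) :=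
          intervalIntegral.integral_mono_on hc.1 hint (hlin _) fun x hx => (hpt x hx).2
      _ = _ := hval M

/-- The reflection `x ↦ -x` exchanges the two ends of the interval. -/
lemma integral_bounds_right (hM : 0 ≤ M)
    (hf : ∀ x ∈ Icc lo hi, ∀ y ∈ Icc lo hi, |f x - f y| ≤ M * |x - y|) {c : ℝ}
    (hc : c ∈ Icc lo hi) :
    f hi * (hi - c) - M * (hi - c) ^ 2 / 2 ≤ ∫ x in c..hi, f x ∧
      ∫ x in c..hi, f x ≤ f hi * (hi - c) + M * (hi - c) ^ 2 / 2 := by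
  have h := integral_bounds_left (f := fun x => f (-x)) (lo := -hi) (hi := -lo) (c := -c) hM
    (fun x hx y hy => by
      have := hf (-x) ⟨by linarith [hx.2], by linarith [hx.1]⟩ (-y)
        ⟨by linarith [hy.2], by linarith [hy.1]⟩
      rwa [neg_sub_neg, abs_sub_comm y x] at this) ⟨by linarith [hc.2], by linarith [hc.1]⟩
  rw [intervalIntegral.integral_comp_neg, neg_neg, neg_neg, neg_sub_neg] at h
  exact h

/-- The elasticity bounds follow from the bounds on the bunching mass `B` that the Lipschitz
envelopes give, `l` being the length of the bunching interval. -/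
lemma mem_elasticitySet {a b B w L l θ : ℝ} (hM : 0 < M) (hL : 0 < L) (ha : 0 ≤ a) (hb : 0 ≤ b)
    (hl : l = w + θ * L) (hab : |a - b| ≤ M * l)
    (hlow : ∀ u u' : ℝ, 0 ≤ u → 0 ≤ u' → u + u' ≤ l →
      a * u - M * u ^ 2 / 2 + (b * u' - M * u' ^ 2 / 2) ≤ B)
    (hup : ∀ u u' : ℝ, 0 ≤ u → 0 ≤ u' → u + u' = l →
      B ≤ a * u + M * u ^ 2 / 2 + (b * u' + M * u' ^ 2 / 2)) :
    θ ∈ elasticitySet a b M B w L := by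
  rw [abs_le] at hab
  have h2M : 0 < 2 * M := by positivity
  have hl0 : 0 ≤ l := by
    by_contra hc
    nlinarith [mul_pos hM (neg_pos.2 (not_le.1 hc)), hab.1, hab.2]
  have hnot : ¬ B < |(a ^ 2 - b ^ 2) / (2 * M)| := by
    rw [not_lt, abs_div, abs_of_pos h2M, div_le_iff₀ h2M, abs_le]
    constructor
    · rcases le_total a b with h | h
      -- At distance `(b - a) / M` from the right end the lower cone has fallen from `b` to `a`; the
      -- mass under it up to there is `(b ^ 2 - a ^ 2) / (2 * M)`. The case `b ≤ a` uses the left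
      -- cone.
      · have := hlow 0 ((b - a) / M) le_rfl (div_nonneg (by linarith) hM.le)
          (by rw [zero_add, div_le_iff₀ hM]; linarith [hab.1])
        have e : b * ((b - a) / M) - M * ((b - a) / M) ^ 2 / 2 = (b ^ 2 - a ^ 2) / (2 * M) := by
          field_simp; ring
        rw [e] at this
        have h1 : (b ^ 2 - a ^ 2) / (2 * M) ≤ B := by linarith
        rw [div_le_iff₀ h2M] at h1
        linarith
      · have h0 := hlow 0 0 le_rfl le_rfl (by simpa using hl0)
        have : 0 ≤ B := by linarith
        nlinarith [mul_nonneg this h2M.le]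
    · rcases le_total a b with h | h
      · have h0 := hlow 0 0 le_rfl le_rfl (by simpa using hl0)
        have : 0 ≤ B := by linarith
        nlinarith [mul_nonneg this h2M.le]
      · have := hlow ((a - b) / M) 0 (div_nonneg (by linarith) hM.le) le_rfl
          (by rw [add_zero, div_le_iff₀ hM]; linarith [hab.2])
        have e : a * ((a - b) / M) - M * ((a - b) / M) ^ 2 / 2 = (a ^ 2 - b ^ 2) / (2 * M) := by
          field_simp; ring
        rw [e] at this
        have h1 : (a ^ 2 - b ^ 2) / (2 * M) ≤ B := by linarith
        rw [div_le_iff₀ h2M] at h1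
        linarith
  have hlower : elasticityLower a b M B w L ≤ θ := by
    -- The point where the upper cones meet: `a + M u = b + M u'` with `u + u' = l`. Their common
    -- height is `(a + b + M l) / 2`, which gives a quadratic inequality for `l`.
    have h1 := hup ((b - a + M * l) / (2 * M)) ((a - b + M * l) / (2 * M))
      (div_nonneg (by linarith [hab.2]) h2M.le) (div_nonneg (by linarith [hab.1]) h2M.le)
      (by field_simp; ring)
    have e : a * ((b - a + M * l) / (2 * M)) + M * ((b - a + M * l) / (2 * M)) ^ 2 / 2 +
        (b * ((a - b + M * l) / (2 * M)) + M * ((a - b + M * l) / (2 * M)) ^ 2 / 2) =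
        (((a + b + M * l) / 2) ^ 2 - (a ^ 2 + b ^ 2) / 2) / M := by
      field_simp; ring
    rw [e, le_div_iff₀ hM] at h1
    have h2 : Real.sqrt ((a ^ 2 + b ^ 2) / 2 + M * B) ≤ (a + b + M * l) / 2 :=
      Real.sqrt_le_iff.2 ⟨by positivity, by linarith⟩
    rw [elasticityLower, div_le_iff₀ hL, sub_le_iff_le_add, div_le_iff₀ (by positivity)]
    have e2 : (θ * L + w) * (M / 2) = M * l / 2 := by rw [hl]; ring
    rw [e2]; linarith
  unfold elasticitySet
  rw [if_neg hnot]
  split_ifs with hB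
  · refine ⟨hlower, ?_⟩
    rw [lt_div_iff₀ h2M] at hB
    have hv : 0 ≤ (a + b - M * l) / 2 := by
      by_contra hc
      -- If the height at which the lower cones meet were negative, both would reach zero inside the
      -- interval, after `a / M` and `b / M`, and would enclose mass `(a ^ 2 + b ^ 2) / (2 * M)`,
      -- more than `B` in this case.
      have h1 := hlow (a / M) (b / M) (by positivity) (by positivity)
        (by rw [← add_div, div_le_iff₀ hM]; linarith [not_le.1 hc])
      have e : a * (a / M) - M * (a / M) ^ 2 / 2 + (b * (b / M) - M * (b / M) ^ 2 / 2) =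
          (a ^ 2 + b ^ 2) / (2 * M) := by
        field_simp; ring
      rw [e, div_le_iff₀ h2M] at h1
      linarith
    -- The point where the lower cones meet: `a - M u = b - M u'` with `u + u' = l`, at height `(a +
    -- b - M l) / 2`.
    have h1 := hlow ((a - b + M * l) / (2 * M)) ((b - a + M * l) / (2 * M))
      (div_nonneg (by linarith [hab.1]) h2M.le) (div_nonneg (by linarith [hab.2]) h2M.le)
      (le_of_eq (by field_simp; ring))
    have e : a * ((a - b + M * l) / (2 * M)) - M * ((a - b + M * l) / (2 * M)) ^ 2 / 2 +
        (b * ((b - a + M * l) / (2 * M)) - M * ((b - a + M * l) / (2 * M)) ^ 2 / 2) =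
        ((a ^ 2 + b ^ 2) / 2 - ((a + b - M * l) / 2) ^ 2) / M := by
      field_simp; ring
    rw [e, div_le_iff₀ hM] at h1
    have h2 : Real.sqrt ((a ^ 2 + b ^ 2) / 2 - M * B) ≤ (a + b - M * l) / 2 :=
      Real.sqrt_le_iff.2 ⟨hv, by linarith⟩
    rw [elasticityUpper, le_div_iff₀ hL, le_sub_iff_add_le, le_div_iff₀ (by positivity)]
    have e2 : (θ * L + w) * (M / 2) = M * l / 2 := by rw [hl]; ring
    rw [e2]; linarith
  · exact hlower

lemma mem_elasticitySet_of_lipschitz {w L θ : ℝ} (hM : 0 < M) (hL : 0 < L) (hlohi : lo ≤ hi)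
    (hl : hi - lo = w + θ * L) (h0 : ∀ x, 0 ≤ f x)
    (hf : ∀ x ∈ Icc lo hi, ∀ y ∈ Icc lo hi, |f x - f y| ≤ M * |x - y|) :
    θ ∈ elasticitySet (f lo) (f hi) M (∫ x in lo..hi, f x) w L := by
  have hcont := continuousOn_of_abs_sub_le hM.le hf
  have hint : ∀ x ∈ Icc lo hi, ∀ y ∈ Icc lo hi, IntervalIntegrable f volume x y :=
    fun x hx y hy => (hcont.mono (uIcc_subset_Icc hx hy)).intervalIntegrable
  have hlo : lo ∈ Icc lo hi := left_mem_Icc.2 hlohi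
  have hhi : hi ∈ Icc lo hi := right_mem_Icc.2 hlohi
  refine mem_elasticitySet (l := hi - lo) hM hL (h0 lo) (h0 hi) hl ?_ ?_ ?_
  · have := hf lo hlo hi hhi
    rwa [abs_sub_comm lo hi, abs_of_nonneg (sub_nonneg.2 hlohi)] at this
  · intro u u' hu hu' huu
    have hc : lo + u ∈ Icc lo hi := ⟨by linarith, by linarith⟩
    have hc' : hi - u' ∈ Icc lo hi := ⟨by linarith, by linarith⟩
    have h1 := (integral_bounds_left hM.le hf hc).1
    have h2 := (integral_bounds_right hM.le hf hc').1
    -- Between the two cones the density is only known to be nonnegative.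
    have h3 : 0 ≤ ∫ x in (lo + u)..(hi - u'), f x :=
      intervalIntegral.integral_nonneg (by linarith) fun x _ => h0 x
    rw [← intervalIntegral.integral_add_adjacent_intervals (hint _ hlo _ hc) (hint _ hc _ hhi),
      ← intervalIntegral.integral_add_adjacent_intervals (hint _ hc _ hc') (hint _ hc' _ hhi)]
    rw [add_sub_cancel_left] at h1
    rw [sub_sub_cancel] at h2
    linarith
  · intro u u' hu hu' huu
    have hc : lo + u ∈ Icc lo hi := ⟨by linarith, by linarith⟩
    have h1 := (integral_bounds_left hM.le hf hc).2
    have h2 := (integral_bounds_right hM.le hf hc).2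
    rw [← intervalIntegral.integral_add_adjacent_intervals (hint _ hlo _ hc) (hint _ hc _ hhi)]
    rw [add_sub_cancel_left] at h1
    rw [show hi - (lo + u) = u' by linarith] at h2
    linarith

end LipschitzEnvelopes

/-! ### The isoelastic model -/

section Isoelastic

/-- The isoelastic payoff with net-of-tax rate `r`. -/
noncomputable def linearIsoelasticPayoff (r K c θ η y : ℝ) : ℝ :=
  r * (y - K) + c - η / (1 + 1 / θ) * (y / η) ^ (1 + 1 / θ)

variable {r K c θ η : ℝ}

lemma strictConcaveOn_linearIsoelasticPayoff (hθ : 0 < θ) (hη : 0 < η) :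
    StrictConcaveOn ℝ (Ioi 0) (linearIsoelasticPayoff r K c θ η) := by
  have hp : 1 < 1 + 1 / θ := by linarith [one_div_pos.2 hθ]
  refine ⟨convex_Ioi 0, fun x hx y hy hxy s s' hs hs' hss => ?_⟩
  have h1 := (strictConvexOn_rpow hp).2 (x := x / η) (div_nonneg (le_of_lt hx) hη.le) (y := y / η)
    (div_nonneg (le_of_lt hy) hη.le) (by
      intro h; exact hxy ((div_left_inj' hη.ne').1 h)) hs hs' hss
  simp only [smul_eq_mul] at h1 ⊢
  have h2 : s * (x / η) + s' * (y / η) = (s * x + s' * y) / η := by ring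
  rw [h2] at h1
  have h3 : 0 < η / (1 + 1 / θ) := div_pos hη (by linarith)
  have h4 := mul_lt_mul_of_pos_left h1 h3
  unfold linearIsoelasticPayoff
  have h5 : s' = 1 - s := by linarith
  subst h5
  linarith

/-- Measured relative to the claimed maximizer `η * r ^ θ`, the comparison of payoffs is Bernoulli's
inequality `x ^ p ≥ 1 + p (x - 1)` with `p = 1 + 1 / θ`. -/
lemma isMaxOn_linearIsoelasticPayoff (hr : 0 < r) (hθ : 0 < θ) (hη : 0 < η) :
    IsMaxOn (linearIsoelasticPayoff r K c θ η) (Ioi 0) (η * r ^ θ) := by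
  rw [isMaxOn_iff]
  intro y hy
  have hp : 1 < 1 + 1 / θ := by linarith [one_div_pos.2 hθ]
  have hrθ : 0 < r ^ θ := Real.rpow_pos_of_pos hr θ
  obtain ⟨x, hx, rfl⟩ : ∃ x : ℝ, 0 < x ∧ y = x * (η * r ^ θ) :=
    ⟨y / (η * r ^ θ), div_pos hy (by positivity), by field_simp⟩
  have h1 := one_add_mul_self_le_rpow_one_add (s := x - 1) (by linarith) hp.le
  rw [add_sub_cancel] at h1
  have h2 : (r ^ θ) ^ (1 + 1 / θ) = r ^ θ * r := by
    rw [← Real.rpow_mul hr.le, mul_add, mul_one_div, div_self hθ.ne', mul_one,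
      Real.rpow_add hr, Real.rpow_one]
  have h3 : (x * (η * r ^ θ) / η) ^ (1 + 1 / θ) = x ^ (1 + 1 / θ) * (r ^ θ * r) := by
    rw [show x * (η * r ^ θ) / η = x * r ^ θ by field_simp, Real.mul_rpow hx.le hrθ.le, h2]
  have h4 : (η * r ^ θ / η) ^ (1 + 1 / θ) = r ^ θ * r := by
    rw [show η * r ^ θ / η = r ^ θ by field_simp, h2]
  unfold linearIsoelasticPayoff
  rw [h3, h4]
  set p := 1 + 1 / θ with hpdef
  have hp0 : 0 < p := by linarith
  have h5 : 0 ≤ η / p * (r ^ θ * r) := by positivity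
  have h6 := mul_le_mul_of_nonneg_left h1 h5
  have h7 : η / p * (r ^ θ * r) * (1 + p * (x - 1)) =
      η / p * (r ^ θ * r) + r * (x * (η * r ^ θ)) - r * (η * r ^ θ) := by
    field_simp; ring
  linarith

variable {Ω : Type*} [MeasurableSpace Ω] {τ₀ τ₁ K₀ K₁ θ₀ : ℝ} {η Ystar Y : Ω → ℝ}

lemma IsoelasticModel.choice (h : IsoelasticModel τ₀ τ₁ K K₀ K₁ c θ₀ η Ystar Y) (ω : Ω) :
    (η ω * (1 - τ₀) ^ θ₀ ≤ K → Ystar ω = η ω * (1 - τ₀) ^ θ₀) ∧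
      (K ≤ η ω * (1 - τ₁) ^ θ₀ → Ystar ω = η ω * (1 - τ₁) ^ θ₀) ∧
      (K < η ω * (1 - τ₀) ^ θ₀ → η ω * (1 - τ₁) ^ θ₀ < K → Ystar ω = K) := by
  have hη := h.η_pos ω
  have h1 : 0 < 1 - τ₁ := by linarith [h.rates.2]
  have h0 : 0 < 1 - τ₀ := by linarith [h.rates.1]
  have hK : 0 < K := h.window_pos.trans_le h.cutoff_mem_window.1
  have hpay : (fun y => isoelasticPayoff τ₀ τ₁ K c θ₀ y (η ω)) = fun y => if y ≤ K then
      linearIsoelasticPayoff (1 - τ₀) K c θ₀ (η ω) y else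
      linearIsoelasticPayoff (1 - τ₁) K c θ₀ (η ω) y := by
    ext y
    unfold isoelasticPayoff linearIsoelasticPayoff
    split_ifs <;> rfl
  have hmax := (h.argmax ω).2
  rw [hpay] at hmax
  refine kink_choice (strictConcaveOn_linearIsoelasticPayoff h.elasticity_pos hη)
    (strictConcaveOn_linearIsoelasticPayoff h.elasticity_pos hη) hK ?_ ?_ ?_
    (mul_pos hη (Real.rpow_pos_of_pos h0 _))
    (isMaxOn_linearIsoelasticPayoff h0 h.elasticity_pos hη)
    (mul_pos hη (Real.rpow_pos_of_pos h1 _))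
    (isMaxOn_linearIsoelasticPayoff h1 h.elasticity_pos hη) (h.argmax ω).1 hmax
  · intro z _ hz
    unfold linearIsoelasticPayoff
    nlinarith [h.rates.1]
  · simp [linearIsoelasticPayoff]
  · intro z _ hz
    unfold linearIsoelasticPayoff
    nlinarith [h.rates.1]

lemma IsoelasticModel.observed_pos (h : IsoelasticModel τ₀ τ₁ K K₀ K₁ c θ₀ η Ystar Y) (ω : Ω) :
    0 < Y ω := by
  by_cases hY : Y ω ∈ Icc K₀ K₁
  · exact h.window_pos.trans_le hY.1
  · rw [h.frictions.observed_outside ω hY]; exact (h.argmax ω).1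

lemma IsoelasticModel.observed_mem_iff (h : IsoelasticModel τ₀ τ₁ K K₀ K₁ c θ₀ η Ystar Y)
    (ω : Ω) : Y ω ∈ Icc K₀ K₁ ↔
      K₀ ≤ η ω * (1 - τ₀) ^ θ₀ ∧ η ω * (1 - τ₁) ^ θ₀ ≤ K₁ := by
  rw [h.frictions.mem_iff ω, mem_window_iff_of_kink h.cutoff_mem_window (h.choice ω)]

/-- The alternative in the hypothesis makes the events that the observed or the counterfactual
choice falls in a set left of the window coincide, as the comparison of densities requires. -/
lemma IsoelasticModel.observed_of_left (h : IsoelasticModel τ₀ τ₁ K K₀ K₁ c θ₀ η Ystar Y)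
    (ω : Ω) (hω : Y ω < K₀ ∨ η ω * (1 - τ₀) ^ θ₀ < K₀) : Y ω = η ω * (1 - τ₀) ^ θ₀ := by
  obtain ⟨c0, c1, c2⟩ := h.choice ω
  obtain ⟨hK0, hK1⟩ := h.cutoff_mem_window
  have hout : Y ω ∉ Icc K₀ K₁ := by
    rcases hω with hω | hω
    · exact fun hY => absurd hY.1 (not_le.2 hω)
    · rw [h.observed_mem_iff]
      exact fun hY => absurd hY.1 (not_le.2 hω)
  have hY := h.frictions.observed_outside ω hout
  rw [hY]
  rcases hω with hω | hω
  · rw [hY] at hω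
    by_cases hc0 : η ω * (1 - τ₀) ^ θ₀ ≤ K
    · exact c0 hc0
    · exfalso
      by_cases hc1 : K ≤ η ω * (1 - τ₁) ^ θ₀
      · rw [c1 hc1] at hω; linarith
      · rw [c2 (not_le.1 hc0) (not_le.1 hc1)] at hω; linarith
  · exact c0 (hω.le.trans hK0)

lemma IsoelasticModel.observed_of_right (h : IsoelasticModel τ₀ τ₁ K K₀ K₁ c θ₀ η Ystar Y)
    (ω : Ω) (hω : K₁ < Y ω ∨ K₁ < η ω * (1 - τ₁) ^ θ₀) : Y ω = η ω * (1 - τ₁) ^ θ₀ := by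
  obtain ⟨c0, c1, c2⟩ := h.choice ω
  obtain ⟨hK0, hK1⟩ := h.cutoff_mem_window
  have hout : Y ω ∉ Icc K₀ K₁ := by
    rcases hω with hω | hω
    · exact fun hY => absurd hY.2 (not_le.2 hω)
    · rw [h.observed_mem_iff]
      exact fun hY => absurd hY.2 (not_le.2 hω)
  have hY := h.frictions.observed_outside ω hout
  rw [hY]
  rcases hω with hω | hω
  · rw [hY] at hω
    by_cases hc1 : K ≤ η ω * (1 - τ₁) ^ θ₀
    · exact c1 hc1
    · exfalso
      by_cases hc0 : η ω * (1 - τ₀) ^ θ₀ ≤ K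
      · rw [c0 hc0] at hω; linarith
      · rw [c2 (not_le.1 hc0) (not_le.1 hc1)] at hω; linarith
  · exact c1 (hK1.trans hω.le)

end Isoelastic

/-! ### One-sided limits of the observed density. -/

section DensityLimits

variable {Ω : Type*} [MeasurableSpace Ω] {P : Measure Ω} {U V : Ω → ℝ} {f g : ℝ → ℝ}

/-- If `V` agrees with `U + s` where one of them is in `J`, then a density of `V` on `J` is the
density of `U` shifted by `s`. -/
lemma density_eq_shift_ae [IsFiniteMeasure P] (hU : Measurable U) (hV : Measurable V)
    (hf : Measurable f) (hg : Measurable g) (hf0 : ∀ x, 0 ≤ f x) (hg0 : ∀ x, 0 ≤ g x)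
    (hfU : P.map U = volume.withDensity fun x => ENNReal.ofReal (f x))
    {J O : Set ℝ} (hJ : MeasurableSet J) (hJO : J ⊆ O)
    (hgV : (P.map V).restrict O = (volume.restrict O).withDensity fun x => ENNReal.ofReal (g x))
    {s : ℝ} (hUV : ∀ ω, V ω ∈ J ∨ U ω + s ∈ J → V ω = U ω + s) :
    ∀ᵐ x ∂(volume.restrict J), g x = f (x - s) := by
  have hfs : Measurable fun x => ENNReal.ofReal (f (x - s)) :=
    (hf.comp (measurable_id.sub_const s)).ennreal_ofReal
  have hshift : ∀ A, MeasurableSet A → A ⊆ J →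
      P.map V A = ∫⁻ x in A, ENNReal.ofReal (f (x - s)) := by
    intro A hA hAJ
    have e1 : V ⁻¹' A = U ⁻¹' ((fun x => x + s) ⁻¹' A) := by
      ext ω
      simp only [mem_preimage]
      constructor
      · intro h; rw [← hUV ω (Or.inl (hAJ h))]; exact h
      · intro h; rw [hUV ω (Or.inr (hAJ h))]; exact h
    have hA' : MeasurableSet ((fun x => x + s) ⁻¹' A) := (measurable_add_const s) hA
    rw [Measure.map_apply hV hA, e1, ← Measure.map_apply hU hA', hfU, withDensity_apply _ hA',
      ← (measurePreserving_add_right volume s).setLIntegral_comp_preimage hA hfs]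
    simp
  have hgA : ∀ A, MeasurableSet A → A ⊆ J → P.map V A = ∫⁻ x in A, ENNReal.ofReal (g x) := by
    intro A hA hAJ
    conv_lhs => rw [← inter_eq_self_of_subset_left (hAJ.trans hJO), ← Measure.restrict_apply hA,
      hgV, withDensity_apply _ hA, Measure.restrict_restrict hA,
      inter_eq_self_of_subset_left (hAJ.trans hJO)]
  have heq : (volume.restrict J).withDensity (fun x => ENNReal.ofReal (g x)) =
      (volume.restrict J).withDensity fun x => ENNReal.ofReal (f (x - s)) := by
    ext A hA
    rw [withDensity_apply _ hA, withDensity_apply _ hA, Measure.restrict_restrict hA,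
      ← hgA _ (hA.inter hJ) inter_subset_right, ← hshift _ (hA.inter hJ) inter_subset_right]
  rw [withDensity_eq_iff_of_sigmaFinite hg.ennreal_ofReal.aemeasurable hfs.aemeasurable] at heq
  filter_upwards [heq] with x hx
  exact (ENNReal.ofReal_eq_ofReal_iff (hg0 x) (hf0 _)).1 hx

/-- Almost everywhere equality leaves points of agreement in every left neighbourhood of `k`, as
these have positive length. -/
lemma limit_eq_of_ae_eq_left {k a b : ℝ} (hae : ∀ᵐ x ∂(volume.restrict (Iio k)), g x = f x)
    (hg : Tendsto g (𝓝[<] k) (𝓝 a)) (hf : Tendsto f (𝓝[<] k) (𝓝 b)) : a = b := by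
  refine tendsto_nhds_unique_of_frequently_eq hg hf fun hev => ?_
  obtain ⟨l, hl, hsub⟩ := (mem_nhdsLT_iff_exists_Ioo_subset).1 hev
  rw [ae_restrict_iff' measurableSet_Iio, ae_iff] at hae
  have : volume (Ioo l k) = 0 := by
    refine measure_mono_null (fun x hx => ?_) hae
    exact fun h => hsub hx (h hx.2)
  rw [Real.volume_Ioo, ENNReal.ofReal_eq_zero] at this
  linarith [show l < k from hl]

lemma limit_eq_of_ae_eq_right {k a b : ℝ} (hae : ∀ᵐ x ∂(volume.restrict (Ioi k)), g x = f x)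
    (hg : Tendsto g (𝓝[>] k) (𝓝 a)) (hf : Tendsto f (𝓝[>] k) (𝓝 b)) : a = b := by
  refine tendsto_nhds_unique_of_frequently_eq hg hf fun hev => ?_
  obtain ⟨l, hl, hsub⟩ := (mem_nhdsGT_iff_exists_Ioo_subset).1 hev
  rw [ae_restrict_iff' measurableSet_Ioi, ae_iff] at hae
  have : volume (Ioo k l) = 0 := by
    refine measure_mono_null (fun x hx => ?_) hae
    exact fun h => hsub hx (h hx.1)
  rw [Real.volume_Ioo, ENNReal.ofReal_eq_zero] at this
  linarith [show k < l from hl]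

end DensityLimits

/-! ### Elasticity bounds from the Lipschitz condition. -/

section ElasticityBounds

variable {Ω : Type*} [MeasurableSpace Ω] {P : Measure Ω} [IsProbabilityMeasure P]
  {τ₀ τ₁ K K₀ K₁ c θ₀ M : ℝ} {η Ystar Y : Ω → ℝ} {f g : ℝ → ℝ} {a b : ℝ}

theorem elasticity_mem_elasticitySet (h : IsoelasticModel τ₀ τ₁ K K₀ K₁ c θ₀ η Ystar Y)
    (hM : 0 < M)
    (hf : LipschitzLogDensity P η (Real.log (K₀ * (1 - τ₀) ^ (-θ₀)))
      (Real.log (K₁ * (1 - τ₁) ^ (-θ₀))) M f)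
    (hg : ObservedDensity P (fun ω => Real.log (Y ω)) (Real.log K₀) (Real.log K₁) g a b) :
    θ₀ ∈ elasticitySet a b M
      (P.real {ω | Real.log (Y ω) ∈ Icc (Real.log K₀) (Real.log K₁)})
      (Real.log K₁ - Real.log K₀) (Real.log ((1 - τ₀) / (1 - τ₁))) := by
  have h1 : 0 < 1 - τ₁ := by linarith [h.rates.2]
  have h0 : 0 < 1 - τ₀ := by linarith [h.rates.1]
  have hK₀ := h.window_pos
  have hKK : K₀ ≤ K₁ := h.cutoff_mem_window.1.trans h.cutoff_mem_window.2
  have hK₁ : 0 < K₁ := hK₀.trans_le hKK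
  have hL : 0 < Real.log ((1 - τ₀) / (1 - τ₁)) :=
    Real.log_pos ((one_lt_div h1).2 (by linarith [h.rates.1]))
  have hlogK : Real.log K₀ ≤ Real.log K₁ := Real.log_le_log hK₀ hKK
  have elo : Real.log (K₀ * (1 - τ₀) ^ (-θ₀)) = Real.log K₀ - θ₀ * Real.log (1 - τ₀) := by
    rw [Real.log_mul hK₀.ne' (Real.rpow_pos_of_pos h0 _).ne', Real.log_rpow h0]; ring
  have ehi : Real.log (K₁ * (1 - τ₁) ^ (-θ₀)) = Real.log K₁ - θ₀ * Real.log (1 - τ₁) := by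
    rw [Real.log_mul hK₁.ne' (Real.rpow_pos_of_pos h1 _).ne', Real.log_rpow h1]; ring
  rw [elo, ehi] at hf
  have eL : Real.log ((1 - τ₀) / (1 - τ₁)) = Real.log (1 - τ₀) - Real.log (1 - τ₁) :=
    Real.log_div h0.ne' h1.ne'
  -- The length of the bunching interval is affine in the elasticity; solving for `θ₀` produces the
  -- quotients in the bounds.
  have hlen : Real.log K₁ - θ₀ * Real.log (1 - τ₁) - (Real.log K₀ - θ₀ * Real.log (1 - τ₀)) =
      Real.log K₁ - Real.log K₀ + θ₀ * Real.log ((1 - τ₀) / (1 - τ₁)) := by rw [eL]; ring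
  have hlohi : Real.log K₀ - θ₀ * Real.log (1 - τ₀) ≤ Real.log K₁ - θ₀ * Real.log (1 - τ₁) := by
    have := mul_pos h.elasticity_pos hL
    linarith
  have hlogη : ∀ r : ℝ, 0 < r → ∀ ω, Real.log (η ω * r ^ θ₀) =
      Real.log (η ω) + θ₀ * Real.log r := by
    intro r hr ω
    rw [Real.log_mul (h.η_pos ω).ne' (Real.rpow_pos_of_pos hr _).ne', Real.log_rpow hr]
  have hpos : ∀ r : ℝ, 0 < r → ∀ ω, 0 < η ω * r ^ θ₀ := fun r hr ω =>
    mul_pos (h.η_pos ω) (Real.rpow_pos_of_pos hr _)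
  have hmη : Measurable fun ω => Real.log (η ω) := h.measurable_η.log
  have hmY : Measurable fun ω => Real.log (Y ω) := h.measurable_Y.log
  -- the limits of the observed density are the values of the density of `log η`
  have hale : ∀ᵐ x ∂(volume.restrict (Iio (Real.log K₀))),
      g x = f (x - θ₀ * Real.log (1 - τ₀)) := by
    refine density_eq_shift_ae (O := (Icc (Real.log K₀) (Real.log K₁))ᶜ) hmη hmY hf.measurable
      hg.measurable hf.nonneg hg.nonneg hf.isDensity measurableSet_Iio (fun x hx hx' => absurd hx'.1 (not_le.2 hx))
      hg.isDensity fun ω hω => ?_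
    rw [← hlogη _ h0, mem_Iio, mem_Iio, Real.log_lt_log_iff (h.observed_pos ω) hK₀,
      Real.log_lt_log_iff (hpos _ h0 ω) hK₀] at hω
    rw [h.observed_of_left ω hω, hlogη _ h0]
  have hari : ∀ᵐ x ∂(volume.restrict (Ioi (Real.log K₁))),
      g x = f (x - θ₀ * Real.log (1 - τ₁)) := by
    refine density_eq_shift_ae (O := (Icc (Real.log K₀) (Real.log K₁))ᶜ) hmη hmY hf.measurable
      hg.measurable hf.nonneg hg.nonneg hf.isDensity measurableSet_Ioi (fun x hx hx' => absurd hx'.2 (not_le.2 hx))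
      hg.isDensity fun ω hω => ?_
    rw [← hlogη _ h1, mem_Ioi, mem_Ioi, Real.log_lt_log_iff hK₁ (h.observed_pos ω),
      Real.log_lt_log_iff hK₁ (hpos _ h1 ω)] at hω
    rw [h.observed_of_right ω hω, hlogη _ h1]
  -- Continuity of `f` at the end point identifies the limit from outside the bunching interval with
  -- the value that starts the cone inside it.
  have ha : a = f (Real.log K₀ - θ₀ * Real.log (1 - τ₀)) := by
    refine limit_eq_of_ae_eq_left hale hg.left_limit (Tendsto.mono_left ?_ nhdsWithin_le_nhds)
    exact hf.continuousAt_lo.tendsto.comp (Continuous.tendsto (by fun_prop) _)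
  have hb : b = f (Real.log K₁ - θ₀ * Real.log (1 - τ₁)) := by
    refine limit_eq_of_ae_eq_right hari hg.right_limit (Tendsto.mono_left ?_ nhdsWithin_le_nhds)
    exact hf.continuousAt_hi.tendsto.comp (Continuous.tendsto (by fun_prop) _)
  -- the bunching mass
  have hB : P.real {ω | Real.log (Y ω) ∈ Icc (Real.log K₀) (Real.log K₁)} =
      ∫ x in (Real.log K₀ - θ₀ * Real.log (1 - τ₀))..(Real.log K₁ - θ₀ * Real.log (1 - τ₁)),
        f x := by
    have e1 : {ω | Real.log (Y ω) ∈ Icc (Real.log K₀) (Real.log K₁)} =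
        (fun ω => Real.log (η ω)) ⁻¹' Icc (Real.log K₀ - θ₀ * Real.log (1 - τ₀))
          (Real.log K₁ - θ₀ * Real.log (1 - τ₁)) := by
      ext ω
      have hw := h.observed_mem_iff ω
      rw [← Real.log_le_log_iff hK₀ (hpos _ h0 ω), ← Real.log_le_log_iff (hpos _ h1 ω) hK₁,
        hlogη _ h0, hlogη _ h1, mem_Icc, ← Real.log_le_log_iff hK₀ (h.observed_pos ω),
        ← Real.log_le_log_iff (h.observed_pos ω) hK₁] at hw
      simp only [mem_ofPred_eq, mem_preimage, mem_Icc]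
      rw [hw, sub_le_iff_le_add, le_sub_iff_add_le]
    rw [e1, ← map_measureReal_apply hmη measurableSet_Icc, hf.isDensity, measureReal_def,
      withDensity_apply _ measurableSet_Icc, intervalIntegral.integral_of_le hlohi,
      ← integral_Icc_eq_integral_Ioc,
      integral_eq_lintegral_of_nonneg_ae (Eventually.of_forall hf.nonneg)
        hf.measurable.aestronglyMeasurable]
  rw [ha, hb, hB]
  exact mem_elasticitySet_of_lipschitz hM hL hlohi hlen hf.nonneg hf.lipschitz

end ElasticityBounds

theorem theoremA1 {Ω : Type*} [MeasurableSpace Ω] (P : Measure Ω) [IsProbabilityMeasure P] :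
    -- bounds on the bunching probability under piecewise analytic envelopes
    (∀ (dx dθ : ℕ) (D : BunchingDesign Ω dx dθ)
      (κ : EuclideanSpace ℝ (Fin dθ) → Kernel ℝ ℝ) (kbar : EuclideanSpace ℝ (Fin dθ) → ℝ)
      (S : ℕ) (t : ℕ → ℝ) (flow fup : ℕ → ℝ → ℝ) (ρ βlow βup δ : ℝ),
      D.Framework → D.KinkedPayoff → D.InvertibleEquations → D.DataAndFrictions P →
      D.WeightCondition P → D.IsUpperLimit P kbar →
      -- the conditional law of `R(k₁, X, θ)` given the counterfactual choice
      (∀ θ ∈ D.params, IsCondLaw (D.PT P) (D.counterfactual 0)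
        (fun ω => D.reversion D.k₁ (D.X ω) θ) (κ θ)) →
      -- knots
      0 < S → t 0 = D.k₀ → (∀ s < S, t s < t (s + 1)) → t S = kbar D.θ₀ →
      -- analyticity of the pieces and of the conditional quantiles
      δ < 1 →
      (∀ s ∈ Finset.Icc 1 S, ∀ θ ∈ D.params,
        AnalyticityCondition D.k₀ (kbar θ) (fup s) (condQuantile (κ θ)) ρ βup δ ∧
        AnalyticityCondition D.k₀ (kbar θ) (flow s) (condQuantile (κ θ)) ρ βlow δ) →
      D.EnvelopeCondition P (kbar D.θ₀) (piecewiseFn S t flow) (piecewiseFn S t fup) →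
      (∀ θ ∈ D.params, ∀ s < S, t s ≤ kbar θ →
        MomentSeriesDefined (κ θ) (Icc D.k₀ (kbar θ)) t fup s ∧
        MomentSeriesDefined (κ θ) (Icc D.k₀ (kbar θ)) t flow s) ∧
      (D.PT P).real {ω | D.Y ω ∈ Icc D.k₀ D.k₁} ∈
        Icc (bunchingBound (κ D.θ₀) (Icc D.k₀ (kbar D.θ₀)) S t flow)
          (bunchingBound (κ D.θ₀) (Icc D.k₀ (kbar D.θ₀)) S t fup)) ∧
    -- elasticity bounds in the isoelastic model with a Lipschitz log density
    (∀ (τ₀ τ₁ K K₀ K₁ c θ₀ M : ℝ) (η Ystar Y : Ω → ℝ) (f g : ℝ → ℝ) (a b : ℝ),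
      IsoelasticModel τ₀ τ₁ K K₀ K₁ c θ₀ η Ystar Y →
      0 < M →
      LipschitzLogDensity P η (Real.log (K₀ * (1 - τ₀) ^ (-θ₀)))
        (Real.log (K₁ * (1 - τ₁) ^ (-θ₀))) M f →
      ObservedDensity P (fun ω => Real.log (Y ω)) (Real.log K₀) (Real.log K₁) g a b →
      θ₀ ∈ elasticitySet a b M
        (P.real {ω | Real.log (Y ω) ∈ Icc (Real.log K₀) (Real.log K₁)})
        (Real.log K₁ - Real.log K₀) (Real.log ((1 - τ₀) / (1 - τ₁)))) := by
  refine ⟨?_, ?_⟩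
  · intro dx dθ D κ kbar S t flow fup ρ βlow βup δ hF hK hI hD hW hU hκ hS ht0 ht htS hδ hana henv
    refine ⟨fun θ hθ s hs hts => ?_, ?_⟩
    · have := (hκ θ hθ).1
      have hmem : t s ∈ Icc D.k₀ (kbar θ) := ⟨ht0 ▸ knot_le_knot ht (Nat.zero_le s) hs.le, hts⟩
      exact ⟨momentSeriesDefined_of_analyticityCondition hδ (fun s hs => (hana s hs θ hθ).1) hs hmem,
        momentSeriesDefined_of_analyticityCondition hδ (fun s hs => (hana s hs θ hθ).2) hs hmem⟩
    · exact bunching_mass_mem_bounds hF hK hI hD hW hU hκ hS ht0 ht htS hδ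
        (fun s hs => (hana s hs _ hF.true_param).1) (fun s hs => (hana s hs _ hF.true_param).2) henv
  · intro τ₀ τ₁ K K₀ K₁ c θ₀ M η Ystar Y f g a b h hM hf hg
    exact elasticity_mem_elasticitySet h hM hf hg
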